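/- **Setting.** Let $X$ be a totally ordered, order complete set (every nonempty subset that is bounded above has a supremum; for instance a compact interval of $\mathbb{R}$) with the order topology, let $\mathcal{B}$ be its Borel $\sigma$-algebra, and let $\mu$ be a regular Borel probability measure on $X$. A function $f:X\to\mathbb{R}$ has bounded variation if $\mathrm{var}(f)=\sup\sum_{i=1}^n|f(x_{i-1})-f(x_i)|<\infty$, the supremum being over all finite ordered sequences in $X$. If $m$ is a $\sigma$-finite measure on $\mathcal B$ for which a measurable map $T$ is nonsingular, the transfer operator of $T$ with respect to $m$ is the operator on $L^1(m)$ that sends $f$ to the unique element of $L^1(m)$ whose integral over each $A\in\mathcal{B}$ is $\int_{T^{-1}(A)}f\,dm$. Let $P$ denote the transfer operator with respect to $\mu$. Let $V\subset X$ be open and dense with $\mu(V)=1$ and let $T:V\to X$ be continuous and nonsingular with respect to $\mu$; extend $T$ to a measurable map $X\to X$ (the values off the null set $X\setminus V$ are arbitrary). $(T,\mu)$ is a *piecewise uniformly expanding map* if 1. there is a countable family $\mathcal{Z}$ of closed intervals with pairwise disjoint interiors such that $V\subset\bigcup_{Z\in\mathcal{Z}}Z$ and, for each $Z\in\mathcal{Z}$,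 the set $Z\cap(X\setminus V)$ consists exactly of the endpoints of $Z$; 2. for each $Z\in\mathcal{Z}$, $T|_{Z\cap V}$ extends to a monotone (increasing or decreasing) homeomorphism of $Z$ onto some interval of $X$; 3. there is a function $g:X\to[0,\infty)$ of bounded variation with $g|_{X\setminus V}=0$ such that, for every $f\in L^1(\mu)$, $Pf(x)=\sum_{z\in T^{-1}(x)}g(z)f(z)$ for $\mu$-a.e. $x$; 4. $\sup_{x\in V}g(x)<1$. An *asymptotically periodic decomposition* of $(T,\mu)$ consists of integers $l\ge0$ and $r_1,\dots,r_l\ge1$, densities $g_{i,j}\in L^1(\mu)$ (that is, $g_{i,j}\ge0$ and $\int g_{i,j}\,d\mu=1$) and bounded linear functionals $\lambda_{i,j}$ on $L^1(\mu)$, $1\le i\le l$, $1\le j\le r_i$, such that the $g_{i,j}$ have mutually disjoint supports, $Pg_{i,j}=g_{i,j+1}$ for $1\le j<r_i$, $Pg_{i,r_i}=g_{i,1}$, and $$\lim_{n\to\infty}\Bigl\|P^n\Bigl(f-\sum_{i=1}^l\sum_{j=1}^{r_i}\lambda_{i,j}(f)g_{i,j}\Bigr)\Bigr\|_{L^1(\mu)}=0\qquad\text{for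 all }f\in L^1(\mu).$$ **Corollary.** Let $(T,\mu)$ be a piecewise uniformly expanding map and let $\nu$ be a $T$-invariant probability measure that is absolutely continuous with respect to $\mu$. Let $\mathcal{P}_T$ be the transfer operator of $T$ with respect to $\nu$, and let $\mathcal{I}$ be the $\sigma$-algebra of all $A\in\mathcal B$ with $T^{-1}(A)=A$. Let $h:X\to\mathbb{R}$ be of bounded variation with $E_\nu(h\mid\mathcal{I})=0$. Then $(T,\mu)$ has an asymptotically periodic decomposition, and for every such decomposition, with $r=\prod_{i=1}^l r_i$, $$\sum_{n=1}^\infty n^{-3/2}\Bigl\|\sum_{k=0}^{n-1}\mathcal{P}_T^{rk}h_r\Bigr\|_{L^2(\nu)}<\infty,\qquad\text{where } h_r=\frac1{\sqrt r}\sum_{k=0}^{r-1}h\circ T^k .$$ -/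

import Mathlib

open MeasureTheory Filter Topology

noncomputable section

/-- The transfer (Perron–Frobenius) operator of `T` with respect to `μ`: `transferOp T μ f` is the
Radon–Nikodym density with respect to `μ` of the image under `T` of the signed measure `f dμ`. -/
def transferOp {X : Type*} [MeasurableSpace X] (T : X → X) (μ : Measure X) (f : X → ℝ) : X → ℝ :=
  SignedMeasure.rnDeriv ((μ.withDensityᵥ f).map T) μ

theorem transferOp_integrable {X : Type*} [MeasurableSpace X] (T : X → X) (μ : Measure X)
    (f : X → ℝ) : Integrable (transferOp T μ f) μ :=
  SignedMeasure.integrable_rnDeriv _ _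

/-- The defining property: `∫_A P f dμ = ∫_{T⁻¹ A} f dμ` for all measurable `A`. -/
theorem setIntegral_transferOp {X : Type*} [MeasurableSpace X] {T : X → X} {μ : Measure X}
    [SigmaFinite μ] (hT : Measure.QuasiMeasurePreserving T μ μ) {f : X → ℝ}
    (hf : Integrable f μ) {A : Set X} (hA : MeasurableSet A) :
    ∫ x in A, transferOp T μ f x ∂μ = ∫ x in T ⁻¹' A, f x ∂μ := by
  have hac : (μ.withDensityᵥ f).map T ≪ᵥ μ.toENNRealVectorMeasure := by
    refine VectorMeasure.AbsolutelyContinuous.mk fun s hs h0 => ?_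
    rw [Measure.toENNRealVectorMeasure_apply_measurable hs] at h0
    rw [VectorMeasure.map_apply _ hT.measurable hs, withDensityᵥ_apply hf (hT.measurable hs)]
    exact setIntegral_measure_zero _ (hT.preimage_null h0)
  have h := SignedMeasure.withDensityᵥ_rnDeriv_eq _ μ hac
  rw [← withDensityᵥ_apply (transferOp_integrable T μ f) hA]
  unfold transferOp
  rw [h, VectorMeasure.map_apply _ hT.measurable hA, withDensityᵥ_apply hf (hT.measurable hA)]

/-- `(T, μ)` is a piecewise uniformly expanding map with domain `V`. The continuous map `V → X` is
represented by a measurable map `X → X`; its values outside the `μ`-null set `X \ V` are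
arbitrary. -/
structure IsPiecewiseUniformlyExpanding {X : Type*} [ConditionallyCompleteLinearOrder X]
    [TopologicalSpace X] [MeasurableSpace X] (T : X → X) (μ : Measure X) (V : Set X) : Prop where
  isOpen_domain : IsOpen V
  dense_domain : Dense V
  measure_domain : μ V = 1
  measurable : Measurable T
  continuousOn : ContinuousOn T V
  nonsingular : Measure.QuasiMeasurePreserving T μ μ
  /-- A countable family of closed intervals (closed order-convex sets) with disjoint interiors
  covers `V`; each interval misses `V` exactly in its endpoints, and on each of them `T` extends
  to a monotone homeomorphism onto some interval. -/
  exists_partition : ∃ 𝒵 : Set (Set X), 𝒵.Countable ∧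
    (∀ Z ∈ 𝒵, IsClosed Z ∧ Z.OrdConnected) ∧
    𝒵.PairwiseDisjoint interior ∧
    V ⊆ ⋃₀ 𝒵 ∧
    (∀ Z ∈ 𝒵, Z ∩ Vᶜ = {x | IsLeast Z x ∨ IsGreatest Z x}) ∧
    ∀ Z ∈ 𝒵, ∃ φ : X → X, Set.EqOn φ T (Z ∩ V) ∧ IsEmbedding (Z.domRestrict φ) ∧
      (φ '' Z).OrdConnected ∧ (MonotoneOn φ Z ∨ AntitoneOn φ Z)
  /-- The transfer operator has a weight of bounded variation that vanishes off `V` and whose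
  supremum over `V` is smaller than `1`. -/
  exists_weight : ∃ g : X → ℝ, (∀ x, 0 ≤ g x) ∧ BoundedVariationOn g Set.univ ∧
    (∀ x ∉ V, g x = 0) ∧
    (∀ f : X → ℝ, Integrable f μ →
      transferOp T μ f =ᵐ[μ] fun x => ∑' z : (T ⁻¹' {x} : Set X), g z * f z) ∧
    ∃ c : ℝ, c < 1 ∧ ∀ x ∈ V, g x ≤ c

/-- Asymptotic periodicity of `(T, μ)` with `l` cycles of lengths `r i`: densities `g i j` with
mutually disjoint supports, permuted cyclically by the transfer operator for each `i`, and bounded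
linear functionals `lam i j` on `L¹(μ)` such that `Pⁿ (f - ∑ lam i j (f) g i j) → 0` in `L¹(μ)`. -/
structure IsAsymptoticallyPeriodicWith {X : Type*} [MeasurableSpace X] (T : X → X) (μ : Measure X)
    {l : ℕ} (r : Fin l → ℕ) (g : (i : Fin l) → Fin (r i) → X → ℝ)
    (lam : (i : Fin l) → Fin (r i) → (Lp ℝ 1 μ →L[ℝ] ℝ)) : Prop where
  length_pos : ∀ i, 0 < r i
  integrable : ∀ i j, Integrable (g i j) μ
  nonneg : ∀ i j, 0 ≤ᵐ[μ] g i j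
  integral_eq_one : ∀ i j, ∫ x, g i j x ∂μ = 1
  disjoint_supports : ∀ p q : (Σ i, Fin (r i)), p ≠ q →
    (fun x => g p.1 p.2 x * g q.1 q.2 x) =ᵐ[μ] 0
  cyclic : ∀ i j, transferOp T μ (g i j) =ᵐ[μ] g i (finRotate (r i) j)
  tendsto : ∀ f : Lp ℝ 1 μ, Tendsto
    (fun n : ℕ => eLpNorm ((transferOp T μ)^[n]
      (fun x => f x - ∑ i, ∑ j, lam i j f * g i j x)) 1 μ) atTop (𝓝 0)

/-- `h_r = r^{-1/2} ∑_{k<r} h ∘ T^k`. -/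
def blockSum {X : Type*} (T : X → X) (h : X → ℝ) (r : ℕ) : X → ℝ :=
  fun x => (1 / Real.sqrt r) * ∑ k ∈ Finset.range r, h (T^[k] x)

/-- `∑_{n ≥ 1} n^{-3/2} ‖∑_{k<n} P_T^{rk} h_r‖₂ < ∞`, where `P_T` is the transfer operator on
`L¹(ν)`; the summation index below is `n - 1`. -/
def BlockSummability {X : Type*} [MeasurableSpace X] (T : X → X) (ν : Measure X) (h : X → ℝ)
    (r : ℕ) : Prop :=
  ∑' n : ℕ, ENNReal.ofReal (((n : ℝ) + 1) ^ (-(3 / 2) : ℝ)) *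
    eLpNorm (∑ k ∈ Finset.range (n + 1), (transferOp T ν)^[r * k] (blockSum T h r)) 2 ν < ⊤

end

-- Everything rests on a Lasota–Yorke inequality for `P` on functions of bounded variation.
-- Variation is measured by `zVar`, with the function set to 0 at two added end points; it then
-- dominates the supremum and behaves well under restriction to intervals and monotone changes of
-- variable. Since `g` vanishes off `V`, hence at the ends of all branches, `g u` can be cut along
-- the countably many branches without raising the total variation. So `P u` varies no more than `g
-- u`, and `Pⁿ u` no more than `gₙ u`, where `|gₙ| ≤ cⁿ`. Cutting `X` into finitely many intervals
-- on which `g_N` oscillates little gives `var(P^N u) ≤ var(u)/2 + K ‖u‖₁`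
-- (`IsWeightedBranchSystem.exists_lasotaYorke`). As `μ` has no atoms, sets of bounded variation
-- norm are totally bounded in `L¹(μ)`.
--
-- Existence of the decomposition is then soft. For a contraction with such an inequality the
-- recurrent vectors form a finite-dimensional space on which it is a bijective isometry, and every
-- vector is asymptotic to a unique recurrent one. For a positive operator preserving the norm of
-- positive vectors this space is a lattice; the extreme points of its set of densities are finitely
-- many, disjoint, spanning and permuted (`IsMarkov.exists_decomposition`). The cycles of this
-- permutation are the cycles of the decomposition.
--
-- For the summability let `ρ = dν/dμ` and let `Q` be the transfer operator for `ν`. Multiplication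
-- by `ρ` embeds `L¹(ν)` isometrically in `L¹(μ)` and intertwines `Q` with `P`. The density `ρ` is
-- fixed, so recurrent, so a limit of functions of bounded variation norm at most a constant; the
-- same holds for `h ρ`. For any decomposition, `h` is therefore a part `w` with `Q^r w = w` plus a
-- remainder that decays exponentially. The sum of `Q^i w` over `i < r` is a fixed point of `Q`
-- whose integrals over invariant sets vanish, because `E(h | I) = 0`; hence it is 0. Since `Q^r h_r
-- = r^(-1/2) ∑_{i=1}^r Q^i h`, the part `w` drops out, and `Q^(rk) h_r` decays exponentially in
-- `L¹(ν)`. It is also uniformly bounded, so it decays in `L²(ν)`; the partial sums are bounded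
-- there and `n^(-3/2)` is summable.

open scoped ENNReal NNReal

-- Variation with zero boundary values.

noncomputable section

/-- The function on the order completed by a bottom and a top element that takes the values `b` and
`t` there and is `f` elsewhere. -/
def extRec {X β : Type*} (b t : β) (f : X → β) : WithBot (WithTop X) → β :=
  WithBot.recBotCoe b (WithTop.recTopCoe t f)

@[simp] theorem extRec_bot {X β : Type*} (b t : β) (f : X → β) : extRec b t f ⊥ = b := rfl

@[simp] theorem extRec_top {X β : Type*} (b t : β) (f : X → β) : extRec b t f ⊤ = t := rfl

@[simp] theorem extRec_coe {X β : Type*} (b t : β) (f : X → β) (x : X) :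
    extRec b t f ((x : WithTop X) : WithBot (WithTop X)) = f x := rfl

/-- The extension of `u` by `0` to the order completed by a bottom and a top element. -/
def zeroExt {X : Type*} (u : X → ℝ) : WithBot (WithTop X) → ℝ := extRec 0 0 u

@[simp] theorem zeroExt_bot {X : Type*} (u : X → ℝ) : zeroExt u ⊥ = 0 := rfl

@[simp] theorem zeroExt_top {X : Type*} (u : X → ℝ) : zeroExt u ⊤ = 0 := rfl

@[simp] theorem zeroExt_coe {X : Type*} (u : X → ℝ) (x : X) :
    zeroExt u ((x : WithTop X) : WithBot (WithTop X)) = u x := rfl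

/-- The variation of `u` on `X` where `u` is considered to vanish at both ends of `X`. -/
def zVar {X : Type*} [LinearOrder X] (u : X → ℝ) : ℝ≥0∞ :=
  eVariationOn (zeroExt u) Set.univ

/-- Case distinction for points of the extended order. -/
@[elab_as_elim]
theorem extended_cases {X : Type*} {p : WithBot (WithTop X) → Prop} (x : WithBot (WithTop X))
    (hb : p ⊥) (ht : p ⊤)
    (hc : ∀ x : X, p ((x : WithTop X) : WithBot (WithTop X))) : p x := by
  induction x using WithBot.recBotCoe with
  | bot => exact hb
  | coe x =>
    induction x using WithTop.recTopCoe with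
    | top => exact ht
    | coe x => exact hc x

/-- Increments of `F` are paid for by a potential `D`, and the payments telescope. The hypothesis is
additive because subtraction in `ℝ≥0∞` truncates. -/
theorem eVariationOn_le_of_dominated {α E : Type*} [LinearOrder α] [PseudoEMetricSpace E]
    {F : α → E} {D : α → ℝ≥0∞} {s : Set α} {M : ℝ≥0∞} (hM : ∀ x ∈ s, D x ≤ M)
    (h : ∀ x ∈ s, ∀ y ∈ s, x ≤ y → edist (F y) (F x) + D x ≤ D y) :
    eVariationOn F s ≤ M := by
  refine iSup_le fun p => ?_
  obtain ⟨n, u, hu, us⟩ := p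
  have key : ∀ n, ∑ i ∈ Finset.range n, edist (F (u (i + 1))) (F (u i)) ≤ D (u n) := by
    intro n
    induction n with
    | zero => simp
    | succ n ih =>
      rw [Finset.sum_range_succ, add_comm]
      exact (add_le_add le_rfl ih).trans (h _ (us _) _ (us _) (hu n.le_succ))
  exact (key n).trans (hM _ (us n))

theorem ENNReal.edist_eq_abs (a b : ℝ) : edist a b = ENNReal.ofReal |a - b| := by
  rw [edist_dist, Real.dist_eq]

theorem edist_mul_le (a b c d : ℝ) :
    edist (a * b) (c * d) ≤ ENNReal.ofReal |a| * edist b d + ENNReal.ofReal |d| * edist a c := by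
  rw [ENNReal.edist_eq_abs, ENNReal.edist_eq_abs, ENNReal.edist_eq_abs,
    ← ENNReal.ofReal_mul (abs_nonneg _), ← ENNReal.ofReal_mul (abs_nonneg _),
    ← ENNReal.ofReal_add (by positivity) (by positivity), ← abs_mul, ← abs_mul]
  refine ENNReal.ofReal_le_ofReal ?_
  calc |a * b - c * d| = |a * (b - d) + d * (a - c)| := by ring_nf
    _ ≤ _ := abs_add_le _ _

theorem eVariationOn_mul_le {α : Type*} [LinearOrder α] {u v : α → ℝ} {s : Set α} {a b : ℝ≥0∞}
    (ha : ∀ x ∈ s, ENNReal.ofReal |u x| ≤ a) (hb : ∀ x ∈ s, ENNReal.ofReal |v x| ≤ b) :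
    eVariationOn (fun x => u x * v x) s ≤ a * eVariationOn v s + b * eVariationOn u s := by
  refine iSup_le fun p => ?_
  obtain ⟨n, w, hw, ws⟩ := p
  calc ∑ i ∈ Finset.range n, edist (u (w (i + 1)) * v (w (i + 1))) (u (w i) * v (w i))
      ≤ ∑ i ∈ Finset.range n, (a * edist (v (w (i + 1))) (v (w i))
          + b * edist (u (w (i + 1))) (u (w i))) := by
        gcongr with i hi
        refine (edist_mul_le _ _ _ _).trans ?_
        gcongr
        · exact ha _ (ws _)
        · exact hb _ (ws _)
    _ = a * ∑ i ∈ Finset.range n, edist (v (w (i + 1))) (v (w i))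
          + b * ∑ i ∈ Finset.range n, edist (u (w (i + 1))) (u (w i)) := by
        rw [Finset.sum_add_distrib, Finset.mul_sum, Finset.mul_sum]
    _ ≤ _ := by
        gcongr
        · exact eVariationOn.sum_le hw ws
        · exact eVariationOn.sum_le hw ws

section

variable {X : Type*} [LinearOrder X]

/-- The extended function travels from 0 to `u x` and back to 0. Through this bound `zVar` serves as
a norm of bounded variation. -/
theorem zVar_bound (u : X → ℝ) (x : X) : 2 * ENNReal.ofReal |u x| ≤ zVar u := by
  have h1 : edist (zeroExt u ⊥) (zeroExt u ((x : WithTop X) : WithBot (WithTop X)))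
      ≤ eVariationOn (zeroExt u) (Set.Iic ((x : WithTop X) : WithBot (WithTop X))) :=
    eVariationOn.edist_le _ (by simp) (by simp)
  have h2 : edist (zeroExt u ((x : WithTop X) : WithBot (WithTop X)))
      (zeroExt u ⊤)
      ≤ eVariationOn (zeroExt u) (Set.Ici ((x : WithTop X) : WithBot (WithTop X))) :=
    eVariationOn.edist_le _ (by simp) (by simp)
  have h3 := eVariationOn.add_le_union (zeroExt u)
    (s := Set.Iic ((x : WithTop X) : WithBot (WithTop X)))
    (t := Set.Ici ((x : WithTop X) : WithBot (WithTop X)))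
    (fun a ha b hb => le_trans ha hb)
  rw [ENNReal.edist_eq_abs] at h1 h2
  simp only [zeroExt_bot, zeroExt_coe, zeroExt_top, zero_sub, abs_neg, sub_zero] at h1 h2
  rw [two_mul]
  exact (add_le_add h1 h2).trans (h3.trans (eVariationOn.mono _ (Set.subset_univ _)))

theorem ofReal_abs_le_zVar (u : X → ℝ) (x : X) : ENNReal.ofReal |u x| ≤ zVar u := by
  refine le_trans ?_ (zVar_bound u x)
  rw [two_mul]
  exact le_self_add

theorem eVariationOn_le_zVar (u : X → ℝ) (s : Set X) : eVariationOn u s ≤ zVar u := by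
  have : u = zeroExt u ∘ fun x : X => ((x : WithTop X) : WithBot (WithTop X)) := rfl
  conv_lhs => rw [this]
  refine eVariationOn.comp_le_of_monotoneOn _ _ (fun x _ y _ h => ?_) (fun _ _ => Set.mem_univ _)
  simpa using h

open Classical in
/-- Change of variables on an order-convex set. -/
theorem zVar_indicator_comp_le {Y : Type*} [LinearOrder Y] (u : X → ℝ) {J : Set Y}
    (hJ : J.OrdConnected) {φ : Y → X} (hφ : MonotoneOn φ J ∨ AntitoneOn φ J) :
    zVar (J.indicator (u ∘ φ)) ≤ zVar u := by
  rcases hφ with hφ | hφ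
  -- Points off `J` go to the added end on their side of `J`, where the extension is 0;
  -- order-convexity of `J` makes `ψ` monotone.
  · let ψ : WithBot (WithTop Y) → WithBot (WithTop X) :=
      extRec ⊥ ⊤
        fun y => if y ∈ J then ((φ y : WithTop X) : WithBot (WithTop X))
          else if ∃ j ∈ J, y < j then ⊥ else ⊤
    have h1 : zeroExt (J.indicator (u ∘ φ)) = zeroExt u ∘ ψ := by
      funext y
      refine extended_cases y rfl rfl fun y => ?_
      by_cases hy : y ∈ J
      · simp [ψ, hy]
      · by_cases hy' : ∃ j ∈ J, y < j <;> simp [ψ, hy, hy']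
    have h2 : Monotone ψ := by
      intro y z
      refine extended_cases y (fun _ => bot_le) (fun h => ?_) fun y => ?_
      · revert h
        refine extended_cases z (by simp) (by simp) (by simp)
      · refine extended_cases z (by simp) (fun _ => ?_) fun z h => ?_
        · exact le_top
        have h : y ≤ z := by simpa using h
        by_cases hy : y ∈ J <;> by_cases hz : z ∈ J
        · simpa [ψ, hy, hz] using hφ hy hz h
        · have : ¬ ∃ j ∈ J, z < j := fun ⟨j, hj, hzj⟩ => hz (hJ.out hy hj ⟨h, hzj.le⟩)
          simp only [ψ, extRec_coe, hz, if_false, this]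
          exact le_top
        · have : ∃ j ∈ J, y < j := ⟨z, hz, lt_of_le_of_ne h fun e => hy (e ▸ hz)⟩
          simp [ψ, hy, this]
        · by_cases hz' : ∃ j ∈ J, z < j
          · have : ∃ j ∈ J, y < j := hz'.imp fun j hj => ⟨hj.1, h.trans_lt hj.2⟩
            simp [ψ, hy, this]
          · simp only [ψ, extRec_coe, hz, if_false, hz']
            exact le_top
    unfold zVar
    rw [h1]
    exact eVariationOn.comp_le_of_monotoneOn _ _ (h2.monotoneOn _) fun _ _ => Set.mem_univ _
  · let ψ : WithBot (WithTop Y) → WithBot (WithTop X) :=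
      extRec ⊤ ⊥
        fun y => if y ∈ J then ((φ y : WithTop X) : WithBot (WithTop X))
          else if ∃ j ∈ J, y < j then ⊤ else ⊥
    have h1 : zeroExt (J.indicator (u ∘ φ)) = zeroExt u ∘ ψ := by
      funext y
      refine extended_cases y rfl rfl fun y => ?_
      by_cases hy : y ∈ J
      · simp [ψ, hy]
      · by_cases hy' : ∃ j ∈ J, y < j <;> simp [ψ, hy, hy']
    have h2 : Antitone ψ := by
      intro y z
      refine extended_cases y (fun _ => ?_) (fun h => ?_) fun y => ?_
      · exact le_top
      · revert h
        refine extended_cases z (by simp) (by simp) (by simp)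
      · refine extended_cases z (by simp) (fun _ => bot_le) fun z h => ?_
        have h : y ≤ z := by simpa using h
        by_cases hy : y ∈ J <;> by_cases hz : z ∈ J
        · simpa [ψ, hy, hz] using hφ hy hz h
        · have : ¬ ∃ j ∈ J, z < j := fun ⟨j, hj, hzj⟩ => hz (hJ.out hy hj ⟨h, hzj.le⟩)
          simp [ψ, hz, this]
        · have : ∃ j ∈ J, y < j := ⟨z, hz, lt_of_le_of_ne h fun e => hy (e ▸ hz)⟩
          simp only [ψ, extRec_coe, hy, if_false, this, if_true]
          exact le_top
        · by_cases hz' : ∃ j ∈ J, z < j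
          · have : ∃ j ∈ J, y < j := hz'.imp fun j hj => ⟨hj.1, h.trans_lt hj.2⟩
            simp only [ψ, extRec_coe, hy, if_false, this, if_true]
            exact le_top
          · simp [ψ, hz, hz']
    unfold zVar
    rw [h1]
    exact eVariationOn.comp_le_of_antitoneOn _ _ (h2.antitoneOn _) fun _ _ => Set.mem_univ _

theorem zVar_indicator_le (u : X → ℝ) {J : Set X} (hJ : J.OrdConnected) :
    zVar (J.indicator u) ≤ zVar u :=
  zVar_indicator_comp_le (φ := id) u hJ (Or.inl monotoneOn_id)

/-- Countable subadditivity. -/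
theorem zVar_le_tsum {ι : Type*} {u : X → ℝ} {v : ι → X → ℝ}
    (h : ∀ x, HasSum (fun i => v i x) (u x)) : zVar u ≤ ∑' i, zVar (v i) := by
  have h' : ∀ x, HasSum (fun i => zeroExt (v i) x) (zeroExt u x) := fun x =>
    extended_cases x (by simp [hasSum_zero]) (by simp [hasSum_zero]) (fun x => h x)
  refine iSup_le fun p => ?_
  obtain ⟨n, w, hw, ws⟩ := p
  have key : ∀ x y, edist (zeroExt u x) (zeroExt u y)
      ≤ ∑' i, edist (zeroExt (v i) x) (zeroExt (v i) y) := by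
    intro x y
    have := (h' x).sub (h' y)
    simp only [edist_eq_enorm_sub]
    rw [← this.tsum_eq]
    exact enorm_tsum_le_tsum_enorm
  calc ∑ i ∈ Finset.range n, edist (zeroExt u (w (i + 1))) (zeroExt u (w i))
      ≤ ∑ i ∈ Finset.range n, ∑' j, edist (zeroExt (v j) (w (i + 1))) (zeroExt (v j) (w i)) := by
        gcongr with i hi
        exact key _ _
    _ = ∑' j, ∑ i ∈ Finset.range n, edist (zeroExt (v j) (w (i + 1))) (zeroExt (v j) (w i)) :=
        (Summable.tsum_finsetSum fun _ _ => ENNReal.summable).symm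
    _ ≤ _ := ENNReal.tsum_le_tsum fun j => eVariationOn.sum_le hw ws

theorem zVar_zero : zVar (0 : X → ℝ) = 0 := by
  refine eVariationOn.constant_on (Set.subsingleton_of_forall_eq 0 ?_)
  rintro _ ⟨x, -, rfl⟩
  exact extended_cases x rfl rfl fun _ => rfl

theorem zVar_sum_le {ι : Type*} (s : Finset ι) (v : ι → X → ℝ) :
    zVar (fun x => ∑ i ∈ s, v i x) ≤ ∑ i ∈ s, zVar (v i) := by
  have := zVar_le_tsum (u := fun x => ∑ i ∈ s, v i x) (v := fun i : s => v i)
    (fun x => by simpa [← Finset.sum_coe_sort s] using hasSum_fintype (fun i : s => v i x))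
  rwa [tsum_fintype, Finset.sum_coe_sort s (fun i => zVar (v i))] at this

theorem zVar_add_le (u v : X → ℝ) : zVar (u + v) ≤ zVar u + zVar v := by
  have := zVar_sum_le (Finset.univ : Finset (Fin 2)) ![u, v]
  simpa [Fin.sum_univ_two, Pi.add_def] using this

theorem zVar_mul_le {u v : X → ℝ} {a b : ℝ≥0∞} (ha : ∀ x, ENNReal.ofReal |u x| ≤ a)
    (hb : ∀ x, ENNReal.ofReal |v x| ≤ b) : zVar (u * v) ≤ a * zVar v + b * zVar u := by
  have h : zeroExt (u * v) = fun x => zeroExt u x * zeroExt v x := by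
    funext x
    exact extended_cases x (by simp) (by simp) (fun x => by simp)
  unfold zVar
  rw [h]
  exact eVariationOn_mul_le
    (fun x _ => extended_cases x (by simp) (by simp) (fun x => by simpa using ha x))
    (fun x _ => extended_cases x (by simp) (by simp) (fun x => by simpa using hb x))

theorem zVar_const_smul_le (c : ℝ) (u : X → ℝ) : zVar (c • u) ≤ ENNReal.ofReal |c| * zVar u := by
  have h : zeroExt (c • u) = fun x => c * zeroExt u x := by
    funext x
    exact extended_cases x (by simp) (by simp) (fun x => by simp)
  unfold zVar
  rw [h]
  -- The bound `⊤` on `zeroExt u` is harmless: it multiplies the variation of a constant, and `⊤ * 0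
  -- = 0`.
  refine (eVariationOn_mul_le (a := ENNReal.ofReal |c|) (b := ⊤) (u := fun _ => c)
    (fun x _ => le_rfl) (fun x _ => le_top)).trans ?_
  rw [eVariationOn.constant_on (f := fun _ => c)]
  · simp
  · rintro _ ⟨x, -, rfl⟩ _ ⟨y, -, rfl⟩
    rfl

open Classical in
/-- Restricting a function to an order-convex set costs at most the jumps at the two ends. -/
theorem zVar_indicator_le_eVariationOn (f : X → ℝ) {J : Set X} (hJ : J.OrdConnected) {p : X}
    (hp : p ∈ J) :
    zVar (J.indicator f) ≤ 3 * eVariationOn f J + 2 * ENNReal.ofReal |f p| := by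
  set v := eVariationOn f J with hv
  set q := ENNReal.ofReal |f p| with hq
  have hbd : ∀ x ∈ J, ENNReal.ofReal |f x| ≤ q + v := by
    intro x hx
    have h1 := eVariationOn.edist_le f hx hp
    rw [ENNReal.edist_eq_abs] at h1
    refine le_trans ?_ (add_le_add le_rfl h1)
    rw [hq, ← ENNReal.ofReal_add (abs_nonneg _) (abs_nonneg _)]
    refine ENNReal.ofReal_le_ofReal ?_
    have := abs_add_le (f p) (f x - f p)
    simpa using this
  -- The potential pays `q + v` for the jump into `J`, then the variation inside `J`, then `q + v`
  -- for the jump back to 0.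
  let D : WithBot (WithTop X) → ℝ≥0∞ :=
    extRec 0 (2 * (q + v) + v)
        fun y => if y ∈ J then q + v + eVariationOn f (J ∩ Set.Iic y)
        else if ∃ j ∈ J, y < j then 0 else 2 * (q + v) + v
  have hvJ : ∀ y, eVariationOn f (J ∩ Set.Iic y) ≤ v := fun y =>
    eVariationOn.mono _ Set.inter_subset_left
  have hM : ∀ x, D x ≤ 2 * (q + v) + v := by
    intro x
    refine extended_cases x (by simp [D]) (by simp [D]) fun y => ?_
    simp only [D, extRec_coe]
    split_ifs
    · refine add_le_add ?_ (hvJ y)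
      rw [two_mul]; exact le_self_add
    · exact zero_le
    · exact le_rfl
  have h0 : ∀ x : WithBot (WithTop X), edist (zeroExt (J.indicator f) x) 0 ≤ q + v := by
    intro x
    refine extended_cases x (by simp) (by simp) fun y => ?_
    rw [ENNReal.edist_eq_abs]
    by_cases hy : y ∈ J
    · simpa [hy] using hbd y hy
    · simp [hy]
  have hup : ∀ x : X, edist (0 : ℝ) (zeroExt (J.indicator f) ((x : WithTop X) : WithBot (WithTop X)))
      + D ((x : WithTop X) : WithBot (WithTop X)) ≤ 2 * (q + v) + v := by
    intro x
    by_cases hx : x ∈ J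
    · have h1 := h0 ((x : WithTop X) : WithBot (WithTop X))
      rw [edist_comm] at h1
      simp only [D, extRec_coe, if_pos hx]
      calc _ ≤ (q + v) + (q + v + v) := add_le_add h1 (add_le_add le_rfl (hvJ x))
        _ = _ := by ring
    · simpa [hx] using hM ((x : WithTop X) : WithBot (WithTop X))
  have key : zVar (J.indicator f) ≤ 2 * (q + v) + v := by
    refine eVariationOn_le_of_dominated (D := D) (fun x _ => hM x) fun x _ y _ => ?_
    refine extended_cases x ?_ ?_ fun x => ?_
    · refine extended_cases y (by simp [D]) (by simp [D]) fun y _ => ?_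
      by_cases hy : y ∈ J
      · have := h0 ((y : WithTop X) : WithBot (WithTop X))
        simp only [D, extRec_coe, if_pos hy, zeroExt_bot,
          extRec_bot, add_zero]
        exact this.trans le_self_add
      · simp [D, hy]
    · refine extended_cases y (by simp) (by simp [D]) fun y => (by simp)
    · refine extended_cases y (by simp) (fun _ => by simpa [D] using hup x) fun y hxy => ?_
      have hxy : x ≤ y := by simpa using hxy
      by_cases hy : y ∈ J
      · by_cases hx : x ∈ J
        · simp only [D, extRec_coe, if_pos hy, if_pos hx,
            zeroExt_coe, Set.indicator_of_mem hy, Set.indicator_of_mem hx]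
          have h1 : edist (f y) (f x) ≤ eVariationOn f (J ∩ Set.Icc x y) :=
            eVariationOn.edist_le _ ⟨hy, hxy, le_rfl⟩ ⟨hx, le_rfl, hxy⟩
          have h2 := eVariationOn.add_le_union f (s := J ∩ Set.Iic x) (t := J ∩ Set.Icc x y)
            (fun a ha b hb => le_trans ha.2 hb.2.1)
          have h3 := h2.trans (eVariationOn.mono f (s := J ∩ Set.Iic y) (by
            rintro z (hz | hz)
            · exact ⟨hz.1, le_trans hz.2 hxy⟩
            · exact ⟨hz.1, hz.2.2⟩))
          calc _ ≤ eVariationOn f (J ∩ Set.Icc x y)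
                + (q + v + eVariationOn f (J ∩ Set.Iic x)) := add_le_add h1 le_rfl
            _ = q + v + (eVariationOn f (J ∩ Set.Iic x) + eVariationOn f (J ∩ Set.Icc x y)) := by
                ring
            _ ≤ _ := add_le_add le_rfl h3
        · have hxj : ∃ j ∈ J, x < j := ⟨y, hy, lt_of_le_of_ne hxy fun e => hx (e ▸ hy)⟩
          have := h0 ((y : WithTop X) : WithBot (WithTop X))
          simp only [D, extRec_coe, if_pos hy, if_neg hx,
            if_pos hxj, add_zero]
          rw [zeroExt_coe _ x, Set.indicator_of_notMem hx]
          exact this.trans le_self_add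
      · by_cases hy' : ∃ j ∈ J, y < j
        · have hx : x ∉ J := by
            obtain ⟨j, hj, hyj⟩ := hy'
            exact fun hx => hy (hJ.out hx hj ⟨hxy, hyj.le⟩)
          have hx' : ∃ j ∈ J, x < j := hy'.imp fun j hj => ⟨hj.1, hxy.trans_lt hj.2⟩
          simp [D, hx, hx', hy]
        · have := hup x
          rw [zeroExt_coe _ y, Set.indicator_of_notMem hy]
          have hD : D ((y : WithTop X) : WithBot (WithTop X)) = 2 * (q + v) + v := by
            simp only [D, extRec_coe, if_neg hy, if_neg hy']
          rwa [hD]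
  refine key.trans (le_of_eq ?_)
  ring

theorem zVar_lt_top_of_boundedVariationOn {f : X → ℝ} (hf : BoundedVariationOn f Set.univ) :
    zVar f < ⊤ := by
  rcases isEmpty_or_nonempty X with hX | ⟨⟨p⟩⟩
  · have : f = 0 := funext fun x => (hX.false x).elim
    rw [this, zVar_zero]
    exact ENNReal.zero_lt_top
  · have := zVar_indicator_le_eVariationOn f Set.ordConnected_univ (Set.mem_univ p)
    rw [Set.indicator_univ] at this
    refine this.trans_lt (ENNReal.add_lt_top.2 ⟨ENNReal.mul_lt_top (by simp) ?_, ?_⟩)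
    · exact lt_top_iff_ne_top.2 hf
    · exact ENNReal.mul_lt_top (by simp) ENNReal.ofReal_lt_top

theorem boundedVariationOn_of_zVar_lt_top {f : X → ℝ} (hf : zVar f < ⊤) :
    BoundedVariationOn f Set.univ :=
  ((eVariationOn_le_zVar f _).trans_lt hf).ne

end

-- Cutting the order into intervals by a monotone function.

section LevelSets

variable {X : Type*}

/-- The `k`-th level set, at mesh `ε`, of a real function. -/
def levelSet (m : X → ℝ) (ε : ℝ) (k : ℕ) : Set X := {x | k * ε ≤ m x ∧ m x < (k + 1) * ε}

theorem levelSet_ordConnected [LinearOrder X] {m : X → ℝ} (hm : Monotone m) (ε : ℝ) (k : ℕ) :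
    (levelSet m ε k).OrdConnected :=
  ⟨fun _ hx _ hy _ hz => ⟨hx.1.trans (hm hz.1), (hm hz.2).trans_lt hy.2⟩⟩

theorem exists_mem_levelSet {m : X → ℝ} {ε : ℝ} (hε : 0 < ε) {K : ℕ} {x : X} (h0 : 0 ≤ m x)
    (hK : m x < K * ε) : ∃ k ∈ Finset.range K, x ∈ levelSet m ε k := by
  have h1 : 0 ≤ m x / ε := div_nonneg h0 hε.le
  refine ⟨⌊m x / ε⌋₊, ?_, ?_, ?_⟩
  · rw [Finset.mem_range, Nat.floor_lt h1, div_lt_iff₀ hε]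
    exact hK
  · rw [← le_div_iff₀ hε]
    exact Nat.floor_le h1
  · rw [← div_lt_iff₀ hε]
    exact Nat.lt_floor_add_one _

theorem levelSet_eq_of_mem {m : X → ℝ} {ε : ℝ} (hε : 0 < ε) {j k : ℕ} {x : X}
    (hj : x ∈ levelSet m ε j) (hk : x ∈ levelSet m ε k) : j = k := by
  have h : ∀ a b : ℕ, x ∈ levelSet m ε a → x ∈ levelSet m ε b → a ≤ b := by
    intro a b ha hb
    have := lt_of_mul_lt_mul_right (ha.1.trans_lt hb.2) hε.le
    exact Nat.lt_succ_iff.1 (by exact_mod_cast this)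
  exact le_antisymm (h _ _ hj hk) (h _ _ hk hj)

theorem sum_indicator_levelSet {m : X → ℝ} {ε : ℝ} (hε : 0 < ε) (S : Finset ℕ) (f : X → ℝ) {k : ℕ}
    {x : X} (hk : k ∈ S) (hx : x ∈ levelSet m ε k) :
    ∑ j ∈ S, (levelSet m ε j).indicator f x = f x := by
  rw [Finset.sum_eq_single k, Set.indicator_of_mem hx]
  · exact fun j _ hj => Set.indicator_of_notMem (fun h => hj (levelSet_eq_of_mem hε h hx)) _
  · exact fun h => (h hk).elim

variable [LinearOrder X]

/-- Level sets of a monotone function lie one after the other, so their variations add up. -/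
theorem sum_eVariationOn_levelSet_le {m : X → ℝ} {ε : ℝ} (hε : 0 < ε) (hm : Monotone m)
    (f : X → ℝ) (K : ℕ) :
    ∑ k ∈ Finset.range K, eVariationOn f (levelSet m ε k) ≤ eVariationOn f Set.univ := by
  have key : ∑ k ∈ Finset.range K, eVariationOn f (levelSet m ε k)
      ≤ eVariationOn f {x | m x < K * ε} := by
    induction K with
    | zero => simp
    | succ K ih =>
      rw [Finset.sum_range_succ]
      have h2 : ∀ x ∈ {x | m x < K * ε}, ∀ y ∈ levelSet m ε K, x ≤ y := fun x hx y hy =>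
        (hm.reflect_lt (lt_of_lt_of_le hx hy.1)).le
      refine (add_le_add ih le_rfl).trans ((eVariationOn.add_le_union f h2).trans ?_)
      refine eVariationOn.mono _ ?_
      rintro x (hx | hx)
      · have hx : m x < K * ε := hx
        have : m x < ((K + 1 : ℕ) : ℝ) * ε := by
          push_cast
          linarith
        exact this
      · simpa using hx.2
  exact key.trans (eVariationOn.mono _ (Set.subset_univ _))

theorem edist_add_eVariationOn_Iic_le {α : Type*} [PseudoEMetricSpace α] (f : X → α) {x y : X}
    (hxy : x ≤ y) :
    edist (f y) (f x) + eVariationOn f (Set.Iic x) ≤ eVariationOn f (Set.Iic y) := by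
  have h1 : edist (f y) (f x) ≤ eVariationOn f (Set.Icc x y) :=
    eVariationOn.edist_le _ ⟨hxy, le_rfl⟩ ⟨le_rfl, hxy⟩
  have h2 := eVariationOn.add_le_union f (s := Set.Iic x) (t := Set.Icc x y)
    (fun a ha b hb => le_trans ha hb.1)
  rw [add_comm]
  refine (add_le_add le_rfl h1).trans (h2.trans (eVariationOn.mono f ?_))
  rintro z (hz | hz)
  · exact le_trans hz hxy
  · exact hz.2

/-- The variation function of a function of bounded variation. -/
def variationFun (w : X → ℝ) (x : X) : ℝ := (eVariationOn w (Set.Iic x)).toReal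

theorem edist_le_variationFun_sub {w : X → ℝ} (hw : zVar w < ⊤) {x y : X} (hxy : x ≤ y) :
    edist (w y) (w x) ≤ ENNReal.ofReal (variationFun w y - variationFun w x) := by
  have hfin : ∀ x, eVariationOn w (Set.Iic x) ≠ ⊤ := fun x =>
    ((eVariationOn_le_zVar w _).trans_lt hw).ne
  have h := edist_add_eVariationOn_Iic_le w hxy
  rw [variationFun, variationFun, ENNReal.ofReal_sub _ ENNReal.toReal_nonneg,
    ENNReal.ofReal_toReal (hfin _), ENNReal.ofReal_toReal (hfin _)]
  exact ENNReal.le_sub_of_add_le_right (hfin _) h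

theorem variationFun_mono {w : X → ℝ} (hw : zVar w < ⊤) : Monotone (variationFun w) :=
  fun _ _ h => ENNReal.toReal_mono ((eVariationOn_le_zVar w _).trans_lt hw).ne
    (eVariationOn.mono _ (Set.Iic_subset_Iic.2 h))

theorem variationFun_le {w : X → ℝ} (hw : zVar w < ⊤) (x : X) :
    variationFun w x ≤ (zVar w).toReal :=
  ENNReal.toReal_mono hw.ne (eVariationOn_le_zVar w _)

/-- The variation function grows by at most `ε` on one of its level sets and dominates the
increments of `w`. No continuity is needed: two points between which `w` jumps by more than `ε` lie
in different level sets. -/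
theorem eVariationOn_levelSet_variationFun_le {w : X → ℝ} (hw : zVar w < ⊤) (ε : ℝ) (k : ℕ) :
    eVariationOn w (levelSet (variationFun w) ε k) ≤ ENNReal.ofReal ε := by
  refine eVariationOn_le_of_dominated (D := fun x => ENNReal.ofReal (variationFun w x - k * ε))
    (fun x hx => ENNReal.ofReal_le_ofReal (by linarith [hx.2])) fun x hx y hy hxy => ?_
  refine (add_le_add (edist_le_variationFun_sub hw hxy) le_rfl).trans ?_
  rw [← ENNReal.ofReal_add (sub_nonneg.2 (variationFun_mono hw hxy)) (sub_nonneg.2 hx.1)]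
  exact ENNReal.ofReal_le_ofReal (by linarith)

theorem measurable_of_zVar_lt_top [TopologicalSpace X] [OrderTopology X] [MeasurableSpace X]
    [BorelSpace X] {u : X → ℝ} (hu : zVar u < ⊤) : Measurable u := by
  obtain ⟨p, q, hp, hq, rfl⟩ := (boundedVariationOn_of_zVar_lt_top
    hu).locallyBoundedVariationOn.exists_monotoneOn_sub_monotoneOn
  exact (monotoneOn_univ.1 hp).measurable.sub (monotoneOn_univ.1 hq).measurable

theorem abs_le_of_zVar_lt_top {u : X → ℝ} (hu : zVar u < ⊤) (x : X) : |u x| ≤ (zVar u).toReal := by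
  rw [← ENNReal.ofReal_le_iff_le_toReal hu.ne]
  exact ofReal_abs_le_zVar u x

theorem integrable_of_zVar_lt_top [TopologicalSpace X] [OrderTopology X] [MeasurableSpace X]
    [BorelSpace X] {u : X → ℝ} (hu : zVar u < ⊤) (μ : Measure X) [IsFiniteMeasure μ] :
    Integrable u μ :=
  Integrable.of_bound (measurable_of_zVar_lt_top hu).aestronglyMeasurable (zVar u).toReal
    (Eventually.of_forall fun x => abs_le_of_zVar_lt_top hu x)

end LevelSets

-- Cutting a function at its zeros.

section CutOut

variable {X : Type*} [LinearOrder X]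

theorem eVariationOn_univ_eq {α E : Type*} [LinearOrder α] [PseudoEMetricSpace E] (F : α → E)
    {a b : α} (hab : a ≤ b) :
    eVariationOn F Set.univ = eVariationOn F (Set.Iic a) + eVariationOn F (Set.Icc a b)
      + eVariationOn F (Set.Ici b) := by
  have h1 := eVariationOn.union F (s := Set.Icc a b) (t := Set.Ici b) (x := b)
    ⟨⟨hab, le_rfl⟩, fun _ h => h.2⟩ ⟨Set.mem_Ici.2 le_rfl, fun _ h => h⟩
  have h2 := eVariationOn.union F (s := Set.Iic a) (t := Set.Ici a) (x := a)
    ⟨Set.mem_Iic.2 le_rfl, fun _ h => h⟩ ⟨Set.mem_Ici.2 le_rfl, fun _ h => h⟩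
  rw [Set.Icc_union_Ici_eq_Ici hab] at h1
  rw [Set.Iic_union_Ici] at h2
  rw [h2, h1, add_assoc]

/-- Variation splits at zeros of a function. -/
theorem zVar_indicator_add_zVar_indicator_compl_le (u : X → ℝ) {I : Set X}
    {a b : WithBot (WithTop X)} (hab : a ≤ b)
    (hI : ∀ x : X, x ∈ I ↔ a < ((x : WithTop X) : WithBot (WithTop X)) ∧
      ((x : WithTop X) : WithBot (WithTop X)) < b)
    (ha : zeroExt u a = 0) (hb : zeroExt u b = 0) :
    zVar (I.indicator u) + zVar (Iᶜ.indicator u) ≤ zVar u := by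
  classical
  have h1 : ∀ x, zeroExt (I.indicator u) x = if a < x ∧ x < b then zeroExt u x else 0 := by
    intro x
    refine extended_cases x (by simp) (by simp) fun x => ?_
    simp only [zeroExt_coe, ← hI, Set.indicator_apply]
  have h2 : ∀ x, zeroExt (Iᶜ.indicator u) x = if a < x ∧ x < b then 0 else zeroExt u x := by
    intro x
    refine extended_cases x (by simp) (by simp) fun x => ?_
    simp only [zeroExt_coe, ← hI, Set.indicator_apply, Set.mem_compl_iff, ite_not]
  have hz : ∀ (F : WithBot (WithTop X) → ℝ) (s : Set (WithBot (WithTop X))),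
      (∀ x ∈ s, F x = 0) → eVariationOn F s = 0 := by
    intro F s h
    refine eVariationOn.constant_on ?_
    rintro _ ⟨x, hx, rfl⟩ _ ⟨y, hy, rfl⟩
    rw [h x hx, h y hy]
  unfold zVar
  rw [eVariationOn_univ_eq (zeroExt (I.indicator u)) hab,
    eVariationOn_univ_eq (zeroExt (Iᶜ.indicator u)) hab, eVariationOn_univ_eq (zeroExt u) hab,
    hz (zeroExt (I.indicator u)) (Set.Iic a)
      (fun x hx => by rw [h1, if_neg fun h => (not_lt_of_ge hx h.1)]),
    hz (zeroExt (I.indicator u)) (Set.Ici b)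
      (fun x hx => by rw [h1, if_neg fun h => (not_lt_of_ge hx h.2)]),
    hz (zeroExt (Iᶜ.indicator u)) (Set.Icc a b) (fun x hx => by
      rw [h2]
      split_ifs with h
      · rfl
      · rcases hx.1.eq_or_lt with rfl | h3
        · exact ha
        · rcases hx.2.eq_or_lt with rfl | h4
          · exact hb
          · exact (h ⟨h3, h4⟩).elim),
    eVariationOn.congr (f := zeroExt (I.indicator u)) (g := zeroExt u) (s := Set.Icc a b)
      (fun x hx => by
        rw [h1]
        split_ifs with h
        · rfl
        · rcases hx.1.eq_or_lt with rfl | h3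
          · exact ha.symm
          · rcases hx.2.eq_or_lt with rfl | h4
            · exact hb.symm
            · exact (h ⟨h3, h4⟩).elim),
    eVariationOn.congr (f := zeroExt (Iᶜ.indicator u)) (g := zeroExt u) (s := Set.Iic a)
      (fun x hx => by rw [h2, if_neg fun h => (not_lt_of_ge hx h.1)]),
    eVariationOn.congr (f := zeroExt (Iᶜ.indicator u)) (g := zeroExt u) (s := Set.Ici b)
      (fun x hx => by rw [h2, if_neg fun h => (not_lt_of_ge hx h.2)])]
  refine le_of_eq ?_
  ring

end CutOut

-- Branches and the weighted fibre sum.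

/-- The branches of a piecewise monotone map `T` with domain `V`: the open intervals `I i` partition
`V`, their ends are not in `V`, and `T` is monotone on each of them with an interval as image. -/
structure IsBranchSystem {X ι : Type*} [LinearOrder X] (T : X → X) (V : Set X) (I : ι → Set X) :
    Prop where
  disjoint : Pairwise fun i j => Disjoint (I i) (I j)
  cover : ∀ x ∈ V, ∃ i, x ∈ I i
  ordConnected : ∀ i, (I i).OrdConnected
  injOn : ∀ i, Set.InjOn T (I i)
  monotone : ∀ i, MonotoneOn T (I i) ∨ AntitoneOn T (I i)
  image_ordConnected : ∀ i, (T '' I i).OrdConnected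
  ends : ∀ i, ∃ a b : WithBot (WithTop X), a ≤ b ∧
    (∀ x : X, x ∈ I i ↔ a < ((x : WithTop X) : WithBot (WithTop X)) ∧
      ((x : WithTop X) : WithBot (WithTop X)) < b) ∧
    ∀ u : X → ℝ, (∀ x ∉ V, u x = 0) → zeroExt u a = 0 ∧ zeroExt u b = 0

section Branches

variable {X ι : Type*} {T : X → X} {V : Set X} {I : ι → Set X}

/-- The sum of `u` over the fibres of `T`, written branch by branch. -/
def branchSum [Nonempty X] (T : X → X) (I : ι → Set X) (u : X → ℝ) (y : X) : ℝ :=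
  ∑' i, (T '' I i).indicator (u ∘ Function.invFunOn T (I i)) y

/-- On the image of a branch, `T` undoes the inverse branch, so a factor outside the sum becomes the
same factor composed with `T` inside. -/
theorem mul_branchSum [Nonempty X] (T : X → X) (I : ι → Set X) (w u : X → ℝ) :
    w * branchSum T I u = branchSum T I ((w ∘ T) * u) := by
  funext y
  rw [Pi.mul_apply, branchSum, branchSum, ← tsum_mul_left]
  refine tsum_congr fun i => ?_
  by_cases hy : y ∈ T '' I i
  · simp [Set.indicator_of_mem hy, Function.invFunOn_eq hy]
  · simp [Set.indicator_of_notMem hy]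

/-- The weight of the `n`-th iterate. -/
def iterWeight (T : X → X) (g : X → ℝ) : ℕ → X → ℝ
  | 0 => 1
  | n + 1 => g * (iterWeight T g n ∘ T)

theorem abs_iterWeight_le {T : X → X} {g : X → ℝ} {c : ℝ} (hc : ∀ x, |g x| ≤ c) (n : ℕ) (x : X) :
    |iterWeight T g n x| ≤ c ^ n := by
  induction n generalizing x with
  | zero => simp [iterWeight]
  | succ n ih =>
    rw [iterWeight, Pi.mul_apply, abs_mul, pow_succ']
    exact mul_le_mul (hc x) (ih (T x)) (abs_nonneg _) ((abs_nonneg _).trans (hc x))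

/-- The cocycle property of the weights lets iterates be treated with the branches of `T` alone; no
partition for `T^n` is ever built. -/
theorem branchSum_iterate_succ [Nonempty X] (T : X → X) (I : ι → Set X) (g u : X → ℝ) (n : ℕ) :
    (branchSum T I)^[n + 1] (iterWeight T g (n + 1) * u)
      = (branchSum T I)^[n] (iterWeight T g n * branchSum T I (g * u)) := by
  rw [Function.iterate_succ_apply, mul_branchSum, iterWeight, ← mul_assoc,
    mul_comm (_ ∘ T) g]

variable [LinearOrder X]

/-- A function vanishing off `V` is zero at the ends of every branch, so cutting out branches one at
a time never increases the total. This is what makes infinitely many branches harmless. -/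
theorem IsBranchSystem.tsum_zVar_indicator_le (hI : IsBranchSystem T V I) {u : X → ℝ}
    (hu : ∀ x ∉ V, u x = 0) : ∑' i, zVar ((I i).indicator u) ≤ zVar u := by
  classical
  rw [ENNReal.tsum_eq_iSup_sum]
  refine iSup_le fun F => ?_
  induction F using Finset.induction_on generalizing u with
  | empty => simp
  | insert i F hi ih =>
    rw [Finset.sum_insert hi]
    obtain ⟨a, b, hab, hiff, hz⟩ := hI.ends i
    refine le_trans (add_le_add le_rfl ?_)
      (zVar_indicator_add_zVar_indicator_compl_le u hab hiff (hz u hu).1 (hz u hu).2)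
    refine le_trans (le_of_eq ?_) (ih (u := (I i)ᶜ.indicator u) fun x hx => by
      rw [Set.indicator_apply, hu x hx, ite_self])
    refine Finset.sum_congr rfl fun j hj => ?_
    have hij : j ≠ i := fun e => hi (e ▸ hj)
    rw [Set.indicator_indicator, Set.inter_eq_left.2]
    exact Set.subset_compl_iff_disjoint_right.2 (hI.disjoint hij)

/-- On one branch `w ∘ T` varies no more than `w`, and the product rule bounds the piece by `2 *
zVar w` times the variation of that piece of `g`. The pieces of `g` sum to at most `zVar g`. -/
theorem IsBranchSystem.zVar_mul_comp_lt_top (hI : IsBranchSystem T V I) {g w : X → ℝ}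
    (hg : ∀ x ∉ V, g x = 0) (hgv : zVar g < ⊤) (hw : zVar w < ⊤) : zVar (g * (w ∘ T)) < ⊤ := by
  classical
  have hsum : ∀ x, HasSum (fun i => (I i).indicator (g * (w ∘ T)) x) ((g * (w ∘ T)) x) := by
    intro x
    by_cases hx : x ∈ V
    · obtain ⟨i, hi⟩ := hI.cover x hx
      have := hasSum_single (f := fun i => (I i).indicator (g * (w ∘ T)) x) i fun j hj =>
        Set.indicator_of_notMem (Set.disjoint_right.1 (hI.disjoint hj) hi) _
      simpa only [Set.indicator_of_mem hi] using this
    · have h0 : (g * (w ∘ T)) x = 0 := by simp [hg x hx]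
      have : (fun i => (I i).indicator (g * (w ∘ T)) x) = fun _ => 0 := by
        funext i
        rw [Set.indicator_apply, h0, ite_self]
      rw [h0, this]
      exact hasSum_zero
  have hterm : ∀ i, zVar ((I i).indicator (g * (w ∘ T)))
      ≤ 2 * zVar w * zVar ((I i).indicator g) := by
    intro i
    have h1 : (I i).indicator (g * (w ∘ T)) = (I i).indicator g * (I i).indicator (w ∘ T) :=
      Set.indicator_mul _ _ _
    have h2 : zVar ((I i).indicator (w ∘ T)) ≤ zVar w :=
      zVar_indicator_comp_le w (hI.ordConnected i) (hI.monotone i)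
    rw [h1]
    calc _ ≤ zVar ((I i).indicator g) * zVar ((I i).indicator (w ∘ T))
          + zVar ((I i).indicator (w ∘ T)) * zVar ((I i).indicator g) :=
          zVar_mul_le (fun x => ofReal_abs_le_zVar _ x) fun x => ofReal_abs_le_zVar _ x
      _ = 2 * zVar ((I i).indicator (w ∘ T)) * zVar ((I i).indicator g) := by ring
      _ ≤ _ := by gcongr
  calc zVar (g * (w ∘ T)) ≤ ∑' i, zVar ((I i).indicator (g * (w ∘ T))) := zVar_le_tsum hsum
    _ ≤ ∑' i, 2 * zVar w * zVar ((I i).indicator g) := ENNReal.tsum_le_tsum hterm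
    _ = 2 * zVar w * ∑' i, zVar ((I i).indicator g) := ENNReal.tsum_mul_left
    _ ≤ 2 * zVar w * zVar g := by gcongr; exact hI.tsum_zVar_indicator_le hg
    _ < ⊤ := ENNReal.mul_lt_top (ENNReal.mul_lt_top (by simp) hw) hgv

theorem zVar_mul_lt_top {u v : X → ℝ} (hu : zVar u < ⊤) (hv : zVar v < ⊤) : zVar (u * v) < ⊤ :=
  (zVar_mul_le (fun x => ofReal_abs_le_zVar u x) fun x => ofReal_abs_le_zVar v x).trans_lt
    (ENNReal.add_lt_top.2 ⟨ENNReal.mul_lt_top hu hv, ENNReal.mul_lt_top hv hu⟩)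

theorem zVar_one_lt_top : zVar (1 : X → ℝ) < ⊤ := by
  refine zVar_lt_top_of_boundedVariationOn ?_
  rw [BoundedVariationOn, eVariationOn.constant_on]
  · exact ENNReal.zero_ne_top
  · rintro _ ⟨x, -, rfl⟩ _ ⟨y, -, rfl⟩
    rfl

theorem IsBranchSystem.zVar_iterWeight_lt_top (hI : IsBranchSystem T V I) {g : X → ℝ}
    (hg : ∀ x ∉ V, g x = 0) (hgv : zVar g < ⊤) (n : ℕ) : zVar (iterWeight T g n) < ⊤ := by
  induction n with
  | zero => exact zVar_one_lt_top
  | succ n ih => exact hI.zVar_mul_comp_lt_top hg hgv ih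

variable [Nonempty X]

/-- A fibre meets each branch at most once, and its points off `V` contribute 0. The two sums are
matched by a bijection of supports, so convergence plays no role. -/
theorem IsBranchSystem.tsum_fiber (hI : IsBranchSystem T V I) {u : X → ℝ}
    (hu : ∀ x ∉ V, u x = 0) (y : X) :
    ∑' z : (T ⁻¹' {y} : Set X), u z = branchSum T I u y := by
  unfold branchSum
  have hmem : ∀ i : Function.support
      fun i => (T '' I i).indicator (u ∘ Function.invFunOn T (I i)) y, y ∈ T '' I i :=
    fun i => Set.mem_of_indicator_ne_zero i.2
  refine tsum_eq_tsum_of_ne_zero_bij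
    (fun i => ⟨Function.invFunOn T (I i) y, Function.invFunOn_eq (hmem i)⟩) ?_ ?_ ?_
  · intro i j hij
    have h1 : Function.invFunOn T (I i) y = Function.invFunOn T (I j) y := congrArg Subtype.val hij
    by_contra hne
    refine Set.disjoint_left.1 (hI.disjoint fun h => hne (Subtype.ext h))
      (Function.invFunOn_mem (hmem i)) ?_
    rw [h1]
    exact Function.invFunOn_mem (hmem j)
  · rintro ⟨z, hz⟩ hne
    have hz : T z = y := hz
    have hzV : z ∈ V := by
      by_contra h
      exact hne (hu z h)
    obtain ⟨i, hi⟩ := hI.cover z hzV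
    have hy : y ∈ T '' I i := ⟨z, hi, hz⟩
    have hinv : Function.invFunOn T (I i) y = z :=
      hI.injOn i (Function.invFunOn_mem hy) hi ((Function.invFunOn_eq hy).trans hz.symm)
    refine ⟨⟨i, ?_⟩, ?_⟩
    · rw [Function.mem_support, Set.indicator_of_mem hy, Function.comp_apply, hinv]
      exact hne
    · exact Subtype.ext hinv
  · intro i
    rw [Set.indicator_of_mem (hmem i)]
    rfl

theorem IsBranchSystem.zVar_branch_le (hI : IsBranchSystem T V I) (u : X → ℝ) (i : ι) :
    zVar ((T '' I i).indicator (u ∘ Function.invFunOn T (I i))) ≤ zVar ((I i).indicator u) := by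
  have h : (T '' I i).indicator (u ∘ Function.invFunOn T (I i))
      = (T '' I i).indicator ((I i).indicator u ∘ Function.invFunOn T (I i)) := by
    refine Set.indicator_congr fun y hy => ?_
    rw [Function.comp_apply, Function.comp_apply, Set.indicator_of_mem (Function.invFunOn_mem hy)]
  rw [h]
  refine zVar_indicator_comp_le _ (hI.image_ordConnected i) ?_
  rcases hI.monotone i with hm | hm
  · left
    intro y hy z hz hyz
    by_contra hlt
    have h1 := hm (Function.invFunOn_mem hz) (Function.invFunOn_mem hy) (not_le.1 hlt).le
    rw [Function.invFunOn_eq hy, Function.invFunOn_eq hz] at h1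
    exact hlt (le_of_eq (by rw [le_antisymm hyz h1]))
  · right
    intro y hy z hz hyz
    by_contra hlt
    have h1 := hm (Function.invFunOn_mem hy) (Function.invFunOn_mem hz) (not_le.1 hlt).le
    rw [Function.invFunOn_eq hy, Function.invFunOn_eq hz] at h1
    exact hlt (le_of_eq (by rw [le_antisymm hyz h1]))

/-- Moving a piece of `u` to the image of its branch does not raise its variation, and the pieces on
the branches sum to at most `zVar u`. -/
theorem IsBranchSystem.zVar_branchSum_le (hI : IsBranchSystem T V I) {u : X → ℝ}
    (hu : ∀ x ∉ V, u x = 0) : zVar (branchSum T I u) ≤ zVar u := by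
  rcases eq_or_ne (zVar u) ⊤ with htop | htop
  · rw [htop]; exact le_top
  have hle := hI.tsum_zVar_indicator_le hu
  have hle' : ∑' i, zVar ((T '' I i).indicator (u ∘ Function.invFunOn T (I i))) ≤ zVar u :=
    (ENNReal.tsum_le_tsum fun i => hI.zVar_branch_le u i).trans hle
  refine le_trans (zVar_le_tsum
    (v := fun i => (T '' I i).indicator (u ∘ Function.invFunOn T (I i))) fun y => ?_) hle'
  -- Each value is bounded by the variation of its piece, so finite total variation gives absolute
  -- convergence at every point.
  refine Summable.hasSum (Summable.of_norm ?_)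
  have hfin : ∑' i, ENNReal.ofReal |(T '' I i).indicator (u ∘ Function.invFunOn T (I i)) y| ≠ ⊤ :=
    ne_top_of_le_ne_top htop ((ENNReal.tsum_le_tsum fun i => ofReal_abs_le_zVar _ y).trans hle')
  have := ENNReal.summable_toReal hfin
  simpa [ENNReal.toReal_ofReal (abs_nonneg _), Real.norm_eq_abs] using this

/-- At each step the remaining weight is pulled inside the branch sum before the one-step bound is
applied. Thus the whole smallness of `gₙ` is kept and no constant accumulates with `n`. -/
theorem IsBranchSystem.zVar_iterate_le (hI : IsBranchSystem T V I) {g : X → ℝ}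
    (hg : ∀ x ∉ V, g x = 0) (n : ℕ) (u : X → ℝ) :
    zVar ((branchSum T I)^[n] (iterWeight T g n * u)) ≤ zVar (iterWeight T g n * u) := by
  induction n generalizing u with
  | zero => exact le_rfl
  | succ n ih =>
    rw [branchSum_iterate_succ]
    refine (ih _).trans ?_
    rw [mul_branchSum, ← mul_assoc, mul_comm (_ ∘ T) g]
    refine hI.zVar_branchSum_le fun x hx => ?_
    simp [hg x hx]

end Branches

-- The given partition as a branch system.

section Partition

variable {X : Type*} [ConditionallyCompleteLinearOrder X] [TopologicalSpace X] [OrderTopology X]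

/-- A closed order-convex set has a least element or is unbounded below. -/
theorem exists_lower_end {Z : Set X} (hc : IsClosed Z) (ho : Z.OrdConnected) (hne : Z.Nonempty) :
    ∃ a : WithBot (WithTop X), (∀ z ∈ Z, a ≤ ((z : WithTop X) : WithBot (WithTop X))) ∧
      (∀ x, ∀ z ∈ Z, x ≤ z → a < ((x : WithTop X) : WithBot (WithTop X)) → x ∈ Z) ∧
      (∀ x, IsLeast Z x ↔ a = ((x : WithTop X) : WithBot (WithTop X))) ∧
      (a = ⊥ ∨ ∃ p, IsLeast Z p ∧ a = ((p : WithTop X) : WithBot (WithTop X))) := by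
  by_cases h : ∃ p, IsLeast Z p
  · obtain ⟨p, hp⟩ := h
    refine ⟨((p : WithTop X) : WithBot (WithTop X)), fun z hz => by simpa using hp.2 hz, ?_, ?_,
      Or.inr ⟨p, hp, rfl⟩⟩
    · intro x z hz hxz hpx
      have hpx : p < x := by simpa using hpx
      exact ho.out hp.1 hz ⟨hpx.le, hxz⟩
    · intro x
      constructor
      · intro hx
        rw [hp.unique hx]
      · intro e
        have e : p = x := by simpa using e
        exact e ▸ hp
  · have hb : ¬ BddBelow Z := fun hb => h ⟨_, hc.isLeast_csInf hne hb⟩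
    refine ⟨⊥, fun z _ => bot_le, ?_, ?_, Or.inl rfl⟩
    · intro x z hz hxz _
      obtain ⟨w, hw, hwx⟩ := not_bddBelow_iff.1 hb x
      exact ho.out hw hz ⟨hwx.le, hxz⟩
    · intro x
      exact ⟨fun hx => (h ⟨x, hx⟩).elim, fun e => (WithBot.bot_ne_coe e).elim⟩

/-- A closed order-convex set has a greatest element or is unbounded above. -/
theorem exists_upper_end {Z : Set X} (hc : IsClosed Z) (ho : Z.OrdConnected) (hne : Z.Nonempty) :
    ∃ b : WithBot (WithTop X), (∀ z ∈ Z, ((z : WithTop X) : WithBot (WithTop X)) ≤ b) ∧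
      (∀ x, ∀ z ∈ Z, z ≤ x → ((x : WithTop X) : WithBot (WithTop X)) < b → x ∈ Z) ∧
      (∀ x, IsGreatest Z x ↔ b = ((x : WithTop X) : WithBot (WithTop X))) ∧
      (b = ⊤ ∨ ∃ p, IsGreatest Z p ∧ b = ((p : WithTop X) : WithBot (WithTop X))) := by
  by_cases h : ∃ p, IsGreatest Z p
  · obtain ⟨p, hp⟩ := h
    refine ⟨((p : WithTop X) : WithBot (WithTop X)), fun z hz => by simpa using hp.2 hz, ?_, ?_,
      Or.inr ⟨p, hp, rfl⟩⟩
    · intro x z hz hxz hpx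
      have hpx : x < p := by simpa using hpx
      exact ho.out hz hp.1 ⟨hxz, hpx.le⟩
    · intro x
      constructor
      · intro hx
        rw [hp.unique hx]
      · intro e
        have e : p = x := by simpa using e
        exact e ▸ hp
  · have hb : ¬ BddAbove Z := fun hb => h ⟨_, hc.isGreatest_csSup hne hb⟩
    refine ⟨⊤, fun z _ => le_top, ?_, ?_, Or.inl rfl⟩
    · intro x z hz hxz _
      obtain ⟨w, hw, hwx⟩ := not_bddAbove_iff.1 hb x
      exact ho.out hz hw ⟨hxz, hwx.le⟩
    · intro x
      refine ⟨fun hx => (h ⟨x, hx⟩).elim, fun e => ?_⟩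
      have e' : ((⊤ : WithTop X) : WithBot (WithTop X)) = ((x : WithTop X) : WithBot (WithTop X)) := e
      exact (WithTop.top_ne_coe (WithBot.coe_injective e')).elim

/-- The branch of `Z` is `Z ∩ V`, which is `Z` without its end points. It lies in the interior of
`Z`, whence disjointness. An end is either a point off `V` or one of the added points, and zero
extensions vanish at both. -/
theorem IsPiecewiseUniformlyExpanding.exists_branchSystem [MeasurableSpace X] {T : X → X}
    {μ : Measure X} {V : Set X} (hT : IsPiecewiseUniformlyExpanding T μ V) :
    ∃ 𝒵 : Set (Set X), IsBranchSystem T V (fun Z : 𝒵 => (Z : Set X) ∩ V) := by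
  obtain ⟨𝒵, -, hcl, hdis, hcov, hend, hφ⟩ := hT.exists_partition
  refine ⟨𝒵, ?_⟩
  have hnotV : ∀ Z ∈ 𝒵, ∀ x, (IsLeast Z x ∨ IsGreatest Z x) ↔ x ∈ Z ∧ x ∉ V := by
    intro Z hZ x
    have := Set.ext_iff.1 (hend Z hZ) x
    exact this.symm
  have hint : ∀ Z ∈ 𝒵, Z ∩ V ⊆ interior Z := by
    rintro Z hZ x ⟨hxZ, hxV⟩
    have hno : ¬ (IsLeast Z x ∨ IsGreatest Z x) := fun h => ((hnotV Z hZ x).1 h).2 hxV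
    obtain ⟨a, ha, hax⟩ : ∃ a ∈ Z, a < x := by
      by_contra! h
      exact hno (Or.inl ⟨hxZ, h⟩)
    obtain ⟨b, hb, hxb⟩ : ∃ b ∈ Z, x < b := by
      by_contra! h
      exact hno (Or.inr ⟨hxZ, h⟩)
    refine mem_interior.2 ⟨Set.Ioo a b, fun y hy => ?_, isOpen_Ioo, hax, hxb⟩
    exact (hcl Z hZ).2.out ha hb ⟨hy.1.le, hy.2.le⟩
  have hord : ∀ Z ∈ 𝒵, (Z ∩ V).OrdConnected := by
    intro Z hZ
    refine ⟨fun x hx y hy z hz => ?_⟩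
    have hzZ := (hcl Z hZ).2.out hx.1 hy.1 hz
    refine ⟨hzZ, ?_⟩
    by_contra hzV
    rcases (hnotV Z hZ z).2 ⟨hzZ, hzV⟩ with h | h
    · exact hzV (le_antisymm hz.1 (h.2 hx.1) ▸ hx.2)
    · exact hzV (le_antisymm hz.2 (h.2 hy.1) ▸ hy.2)
  have hinj : ∀ Z ∈ 𝒵, ∀ φ : X → X, IsEmbedding (Z.domRestrict φ) → Set.InjOn φ Z := by
    intro Z _ φ he x hx y hy hxy
    exact congrArg Subtype.val (he.injective (a₁ := ⟨x, hx⟩) (a₂ := ⟨y, hy⟩) hxy)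
  refine ⟨?_, ?_, ?_, ?_, ?_, ?_, ?_⟩
  · intro Z Z' hne
    exact (hdis Z.2 Z'.2 (fun h => hne (Subtype.ext h))).mono (hint Z Z.2) (hint Z' Z'.2)
  · intro x hx
    obtain ⟨Z, hZ, hxZ⟩ := hcov hx
    exact ⟨⟨Z, hZ⟩, hxZ, hx⟩
  · exact fun Z => hord Z Z.2
  · intro Z
    obtain ⟨φ, heq, hemb, -, -⟩ := hφ Z Z.2
    exact ((hinj Z Z.2 φ hemb).mono Set.inter_subset_left).congr heq
  · intro Z
    obtain ⟨φ, heq, -, -, hm⟩ := hφ Z Z.2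
    exact hm.imp (fun h => (h.mono Set.inter_subset_left).congr heq)
      fun h => (h.mono Set.inter_subset_left).congr heq
  · intro Z
    obtain ⟨φ, heq, hemb, himg, hm⟩ := hφ Z Z.2
    rw [← heq.image_eq]
    have hφi := hinj Z Z.2 φ hemb
    refine ⟨?_⟩
    rintro _ ⟨x, hx, rfl⟩ _ ⟨y, hy, rfl⟩ w hw
    obtain ⟨z, hz, rfl⟩ := himg.out ⟨x, hx.1, rfl⟩ ⟨y, hy.1, rfl⟩ hw
    refine ⟨z, ?_, rfl⟩
    rcases hm with hm | hm
    · have hs := hm.strictMonoOn_of_injOn hφi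
      exact (hord Z Z.2).out hx hy ⟨(hs.le_iff_le hx.1 hz).1 hw.1, (hs.le_iff_le hz hy.1).1 hw.2⟩
    · have hs := hm.strictAntiOn_of_injOn hφi
      exact (hord Z Z.2).out hy hx ⟨(hs.le_iff_ge hz hy.1).1 hw.2, (hs.le_iff_ge hx.1 hz).1 hw.1⟩
  · rintro ⟨Z, hZ⟩
    rcases Set.eq_empty_or_nonempty (Z ∩ V) with he | ⟨z₀, hz₀⟩
    -- An empty branch is the open interval between `⊥` and `⊥`.
    · refine ⟨⊥, ⊥, le_rfl, fun x => ?_, fun u _ => ⟨rfl, rfl⟩⟩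
      rw [he]
      simp
    obtain ⟨a, ha1, ha2, ha3, ha4⟩ := exists_lower_end (hcl Z hZ).1 (hcl Z hZ).2 ⟨z₀, hz₀.1⟩
    obtain ⟨b, hb1, hb2, hb3, hb4⟩ := exists_upper_end (hcl Z hZ).1 (hcl Z hZ).2 ⟨z₀, hz₀.1⟩
    refine ⟨a, b, (ha1 _ hz₀.1).trans (hb1 _ hz₀.1), fun x => ⟨fun hx => ⟨?_, ?_⟩, fun hx => ?_⟩,
      fun u hu => ⟨?_, ?_⟩⟩
    · refine lt_of_le_of_ne (ha1 x hx.1) fun e => ?_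
      exact ((hnotV Z hZ x).1 (Or.inl ((ha3 x).2 e))).2 hx.2
    · refine lt_of_le_of_ne (hb1 x hx.1) fun e => ?_
      exact ((hnotV Z hZ x).1 (Or.inr ((hb3 x).2 e.symm))).2 hx.2
    · have hxZ : x ∈ Z := by
        rcases le_total x z₀ with h | h
        · exact ha2 x z₀ hz₀.1 h hx.1
        · exact hb2 x z₀ hz₀.1 h hx.2
      refine ⟨hxZ, ?_⟩
      by_contra hxV
      rcases (hnotV Z hZ x).2 ⟨hxZ, hxV⟩ with h | h
      · exact absurd ((ha3 x).1 h) hx.1.ne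
      · exact absurd ((hb3 x).1 h) hx.2.ne'
    · rcases ha4 with rfl | ⟨p, hp, rfl⟩
      · rfl
      · exact hu p ((hnotV Z hZ p).1 (Or.inl hp)).2
    · rcases hb4 with rfl | ⟨p, hp, rfl⟩
      · rfl
      · exact hu p ((hnotV Z hZ p).1 (Or.inr hp)).2

end Partition

-- Weighted branches and the Lasota–Yorke inequality.

theorem transferOp_congr {X : Type*} [MeasurableSpace X] (T : X → X) {μ : Measure X} {f f' : X → ℝ}
    (h : f =ᵐ[μ] f') : transferOp T μ f = transferOp T μ f' := by
  unfold transferOp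
  rw [WithDensityᵥEq.congr_ae h]

theorem transferOp_iterate_congr {X : Type*} [MeasurableSpace X] (T : X → X) {μ : Measure X}
    {f f' : X → ℝ} (h : f =ᵐ[μ] f') (n : ℕ) :
    (transferOp T μ)^[n] f =ᵐ[μ] (transferOp T μ)^[n] f' := by
  cases n with
  | zero => exact h
  | succ n => rw [Function.iterate_succ_apply, Function.iterate_succ_apply, transferOp_congr T h]

/-- The transfer operator is given by a weight of bounded variation on the branches of `T`. -/
structure IsWeightedBranchSystem {X ι : Type*} [LinearOrder X] [MeasurableSpace X] (T : X → X)
    (μ : Measure X) (V : Set X) (I : ι → Set X) (g : X → ℝ) (c : ℝ) : Prop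
    extends IsBranchSystem T V I where
  eq_zero : ∀ x ∉ V, g x = 0
  zVar_lt_top : zVar g < ⊤
  lt_one : c < 1
  abs_le : ∀ x, |g x| ≤ c
  transferOp_eq : ∀ f : X → ℝ, Integrable f μ →
      transferOp T μ f =ᵐ[μ] fun x => ∑' z : (T ⁻¹' {x} : Set X), g z * f z

theorem IsPiecewiseUniformlyExpanding.exists_weightedBranchSystem {X : Type*}
    [ConditionallyCompleteLinearOrder X] [TopologicalSpace X] [OrderTopology X] [MeasurableSpace X]
    {T : X → X} {μ : Measure X} {V : Set X} (hT : IsPiecewiseUniformlyExpanding T μ V) :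
    ∃ (𝒵 : Set (Set X)) (g : X → ℝ) (c : ℝ),
      IsWeightedBranchSystem T μ V (fun Z : 𝒵 => (Z : Set X) ∩ V) g c := by
  obtain ⟨𝒵, h𝒵⟩ := hT.exists_branchSystem
  obtain ⟨g, hg0, hgv, hgV, hgP, c, hc1, hc⟩ := hT.exists_weight
  refine ⟨𝒵, g, max c 0, { h𝒵 with
    eq_zero := hgV
    zVar_lt_top := zVar_lt_top_of_boundedVariationOn hgv
    lt_one := max_lt hc1 one_pos
    abs_le := fun x => ?_
    transferOp_eq := hgP }⟩
  rw [abs_of_nonneg (hg0 x)]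
  by_cases hx : x ∈ V
  · exact (hc x hx).trans (le_max_left _ _)
  · rw [hgV x hx]
    exact le_max_right _ _

/-- On an order-convex set on which the weight oscillates little, multiplication by the weight
contracts the variation up to a multiple of a single value. -/
theorem zVar_indicator_mul_le {X : Type*} [LinearOrder X] {w u : X → ℝ} {J : Set X}
    (hJ : J.OrdConnected) {p : X} (hp : p ∈ J) {s ε : ℝ≥0∞} (hs : ∀ x, ENNReal.ofReal |w x| ≤ s) (hε : eVariationOn w J ≤ ε) :
    zVar (J.indicator (w * u)) ≤ 3 * (s + ε) * eVariationOn u J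
      + 3 * (s + ε) * ENNReal.ofReal |u p| := by
  set q := ENNReal.ofReal |u p|
  set v := eVariationOn u J
  have hbd : ∀ x ∈ J, ENNReal.ofReal |u x| ≤ q + v := by
    intro x hx
    have h1 := eVariationOn.edist_le u hx hp
    rw [ENNReal.edist_eq_abs] at h1
    refine le_trans ?_ (add_le_add le_rfl h1)
    rw [← ENNReal.ofReal_add (abs_nonneg _) (abs_nonneg _)]
    refine ENNReal.ofReal_le_ofReal ?_
    have := abs_add_le (u p) (u x - u p)
    simpa using this
  have h1 : eVariationOn (w * u) J ≤ s * v + (q + v) * ε :=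
    (eVariationOn_mul_le (fun x _ => hs x) hbd).trans (by gcongr)
  have h2 : ENNReal.ofReal |(w * u) p| ≤ s * q := by
    rw [Pi.mul_apply, abs_mul, ENNReal.ofReal_mul (abs_nonneg _)]
    gcongr
    exact hs p
  calc zVar (J.indicator (w * u)) ≤ 3 * eVariationOn (w * u) J + 2 * ENNReal.ofReal |(w * u) p| :=
        zVar_indicator_le_eVariationOn _ hJ hp
    _ ≤ 3 * (s * v + (q + v) * ε) + 3 * (s * q) := by
        gcongr
        norm_num
    _ = _ := by ring

/-- Null intervals may be discarded because the operator sees only classes modulo null sets; this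
permits averaging over the intervals that remain. -/
theorem ae_eq_sum_indicator_levelSet {X : Type*} [MeasurableSpace X] {μ : Measure X} {m : X → ℝ}
    {ε : ℝ} (hε : 0 < ε) {K : ℕ} (h0 : ∀ x, 0 ≤ m x) (hK : ∀ x, m x < K * ε) (u : X → ℝ) {S : Finset ℕ}
    (hS : ∀ k ∈ Finset.range K, k ∉ S → μ (levelSet m ε k) = 0) :
    u =ᵐ[μ] fun x => ∑ k ∈ S, (levelSet m ε k).indicator u x := by
  have hnull : μ (⋃ k ∈ (Finset.range K).filter (· ∉ S), levelSet m ε k) = 0 :=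
    (measure_biUnion_null_iff (Finset.countable_toSet _)).2 fun k hk =>
      hS k (Finset.mem_filter.1 hk).1 (Finset.mem_filter.1 hk).2
  filter_upwards [measure_eq_zero_iff_ae_notMem.1 hnull] with x hx
  obtain ⟨k, hk, hxk⟩ := exists_mem_levelSet hε (h0 x) (hK x)
  have hkS : k ∈ S := by
    by_contra hkS
    exact hx (Set.mem_biUnion (Finset.mem_filter.2 ⟨hk, hkS⟩) hxk)
  exact (sum_indicator_levelSet hε S u hkS hxk).symm

section LasotaYorke

variable {X ι : Type*} [LinearOrder X] [TopologicalSpace X] [OrderTopology X] [MeasurableSpace X]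
  [BorelSpace X] {T : X → X} {μ : Measure X} [IsProbabilityMeasure μ] {V : Set X} {I : ι → Set X}
  {g : X → ℝ} {c : ℝ}

theorem IsWeightedBranchSystem.transferOp_ae_eq [Nonempty X]
    (hI : IsWeightedBranchSystem T μ V I g c) {u : X → ℝ} (hu : zVar u < ⊤) :
    transferOp T μ u =ᵐ[μ] branchSum T I (g * u) := by
  refine (hI.transferOp_eq u (integrable_of_zVar_lt_top hu μ)).trans
    (Eventually.of_forall fun y => ?_)
  exact hI.toIsBranchSystem.tsum_fiber (u := g * u) (fun x hx => by simp [hI.eq_zero x hx]) y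

/-- Variation is not invariant under changes on null sets, so the bound is attached to the explicit
representative built from branch sums. -/
theorem IsWeightedBranchSystem.exists_ae_eq_iterate [Nonempty X]
    (hI : IsWeightedBranchSystem T μ V I g c) (n : ℕ) {u : X → ℝ} (hu : zVar u < ⊤) :
    ∃ v, (transferOp T μ)^[n] u =ᵐ[μ] v ∧ zVar v ≤ zVar (iterWeight T g n * u) := by
  refine ⟨(branchSum T I)^[n] (iterWeight T g n * u), ?_,
    hI.toIsBranchSystem.zVar_iterate_le hI.eq_zero n u⟩
  induction n generalizing u with
  | zero => simp [iterWeight]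
  | succ n ih =>
    rw [branchSum_iterate_succ, Function.iterate_succ_apply]
    refine (transferOp_iterate_congr T (hI.transferOp_ae_eq hu) n).trans (ih ?_)
    refine (hI.toIsBranchSystem.zVar_branchSum_le fun x hx => by simp [hI.eq_zero x hx]).trans_lt ?_
    exact zVar_mul_lt_top hI.zVar_lt_top hu

/-- The Lasota–Yorke inequality. -/
theorem IsWeightedBranchSystem.exists_lasotaYorke
    (hI : IsWeightedBranchSystem T μ V I g c) :
    ∃ (N : ℕ) (K : ℝ≥0), 0 < N ∧ ∀ u : X → ℝ, zVar u < ⊤ →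
      ∃ v, (transferOp T μ)^[N] u =ᵐ[μ] v ∧
        zVar v ≤ zVar u / 2 + K * ∫⁻ x, ENNReal.ofReal |u x| ∂μ := by
  classical
  have : Nonempty X := nonempty_of_isProbabilityMeasure μ
  have hc0 : 0 ≤ c := (abs_nonneg _).trans (hI.abs_le this.some)
  -- With both the supremum and the oscillation of the weight at most 1/12, the coefficient `3 * (s
  -- + ε)` in `zVar_indicator_mul_le` is 1/2.
  obtain ⟨N, hN⟩ := exists_pow_lt_of_lt_one (show (0 : ℝ) < 1 / 12 by norm_num) hI.lt_one
  have hN0 : 0 < N := by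
    rcases Nat.eq_zero_or_pos N with rfl | h
    · norm_num at hN
    · exact h
  set w := iterWeight T g N
  have hw : zVar w < ⊤ := hI.toIsBranchSystem.zVar_iterWeight_lt_top hI.eq_zero hI.zVar_lt_top N
  have hws : ∀ x, ENNReal.ofReal |w x| ≤ ENNReal.ofReal (1 / 12) := fun x =>
    ENNReal.ofReal_le_ofReal ((abs_iterWeight_le hI.abs_le N x).trans hN.le)
  set m := variationFun w
  have hm : Monotone m := variationFun_mono hw
  have hε : (0 : ℝ) < 1 / 12 := by norm_num
  obtain ⟨K, hK⟩ := exists_nat_gt ((zVar w).toReal / (1 / 12))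
  have hK' : ∀ x, m x < K * (1 / 12) := fun x =>
    (variationFun_le hw x).trans_lt ((div_lt_iff₀ hε).1 hK)
  have h0 : ∀ x, 0 ≤ m x := fun x => ENNReal.toReal_nonneg
  set J := levelSet m (1 / 12)
  have hJ : ∀ k, (J k).OrdConnected := levelSet_ordConnected hm _
  set S := (Finset.range K).filter fun k => μ (J k) ≠ 0
  have hconst : 3 * (ENNReal.ofReal (1 / 12) + ENNReal.ofReal (1 / 12)) = 2⁻¹ := by
    rw [← ENNReal.ofReal_add hε.le hε.le, show (3 : ℝ≥0∞) = ENNReal.ofReal 3 by simp,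
      ← ENNReal.ofReal_mul (by norm_num), show (2 : ℝ≥0∞) = ENNReal.ofReal 2 by simp,
      ← ENNReal.ofReal_inv_of_pos (by norm_num)]
    norm_num
  have hKtop : ∑ k ∈ S, (μ (J k))⁻¹ ≠ ⊤ :=
    ENNReal.sum_ne_top.2 fun k hk => ENNReal.inv_ne_top.2 (Finset.mem_filter.1 hk).2
  refine ⟨N, (∑ k ∈ S, (μ (J k))⁻¹).toNNReal, hN0, fun u hu => ?_⟩
  set u' : X → ℝ := fun x => ∑ k ∈ S, (J k).indicator u x
  have huu' : u =ᵐ[μ] u' := ae_eq_sum_indicator_levelSet hε h0 hK' u fun k hk hkS => by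
    by_contra h
    exact hkS (Finset.mem_filter.2 ⟨hk, h⟩)
  have hu' : zVar u' < ⊤ := (zVar_sum_le _ _).trans_lt
    (ENNReal.sum_lt_top.2 fun k _ => (zVar_indicator_le u (hJ k)).trans_lt hu)
  obtain ⟨v, hv, hvle⟩ := hI.exists_ae_eq_iterate N hu'
  refine ⟨v, (transferOp_iterate_congr T huu' N).trans hv, hvle.trans ?_⟩
  have hprod : w * u' = fun x => ∑ k ∈ S, (J k).indicator (w * u) x := by
    funext x
    rw [Pi.mul_apply, Finset.mul_sum]
    refine Finset.sum_congr rfl fun k _ => ?_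
    by_cases hx : x ∈ J k <;> simp [hx]
  have hterm : ∀ k ∈ S, zVar ((J k).indicator (w * u)) ≤ 2⁻¹ * eVariationOn u (J k)
      + (μ (J k))⁻¹ * ∫⁻ x, ENNReal.ofReal |u x| ∂μ := by
    intro k hk
    have hμk : μ (J k) ≠ 0 := (Finset.mem_filter.1 hk).2
    -- At `p` the value of `|u|` is at most its mean over `J k`; this turns a point value into an
    -- `L¹` norm divided by `μ (J k)`.
    obtain ⟨p, hp, hple⟩ := exists_le_setLAverage (μ := μ) (s := J k)
      (f := fun x => ENNReal.ofReal |u x|) hμk (measure_ne_top _ _)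
      (measurable_of_zVar_lt_top hu).abs.ennreal_ofReal.aemeasurable
    have h1 := zVar_indicator_mul_le (u := u) (hJ k) hp hws
      (eVariationOn_levelSet_variationFun_le hw (1 / 12) k)
    rw [hconst] at h1
    refine h1.trans (add_le_add le_rfl ?_)
    rw [setLAverage_eq] at hple
    calc 2⁻¹ * ENNReal.ofReal |u p| ≤ 1 * ENNReal.ofReal |u p| := by
          gcongr
          exact ENNReal.inv_le_one.2 (by norm_num)
      _ ≤ (μ (J k))⁻¹ * ∫⁻ x in J k, ENNReal.ofReal |u x| ∂μ := by
          rw [one_mul, ← ENNReal.div_eq_inv_mul]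
          exact hple
      _ ≤ _ := by gcongr; exact Measure.restrict_le_self
  rw [ENNReal.coe_toNNReal hKtop, hprod]
  calc zVar (fun x => ∑ k ∈ S, (J k).indicator (w * u) x)
      ≤ ∑ k ∈ S, zVar ((J k).indicator (w * u)) := zVar_sum_le _ _
    _ ≤ ∑ k ∈ S, (2⁻¹ * eVariationOn u (J k) + (μ (J k))⁻¹ * ∫⁻ x, ENNReal.ofReal |u x| ∂μ) :=
        Finset.sum_le_sum hterm
    _ = 2⁻¹ * ∑ k ∈ S, eVariationOn u (J k)
        + (∑ k ∈ S, (μ (J k))⁻¹) * ∫⁻ x, ENNReal.ofReal |u x| ∂μ := by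
        rw [Finset.sum_add_distrib, Finset.mul_sum, Finset.sum_mul]
    _ ≤ zVar u / 2 + (∑ k ∈ S, (μ (J k))⁻¹) * ∫⁻ x, ENNReal.ofReal |u x| ∂μ := by
        rw [ENNReal.div_eq_inv_mul]
        gcongr
        refine le_trans (Finset.sum_le_sum_of_subset (Finset.filter_subset _ _)) ?_
        exact (sum_eVariationOn_levelSet_le hε hm u K).trans (eVariationOn_le_zVar u _)

theorem IsWeightedBranchSystem.exists_zVar_transferOp_le [Nonempty X]
    (hI : IsWeightedBranchSystem T μ V I g c) {u : X → ℝ} (hu : zVar u < ⊤) :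
    ∃ v, transferOp T μ u =ᵐ[μ] v ∧ zVar v ≤ 2 * zVar g * zVar u := by
  refine ⟨_, hI.transferOp_ae_eq hu, (hI.toIsBranchSystem.zVar_branchSum_le
    fun x hx => by simp [hI.eq_zero x hx]).trans ?_⟩
  refine (zVar_mul_le (fun x => ofReal_abs_le_zVar g x)
    fun x => ofReal_abs_le_zVar u x).trans (le_of_eq ?_)
  ring

/-- The measure has no atoms. -/
theorem IsWeightedBranchSystem.measure_singleton (hI : IsWeightedBranchSystem T μ V I g c)
    (hT : Measure.QuasiMeasurePreserving T μ μ) (x : X) : μ {x} = 0 := by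
  classical
  have hc0 : 0 ≤ c := (abs_nonneg _).trans (hI.abs_le x)
  have hstep : ∀ x, μ.real {x} ≤ c * μ.real {T x} := by
    intro x
    -- Testing the operator on the indicator of `{x}` gives `μ {x} = g x * μ {T x}`; following the
    -- orbit yields the bound `c ^ n`.
    have hint : Integrable (Set.indicator {x} (1 : X → ℝ)) μ :=
      (integrable_const (1 : ℝ)).indicator (measurableSet_singleton x)
    have h1 := setIntegral_transferOp hT hint (measurableSet_singleton (T x))
    rw [setIntegral_congr_ae (measurableSet_singleton _)
      ((hI.transferOp_eq _ hint).mono fun y hy _ => hy), integral_singleton,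
      setIntegral_indicator (measurableSet_singleton x)] at h1
    have h2 : T ⁻¹' {T x} ∩ {x} = {x} := Set.inter_eq_right.2 (by simp)
    have h3 : ∑' z : (T ⁻¹' {T x} : Set X), g z * Set.indicator {x} (1 : X → ℝ) z = g x := by
      rw [tsum_eq_single ⟨x, rfl⟩]
      · simp
      · rintro ⟨z, hz⟩ hne
        have : z ≠ x := fun e => hne (Subtype.ext e)
        simp [this]
    rw [h2, h3] at h1
    simp only [Pi.one_apply, integral_const, smul_eq_mul, mul_one,
      measureReal_restrict_apply_univ] at h1
    rw [← h1, mul_comm]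
    exact mul_le_mul_of_nonneg_right ((le_abs_self _).trans (hI.abs_le x)) measureReal_nonneg
  have hiter : ∀ n x, μ.real {x} ≤ c ^ n := by
    intro n
    induction n with
    | zero => intro x; simp
    | succ n ih =>
      intro x
      rw [pow_succ']
      exact (hstep x).trans (mul_le_mul_of_nonneg_left (ih _) hc0)
  have h0 : μ.real {x} ≤ 0 :=
    ge_of_tendsto' (tendsto_pow_atTop_nhds_zero_of_lt_one hc0 hI.lt_one) fun n => hiter n x
  exact (measureReal_eq_zero_iff).1 (le_antisymm h0 measureReal_nonneg)

end LasotaYorke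

-- The transfer operator on the lattice `L¹`.

theorem L1_norm_eq_integral_of_nonneg {X : Type*} [MeasurableSpace X] {μ : Measure X} {f : Lp ℝ 1 μ}
    (hf : 0 ≤ f) : ‖f‖ = ∫ x, f x ∂μ := by
  rw [← Lp.coeFn_nonneg] at hf
  rw [L1.norm_eq_integral_norm]
  refine integral_congr_ae ?_
  filter_upwards [hf] with x hx
  rw [Real.norm_of_nonneg hx]

theorem L1_norm_add_of_nonneg {X : Type*} [MeasurableSpace X] {μ : Measure X} {f g : Lp ℝ 1 μ}
    (hf : 0 ≤ f) (hg : 0 ≤ g) : ‖f + g‖ = ‖f‖ + ‖g‖ := by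
  rw [L1_norm_eq_integral_of_nonneg hf, L1_norm_eq_integral_of_nonneg hg,
    L1_norm_eq_integral_of_nonneg (add_nonneg hf hg),
    ← integral_add (L1.integrable_coeFn f) (L1.integrable_coeFn g)]
  exact integral_congr_ae (Lp.coeFn_add f g)

section TransferOperator

variable {X : Type*} [MeasurableSpace X] {T : X → X} {μ : Measure X} [IsFiniteMeasure μ]

theorem transferOp_ae_eq_of_setIntegral (hT : Measure.QuasiMeasurePreserving T μ μ) {f q : X → ℝ}
    (hf : Integrable f μ) (hq : Integrable q μ)
    (h : ∀ A, MeasurableSet A → ∫ x in A, q x ∂μ = ∫ x in T ⁻¹' A, f x ∂μ) :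
    transferOp T μ f =ᵐ[μ] q :=
  Integrable.ae_eq_of_forall_setIntegral_eq _ _ (transferOp_integrable T μ f) hq fun A hA _ => by
    rw [setIntegral_transferOp hT hf hA, h A hA]

theorem transferOp_add (hT : Measure.QuasiMeasurePreserving T μ μ) {f g : X → ℝ}
    (hf : Integrable f μ) (hg : Integrable g μ) :
    transferOp T μ (f + g) =ᵐ[μ] transferOp T μ f + transferOp T μ g := by
  have h1 := transferOp_integrable T μ f
  have h2 := transferOp_integrable T μ g
  refine transferOp_ae_eq_of_setIntegral hT (hf.add hg) (h1.add h2) fun A hA => ?_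
  simp only [Pi.add_apply]
  rw [integral_add h1.integrableOn h2.integrableOn, integral_add hf.integrableOn hg.integrableOn,
    setIntegral_transferOp hT hf hA, setIntegral_transferOp hT hg hA]

theorem transferOp_smul (hT : Measure.QuasiMeasurePreserving T μ μ) {f : X → ℝ}
    (hf : Integrable f μ) (c : ℝ) : transferOp T μ (c • f) =ᵐ[μ] c • transferOp T μ f := by
  have h1 := transferOp_integrable T μ f
  refine transferOp_ae_eq_of_setIntegral hT (hf.smul c) (h1.smul c) fun A hA => ?_
  simp only [Pi.smul_apply]
  rw [integral_smul, integral_smul, setIntegral_transferOp hT hf hA]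

theorem transferOp_nonneg (hT : Measure.QuasiMeasurePreserving T μ μ) {f : X → ℝ}
    (hf : Integrable f μ) (h0 : 0 ≤ᵐ[μ] f) : 0 ≤ᵐ[μ] transferOp T μ f :=
  ae_nonneg_of_forall_setIntegral_nonneg (transferOp_integrable T μ f) fun A hA _ => by
    rw [setIntegral_transferOp hT hf hA]
    exact integral_nonneg_of_ae (ae_restrict_of_ae h0)

/-- Positivity applied to `|f| + f` and `|f| - f`. -/
theorem abs_transferOp_le (hT : Measure.QuasiMeasurePreserving T μ μ) {f : X → ℝ}
    (hf : Integrable f μ) : ∀ᵐ x ∂μ, |transferOp T μ f x| ≤ transferOp T μ (fun x => |f x|) x := by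
  have h1 := transferOp_nonneg hT (hf.abs.add hf)
    (Eventually.of_forall fun x => by simpa using neg_le_iff_add_nonneg'.1 (neg_abs_le (f x)))
  have h2 := transferOp_nonneg hT (hf.abs.add (hf.smul (-1 : ℝ)))
    (Eventually.of_forall fun x => by simpa using (le_abs_self (f x)))
  filter_upwards [h1, h2, transferOp_add hT hf.abs hf, transferOp_add hT hf.abs (hf.smul (-1 : ℝ)),
    transferOp_smul hT hf (-1)] with x a1 a2 a3 a4 a5
  rw [a3] at a1
  rw [a4] at a2
  simp only [Pi.zero_apply, Pi.add_apply] at a1 a2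
  rw [a5] at a2
  simp only [Pi.smul_apply, smul_eq_mul] at a2
  exact abs_le.2 ⟨by linarith, by linarith⟩

theorem integral_transferOp (hT : Measure.QuasiMeasurePreserving T μ μ) {f : X → ℝ}
    (hf : Integrable f μ) : ∫ x, transferOp T μ f x ∂μ = ∫ x, f x ∂μ := by
  simpa using setIntegral_transferOp hT hf MeasurableSet.univ

theorem integral_abs_transferOp_le (hT : Measure.QuasiMeasurePreserving T μ μ) {f : X → ℝ}
    (hf : Integrable f μ) : ∫ x, |transferOp T μ f x| ∂μ ≤ ∫ x, |f x| ∂μ := by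
  rw [← integral_transferOp hT hf.abs]
  exact integral_mono_ae (transferOp_integrable T μ f).abs (transferOp_integrable T μ _)
    (abs_transferOp_le hT hf)

/-- The transfer operator as a bounded operator on `L¹(μ)`. -/
def transferL (hT : Measure.QuasiMeasurePreserving T μ μ) : Lp ℝ 1 μ →L[ℝ] Lp ℝ 1 μ :=
  LinearMap.mkContinuous
    { toFun := fun f => (transferOp_integrable T μ f).toL1 _
      map_add' := fun f g => by
        rw [← Integrable.toL1_add]
        refine (Integrable.toL1_eq_toL1_iff _ _ _ _).2 ?_
        rw [transferOp_congr T (Lp.coeFn_add f g)]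
        exact transferOp_add hT (L1.integrable_coeFn f) (L1.integrable_coeFn g)
      map_smul' := fun c f => by
        rw [RingHom.id_apply, ← Integrable.toL1_smul]
        refine (Integrable.toL1_eq_toL1_iff _ _ _ _).2 ?_
        rw [transferOp_congr T (Lp.coeFn_smul c f)]
        exact transferOp_smul hT (L1.integrable_coeFn f) c } 1 fun f => by
    rw [one_mul, L1.norm_eq_integral_norm, L1.norm_eq_integral_norm]
    have h := (transferOp_integrable T μ f).coeFn_toL1
    refine le_trans (le_of_eq (integral_congr_ae ?_))
      (integral_abs_transferOp_le hT (L1.integrable_coeFn f))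
    filter_upwards [h] with x hx
    simp only [LinearMap.coe_mk, AddHom.coe_mk]
    rw [hx, Real.norm_eq_abs]

theorem coeFn_transferL (hT : Measure.QuasiMeasurePreserving T μ μ) (f : Lp ℝ 1 μ) :
    transferL hT f =ᵐ[μ] transferOp T μ f :=
  (transferOp_integrable T μ f).coeFn_toL1

theorem coeFn_transferL_pow (hT : Measure.QuasiMeasurePreserving T μ μ) (n : ℕ) (f : Lp ℝ 1 μ) :
    (transferL hT ^ n) f =ᵐ[μ] (transferOp T μ)^[n] f := by
  induction n generalizing f with
  | zero => rfl
  | succ n ih =>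
    rw [pow_succ, Function.iterate_succ_apply]
    exact (ih _).trans (transferOp_iterate_congr T (coeFn_transferL hT f) n)

theorem coeFn_transferL_pow_of_ae_eq (hT : Measure.QuasiMeasurePreserving T μ μ) (n : ℕ)
    {f : Lp ℝ 1 μ} {u : X → ℝ} (h : f =ᵐ[μ] u) :
    (transferL hT ^ n) f =ᵐ[μ] (transferOp T μ)^[n] u :=
  (coeFn_transferL_pow hT n f).trans (transferOp_iterate_congr T h n)

theorem transferL_nonneg (hT : Measure.QuasiMeasurePreserving T μ μ) {f : Lp ℝ 1 μ} (hf : 0 ≤ f) :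
    0 ≤ transferL hT f := by
  rw [← Lp.coeFn_nonneg] at hf ⊢
  filter_upwards [transferOp_nonneg hT (L1.integrable_coeFn f) hf, coeFn_transferL hT f] with x h1 h2
  rw [h2]
  exact h1

theorem norm_transferL_of_nonneg (hT : Measure.QuasiMeasurePreserving T μ μ) {f : Lp ℝ 1 μ}
    (hf : 0 ≤ f) : ‖transferL hT f‖ = ‖f‖ := by
  rw [L1_norm_eq_integral_of_nonneg hf, L1_norm_eq_integral_of_nonneg (transferL_nonneg hT hf),
    ← integral_transferOp hT (L1.integrable_coeFn f)]
  exact integral_congr_ae (coeFn_transferL hT f)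

theorem setIntegral_transferL (hT : Measure.QuasiMeasurePreserving T μ μ) (f : Lp ℝ 1 μ)
    {A : Set X} (hA : MeasurableSet A) :
    ∫ x in A, transferL hT f x ∂μ = ∫ x in T ⁻¹' A, f x ∂μ := by
  rw [← setIntegral_transferOp hT (L1.integrable_coeFn f) hA]
  exact integral_congr_ae (ae_restrict_of_ae (coeFn_transferL hT f))

end TransferOperator

theorem ofReal_norm_sub_eq_lintegral {X : Type*} [MeasurableSpace X] {μ : Measure X}
    {f g : Lp ℝ 1 μ} {u v : X → ℝ} (hf : f =ᵐ[μ] u) (hg : g =ᵐ[μ] v) :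
    ENNReal.ofReal ‖f - g‖ = ∫⁻ x, ENNReal.ofReal |u x - v x| ∂μ := by
  rw [L1.ofReal_norm_sub_eq_lintegral]
  refine lintegral_congr_ae ?_
  filter_upwards [hf, hg] with x h1 h2
  rw [h1, h2, Real.enorm_eq_ofReal_abs]

theorem ofReal_norm_eq_lintegral {X : Type*} [MeasurableSpace X] {μ : Measure X}
    {f : Lp ℝ 1 μ} {u : X → ℝ} (hf : f =ᵐ[μ] u) :
    ENNReal.ofReal ‖f‖ = ∫⁻ x, ENNReal.ofReal |u x| ∂μ := by
  have := ofReal_norm_sub_eq_lintegral hf (Lp.coeFn_zero ℝ 1 μ)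
  simpa using this

-- Functions of bounded variation as a compact scale in `L¹`.

/-- A scale of closed sets `D c` (balls of a stronger norm) for which the operator `P` satisfies a
Lasota–Yorke inequality. -/
structure IsLasotaYorke {B : Type*} [NormedAddCommGroup B] [NormedSpace ℝ B] (P : B →L[ℝ] B)
    (D : ℝ≥0 → Set B) : Prop where
  isClosed : ∀ c, IsClosed (D c)
  mono : ∀ {c d}, c ≤ d → D c ⊆ D d
  add_mem : ∀ {c d f g}, f ∈ D c → g ∈ D d → f + g ∈ D (c + d)
  smul_mem : ∀ {c f} (t : ℝ), f ∈ D c → t • f ∈ D (‖t‖₊ * c)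
  norm_le : ∀ {c f}, f ∈ D c → ‖f‖ ≤ c
  totallyBounded : ∀ c, TotallyBounded (D c)
  dense : ∀ (f : B) (ε : ℝ), 0 < ε → ∃ c, ∃ g ∈ D c, ‖f - g‖ < ε
  step : ∃ K : ℝ≥0, ∀ c, ∀ f ∈ D c, P f ∈ D (K * c)
  contract : ∃ (N : ℕ) (K : ℝ≥0), 0 < N ∧ ∀ c, ∀ f ∈ D c, (P ^ N) f ∈ D (c / 2 + K * ‖f‖₊)

theorem totallyBounded_of_approx {B : Type*} [PseudoMetricSpace B] {s : Set B}
    (h : ∀ ε > 0, ∃ t : Set B, TotallyBounded t ∧ ∀ x ∈ s, ∃ y ∈ t, dist x y ≤ ε) :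
    TotallyBounded s := by
  rw [Metric.totallyBounded_iff]
  intro ε hε
  obtain ⟨t, ht, hst⟩ := h (ε / 2) (half_pos hε)
  obtain ⟨F, hF, htF⟩ := Metric.totallyBounded_iff.1 ht (ε / 2) (half_pos hε)
  refine ⟨F, hF, fun x hx => ?_⟩
  obtain ⟨y, hy, hxy⟩ := hst x hx
  obtain ⟨z, hz, hyz⟩ := Set.mem_iUnion₂.1 (htF hy)
  refine Set.mem_iUnion₂.2 ⟨z, hz, ?_⟩
  rw [Metric.mem_ball] at hyz ⊢
  linarith [dist_triangle x y z]

/-- Finitely many order components of `U` cover `K`. Each is order-convex, so its indicator has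
finite variation, and inclusion–exclusion passes to the union. -/
theorem exists_zVar_indicator_lt_top_between {X : Type*} [LinearOrder X]
    [TopologicalSpace X] [OrderTopology X] {K U : Set X} (hK : IsCompact K) (hU : IsOpen U) (hKU : K ⊆ U) :
    ∃ O, K ⊆ O ∧ O ⊆ U ∧ zVar (O.indicator (1 : X → ℝ)) < ⊤ := by
  obtain ⟨t, ht, hcov⟩ := hK.elim_nhds_subcover (fun x => U.ordConnectedComponent x) fun x hx =>
    Set.ordConnectedComponent_mem_nhds.2 (hU.mem_nhds (hKU hx))
  refine ⟨_, hcov, Set.iUnion₂_subset fun x _ => Set.ordConnectedComponent_subset, ?_⟩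
  clear hcov ht
  classical
  induction t using Finset.induction_on with
  | empty => simp [show (fun _ : X => (0 : ℝ)) = 0 from rfl, zVar_zero]
  | insert a t ha ih =>
    rw [Finset.set_biUnion_insert]
    set A := U.ordConnectedComponent a
    set C := ⋃ x ∈ t, U.ordConnectedComponent x
    have hA : zVar (A.indicator (1 : X → ℝ)) < ⊤ :=
      (zVar_indicator_le _ inferInstance).trans_lt zVar_one_lt_top
    have he : (A ∪ C).indicator (1 : X → ℝ) = A.indicator 1 + (C.indicator 1
        + (-1 : ℝ) • (A.indicator 1 * C.indicator 1)) := by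
      funext x
      by_cases h1 : x ∈ A <;> by_cases h2 : x ∈ C <;> simp [h1, h2]
    rw [he]
    refine (zVar_add_le _ _).trans_lt (ENNReal.add_lt_top.2 ⟨hA, ?_⟩)
    refine (zVar_add_le _ _).trans_lt (ENNReal.add_lt_top.2 ⟨ih, ?_⟩)
    exact (zVar_const_smul_le _ _).trans_lt
      (ENNReal.mul_lt_top ENNReal.ofReal_lt_top (zVar_mul_lt_top hA ih))

section BVSet

variable {X : Type*} [LinearOrder X] [MeasurableSpace X]

/-- The classes of functions whose variation is at most `c`. -/
def bvSet (μ : Measure X) (c : ℝ≥0) : Set (Lp ℝ 1 μ) := {f | ∃ u, zVar u ≤ c ∧ f =ᵐ[μ] u}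

variable {μ : Measure X}

theorem bvSet_mono {c d : ℝ≥0} (h : c ≤ d) : bvSet μ c ⊆ bvSet μ d :=
  fun _ ⟨u, hu, hf⟩ => ⟨u, hu.trans (by exact_mod_cast h), hf⟩

theorem bvSet_add {c d : ℝ≥0} {f g : Lp ℝ 1 μ} (hf : f ∈ bvSet μ c) (hg : g ∈ bvSet μ d) :
    f + g ∈ bvSet μ (c + d) := by
  obtain ⟨u, hu, hfu⟩ := hf
  obtain ⟨v, hv, hgv⟩ := hg
  refine ⟨u + v, (zVar_add_le u v).trans ?_, (Lp.coeFn_add f g).trans (hfu.add hgv)⟩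
  rw [ENNReal.coe_add]
  exact add_le_add hu hv

theorem bvSet_smul {c : ℝ≥0} {f : Lp ℝ 1 μ} (t : ℝ) (hf : f ∈ bvSet μ c) :
    t • f ∈ bvSet μ (‖t‖₊ * c) := by
  obtain ⟨u, hu, hfu⟩ := hf
  refine ⟨t • u, (zVar_const_smul_le t u).trans ?_, (Lp.coeFn_smul t f).trans (hfu.const_smul t)⟩
  rw [ENNReal.coe_mul, ← Real.enorm_eq_ofReal_abs]
  exact mul_le_mul' le_rfl hu

theorem norm_le_of_mem_bvSet [IsProbabilityMeasure μ] {c : ℝ≥0} {f : Lp ℝ 1 μ}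
    (hf : f ∈ bvSet μ c) : ‖f‖ ≤ c := by
  obtain ⟨u, hu, hfu⟩ := hf
  have h : ENNReal.ofReal ‖f‖ ≤ c := by
    rw [ofReal_norm_eq_lintegral hfu]
    calc _ ≤ ∫⁻ _, (c : ℝ≥0∞) ∂μ := lintegral_mono fun x => (ofReal_abs_le_zVar u x).trans hu
      _ = c := by simp
  simpa using ENNReal.toReal_mono ENNReal.coe_ne_top h

theorem measure_symmDiff_lt_of_between {α : Type*} [MeasurableSpace α] {μ : Measure α}
    [IsFiniteMeasure μ] {K s O U : Set α} (hK : MeasurableSet K) (hKs : K ⊆ s) (hsU : s ⊆ U)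
    (hKO : K ⊆ O) (hOU : O ⊆ U) {ε : ℝ≥0∞} (h1 : μ s < μ K + ε) (h2 : μ U < μ s + ε) :
    μ (symmDiff s O) < ε + ε := by
  have hsub : symmDiff s O ⊆ U \ K := by
    rintro x (⟨hx, hx'⟩ | ⟨hx, hx'⟩)
    · exact ⟨hsU hx, fun h => hx' (hKO h)⟩
    · exact ⟨hOU hx, fun h => hx' (hKs h)⟩
  refine (measure_mono hsub).trans_lt ?_
  rw [measure_sdiff (hKs.trans hsU) hK.nullMeasurableSet (measure_ne_top _ _)]
  refine ENNReal.sub_lt_of_lt_add (measure_mono (hKs.trans hsU)) ?_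
  refine h2.trans_le ?_
  calc μ s + ε ≤ (μ K + ε) + ε := by gcongr
    _ = ε + ε + μ K := by ring

variable [TopologicalSpace X] [OrderTopology X] [BorelSpace X]

theorem exists_zVar_indicator_lt_top_symmDiff_lt [IsFiniteMeasure μ] [μ.Regular] {s : Set X}
    (hs : MeasurableSet s) {ε : ℝ≥0∞} (hε : ε ≠ 0) :
    ∃ O, zVar (O.indicator (1 : X → ℝ)) < ⊤ ∧ μ (symmDiff s O) < ε := by
  have hε2 : ε / 2 ≠ 0 := by simpa using hε
  obtain ⟨K, hKs, hK, hK'⟩ := hs.exists_isCompact_lt_add (measure_ne_top μ s) hε2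
  obtain ⟨U, hsU, hU, hU'⟩ := s.exists_isOpen_lt_add (measure_ne_top μ s) hε2
  obtain ⟨O, hKO, hOU, hO⟩ := exists_zVar_indicator_lt_top_between hK hU (hKs.trans hsU)
  refine ⟨O, hO, ?_⟩
  have := measure_symmDiff_lt_of_between hK.isClosed.measurableSet hKs hsU hKO hOU hK' hU'
  rwa [ENNReal.add_halves] at this

/-- Regularity squeezes a measurable set between a compact and an open one, and a finite union of
order components fits between them. Density follows from indicators by linearity and closure. -/
theorem mem_closure_iUnion_bvSet [IsProbabilityMeasure μ] [μ.Regular] (f : Lp ℝ 1 μ) :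
    f ∈ closure (⋃ c, bvSet μ c) := by
  refine Lp.induction ENNReal.one_ne_top (fun f => f ∈ closure (⋃ c, bvSet μ c)) ?_ ?_ ?_ f
  · intro c s hs hμs
    rw [Metric.mem_closure_iff]
    intro ε hε
    obtain ⟨O, hO, hsO⟩ := exists_zVar_indicator_lt_top_symmDiff_lt (μ := μ) hs
      (ε := ENNReal.ofReal (ε / (|c| + 1))) (by simp; positivity)
    have hcO : zVar (c • O.indicator (1 : X → ℝ)) < ⊤ :=
      (zVar_const_smul_le _ _).trans_lt (ENNReal.mul_lt_top ENNReal.ofReal_lt_top hO)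
    have hint := integrable_of_zVar_lt_top hcO μ
    refine ⟨hint.toL1 _, Set.mem_iUnion.2 ⟨(zVar (c • O.indicator (1 : X → ℝ))).toNNReal,
      _, (ENNReal.coe_toNNReal hcO.ne).ge, hint.coeFn_toL1⟩, ?_⟩
    have hind : ((Lp.simpleFunc.indicatorConst 1 hs hμs.ne c : Lp.simpleFunc ℝ 1 μ) : Lp ℝ 1 μ)
        =ᵐ[μ] s.indicator fun _ => c := by
      rw [Lp.simpleFunc.coe_indicatorConst]
      exact indicatorConstLp_coeFn
    rw [dist_eq_norm, ← ENNReal.ofReal_lt_ofReal_iff hε,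
      ofReal_norm_sub_eq_lintegral hind hint.coeFn_toL1]
    have hle : ∀ x, ENNReal.ofReal |s.indicator (fun _ => c) x
        - (c • O.indicator (1 : X → ℝ)) x| ≤ (symmDiff s O).indicator
          (fun _ => ENNReal.ofReal |c|) x := by
      intro x
      by_cases h1 : x ∈ s <;> by_cases h2 : x ∈ O <;> simp [h1, h2, Set.mem_symmDiff]
    calc _ ≤ ∫⁻ x, (symmDiff s O).indicator (fun _ => ENNReal.ofReal |c|) x ∂μ :=
          lintegral_mono hle
      _ ≤ ENNReal.ofReal |c| * μ (symmDiff s O) := lintegral_indicator_const_le _ _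
      _ ≤ ENNReal.ofReal |c| * ENNReal.ofReal (ε / (|c| + 1)) := by gcongr
      _ < ENNReal.ofReal ε := by
          rw [← ENNReal.ofReal_mul (abs_nonneg _), ENNReal.ofReal_lt_ofReal_iff hε]
          have h1 : 0 < |c| + 1 := by positivity
          rw [← mul_div_assoc, div_lt_iff₀ h1]
          nlinarith [abs_nonneg c]
  · intro f g hf hg _ h1 h2
    refine map_mem_closure₂ continuous_add h1 h2 ?_
    intro a ha b hb
    obtain ⟨c, hc⟩ := Set.mem_iUnion.1 ha
    obtain ⟨d, hd⟩ := Set.mem_iUnion.1 hb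
    exact Set.mem_iUnion.2 ⟨c + d, bvSet_add hc hd⟩
  · exact isClosed_closure

/-- A level set need not have end points, but a compact subset has a least point `a` and a greatest
point `b`. Without atoms its mass is at most the increment of the distribution function from `a` to
`b`; inner regularity does the rest. -/
theorem measure_levelSet_cdf_le [IsProbabilityMeasure μ] [μ.Regular] (h0 : ∀ x, μ {x} = 0) {ε : ℝ}
    (k : ℕ) : μ (levelSet (fun x => μ.real (Set.Iic x)) ε k) ≤ ENNReal.ofReal ε := by
  have hm : Monotone fun x => μ.real (Set.Iic x) := fun x y h =>
    measureReal_mono (Set.Iic_subset_Iic.2 h)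
  have hmeas := (levelSet_ordConnected hm ε k).measurableSet
  refine le_of_forall_lt fun r hr => ?_
  obtain ⟨K, hKs, hK, hrK⟩ := hmeas.exists_lt_isCompact_of_ne_top (measure_ne_top _ _) hr
  refine hrK.trans_le ?_
  rcases K.eq_empty_or_nonempty with rfl | hne
  · simp
  obtain ⟨a, ha, ha'⟩ := hK.exists_isLeast hne
  obtain ⟨b, hb, hb'⟩ := hK.exists_isGreatest hne
  have hsub : K ⊆ {a} ∪ (Set.Iic b \ Set.Iic a) := by
    intro x hx
    rcases (ha' hx).eq_or_lt with h | h
    · exact Or.inl h.symm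
    · exact Or.inr ⟨hb' hx, not_le.2 h⟩
  have hab : a ≤ b := ha' hb
  calc μ K ≤ μ {a} + μ (Set.Iic b \ Set.Iic a) := (measure_mono hsub).trans (measure_union_le _ _)
    _ = μ (Set.Iic b) - μ (Set.Iic a) := by
        rw [h0, zero_add, measure_sdiff (Set.Iic_subset_Iic.2 hab)
          measurableSet_Iic.nullMeasurableSet (measure_ne_top _ _)]
    _ = ENNReal.ofReal (μ.real (Set.Iic b) - μ.real (Set.Iic a)) := by
        rw [ENNReal.ofReal_sub _ measureReal_nonneg, ofReal_measureReal, ofReal_measureReal]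
    _ ≤ ENNReal.ofReal ε := ENNReal.ofReal_le_ofReal (by linarith [(hKs ha).1, (hKs hb).2])

/-- Replacing `u` on each interval of mass at most `ε` by one of its values costs at most `ε` times
the total variation. The resulting step functions lie in the image of a cube under a continuous map,
which is compact. -/
theorem totallyBounded_bvSet [IsProbabilityMeasure μ] [μ.Regular] (h0 : ∀ x, μ {x} = 0)
    (c : ℝ≥0) : TotallyBounded (bvSet μ c) := by
  classical
  refine totallyBounded_of_approx fun δ hδ => ?_
  set ε : ℝ := δ / (c + 1)
  have hε : 0 < ε := by positivity
  set m : X → ℝ := fun x => μ.real (Set.Iic x)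
  have hm : Monotone m := fun x y h => measureReal_mono (Set.Iic_subset_Iic.2 h)
  obtain ⟨K, hK⟩ := exists_nat_gt (1 / ε)
  have hK' : ∀ x, m x < K * ε := fun x => measureReal_le_one.trans_lt ((div_lt_iff₀ hε).1 hK)
  have hm0 : ∀ x, 0 ≤ m x := fun x => measureReal_nonneg
  set J := levelSet m ε
  have hJ : ∀ k, (J k).OrdConnected := levelSet_ordConnected hm _
  have hJm : ∀ k, MeasurableSet (J k) := fun k => (hJ k).measurableSet
  let Φ : (ℕ → ℝ) → Lp ℝ 1 μ := fun a =>
    ∑ k ∈ Finset.range K, a k • indicatorConstLp 1 (hJm k) (measure_ne_top μ _) (1 : ℝ)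
  have hΦ : Continuous Φ := continuous_finsetSum _ fun k _ =>
    (continuous_apply k).smul continuous_const
  refine ⟨Φ '' (Set.pi Set.univ fun _ => Set.Icc (-c : ℝ) c),
    ((isCompact_univ_pi fun _ => isCompact_Icc).image hΦ).totallyBounded, ?_⟩
  rintro f ⟨u, hu, hfu⟩
  have huc : ∀ x, |u x| ≤ c := fun x => by
    have := (ofReal_abs_le_zVar u x).trans hu
    exact (ENNReal.ofReal_le_coe).1 this
  let a : ℕ → ℝ := fun k => if h : (J k).Nonempty then u h.some else 0
  refine ⟨Φ a, ⟨a, fun k _ => ?_, rfl⟩, ?_⟩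
  · simp only [a]
    split_ifs with h
    · exact abs_le.1 (huc _)
    · exact ⟨by simp, by simp⟩
  have hΦa : Φ a =ᵐ[μ] fun x => ∑ k ∈ Finset.range K, (J k).indicator (fun _ => a k) x := by
    have h1 : ∀ k ∈ Finset.range K, (a k • indicatorConstLp 1 (hJm k) (measure_ne_top μ _) (1 : ℝ) :
        Lp ℝ 1 μ) =ᵐ[μ] (J k).indicator (fun _ => a k) := by
      intro k _
      filter_upwards [Lp.coeFn_smul (a k) (indicatorConstLp 1 (hJm k) (measure_ne_top μ _) (1 : ℝ)),
        indicatorConstLp_coeFn (p := 1) (hs := hJm k) (hμs := measure_ne_top μ _) (c := (1 : ℝ))]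
        with x h1 h2
      rw [h1, Pi.smul_apply, h2]
      by_cases hx : x ∈ J k <;> simp [hx]
    have h2 := Lp.coeFn_finsetSum (Finset.range K) fun k =>
      (a k • indicatorConstLp 1 (hJm k) (measure_ne_top μ _) (1 : ℝ) : Lp ℝ 1 μ)
    have h3 : ∀ᵐ x ∂μ, ∀ k ∈ Finset.range K,
        (a k • indicatorConstLp 1 (hJm k) (measure_ne_top μ _) (1 : ℝ) : Lp ℝ 1 μ) x
          = (J k).indicator (fun _ => a k) x :=
      (ae_ball_iff (Finset.countable_toSet _)).2 h1
    filter_upwards [h2, h3] with x h2 h3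
    rw [h2, Finset.sum_apply]
    exact Finset.sum_congr rfl h3
  rw [dist_eq_norm, ← ENNReal.ofReal_le_ofReal_iff hδ.le, ofReal_norm_sub_eq_lintegral hfu hΦa]
  have hpt : ∀ x, ENNReal.ofReal |u x - ∑ k ∈ Finset.range K, (J k).indicator (fun _ => a k) x|
      ≤ ∑ k ∈ Finset.range K, (J k).indicator (fun _ => eVariationOn u (J k)) x := by
    intro x
    obtain ⟨k, hk, hx⟩ := exists_mem_levelSet hε (hm0 x) (hK' x)
    have h1 : ∑ j ∈ Finset.range K, (J j).indicator (fun _ => a j) x = a k := by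
      rw [Finset.sum_eq_single k, Set.indicator_of_mem hx]
      · exact fun j _ hj => Set.indicator_of_notMem (fun h => hj (levelSet_eq_of_mem hε h hx)) _
      · exact fun h => (h hk).elim
    have hne : (J k).Nonempty := ⟨x, hx⟩
    have h2 : a k = u hne.some := dif_pos hne
    have h3 := Finset.single_le_sum (f := fun k => (J k).indicator
      (fun _ => eVariationOn u (J k)) x) (fun _ _ => zero_le) hk
    rw [Set.indicator_of_mem hx] at h3
    refine le_trans ?_ h3
    rw [h1, h2, ← ENNReal.edist_eq_abs]
    exact eVariationOn.edist_le u hx hne.some_mem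
  calc _ ≤ ∫⁻ x, ∑ k ∈ Finset.range K, (J k).indicator (fun _ => eVariationOn u (J k)) x ∂μ :=
        lintegral_mono hpt
    _ = ∑ k ∈ Finset.range K, eVariationOn u (J k) * μ (J k) := by
        rw [lintegral_finsetSum _ fun k _ => measurable_const.indicator (hJm k)]
        exact Finset.sum_congr rfl fun k _ => lintegral_indicator_const (hJm k) _
    _ ≤ ∑ k ∈ Finset.range K, eVariationOn u (J k) * ENNReal.ofReal ε := by
        gcongr with k hk
        exact measure_levelSet_cdf_le h0 k
    _ = (∑ k ∈ Finset.range K, eVariationOn u (J k)) * ENNReal.ofReal ε := by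
        rw [Finset.sum_mul]
    _ ≤ c * ENNReal.ofReal ε := by
        gcongr
        exact (sum_eVariationOn_levelSet_le hε hm u K).trans ((eVariationOn_le_zVar u _).trans hu)
    _ ≤ ENNReal.ofReal δ := by
        rw [← ENNReal.ofReal_coe_nnreal, ← ENNReal.ofReal_mul (by positivity)]
        refine ENNReal.ofReal_le_ofReal ?_
        have h1 : (0 : ℝ) < c + 1 := by positivity
        simp only [ε]
        rw [← mul_div_assoc, div_le_iff₀ h1]
        nlinarith [c.2]

end BVSet

section

variable {X ι : Type*} [LinearOrder X] [TopologicalSpace X] [OrderTopology X] [MeasurableSpace X]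
  [BorelSpace X] {T : X → X} {μ : Measure X} [IsProbabilityMeasure μ] {V : Set X}
  {I : ι → Set X} {g : X → ℝ} {c : ℝ}

/-- Taking closures supplies closed sets without any semicontinuity of the variation; in return each
estimate must survive limits in `L¹`. -/
theorem IsWeightedBranchSystem.isLasotaYorke [μ.Regular]
    (hI : IsWeightedBranchSystem T μ V I g c) (hT : Measure.QuasiMeasurePreserving T μ μ) :
    IsLasotaYorke (transferL hT) fun c => closure (bvSet μ c) where
  isClosed _ := isClosed_closure
  mono h := closure_mono (bvSet_mono h)
  add_mem hf hg := map_mem_closure₂ continuous_add hf hg fun _ ha _ hb => bvSet_add ha hb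
  smul_mem t hf := map_mem_closure (continuous_const_smul t) hf fun _ ha => bvSet_smul t ha
  norm_le {c f} hf := closure_minimal (t := {f | ‖f‖ ≤ c}) (fun f hf => norm_le_of_mem_bvSet hf)
    (isClosed_le continuous_norm continuous_const) hf
  totallyBounded c := (totallyBounded_bvSet (hI.measure_singleton hT) c).closure
  dense f ε hε := by
    obtain ⟨b, hb, hfb⟩ := Metric.mem_closure_iff.1 (mem_closure_iUnion_bvSet f) ε hε
    obtain ⟨c, hc⟩ := Set.mem_iUnion.1 hb
    exact ⟨c, b, subset_closure hc, by rwa [← dist_eq_norm]⟩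
  step := by
    have : Nonempty X := nonempty_of_isProbabilityMeasure μ
    refine ⟨(2 * zVar g).toNNReal, fun c f hf =>
      map_mem_closure (transferL hT).continuous hf fun f hf => ?_⟩
    obtain ⟨u, hu, hfu⟩ := hf
    obtain ⟨v, hv, hvle⟩ := hI.exists_zVar_transferOp_le (hu.trans_lt ENNReal.coe_lt_top)
    refine ⟨v, hvle.trans ?_, (coeFn_transferL hT f).trans (by rwa [transferOp_congr T hfu])⟩
    rw [ENNReal.coe_mul, ENNReal.coe_toNNReal (ENNReal.mul_lt_top (by simp) hI.zVar_lt_top).ne]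
    gcongr
  contract := by
    obtain ⟨N, K, hN, hNK⟩ := hI.exists_lasotaYorke
    -- The factor 2 gives room for limits: near a nonzero `f` the approximants can be chosen with
    -- norm below `2 * ‖f‖`.
    refine ⟨N, K * 2, hN, fun c f hf => ?_⟩
    rcases eq_or_ne f 0 with rfl | hf0
    · refine subset_closure ⟨0, by simp [zVar_zero], ?_⟩
      rw [map_zero]
      exact Lp.coeFn_zero ℝ 1 μ
    have hpos : ‖f‖ < 2 * ‖f‖ := by linarith [norm_pos_iff.2 hf0]
    have hf' : f ∈ closure ({h | ‖h‖ < 2 * ‖f‖} ∩ bvSet μ c) :=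
      (isOpen_lt continuous_norm continuous_const).inter_closure ⟨hpos, hf⟩
    refine map_mem_closure (transferL hT ^ N).continuous hf' ?_
    rintro h ⟨hh, u, hu, hhu⟩
    obtain ⟨v, hv, hvle⟩ := hNK u (hu.trans_lt ENNReal.coe_lt_top)
    refine ⟨v, hvle.trans ?_, (coeFn_transferL_pow_of_ae_eq hT N hhu).trans hv⟩
    rw [← ofReal_norm_eq_lintegral hhu]
    have h2 : ENNReal.ofReal ‖h‖ ≤ 2 * ‖f‖₊ := by
      refine (ENNReal.ofReal_le_ofReal (le_of_lt hh)).trans (le_of_eq ?_)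
      rw [ENNReal.ofReal_mul (by norm_num)]
      simp [← enorm_eq_nnnorm]
    calc zVar u / 2 + K * ENNReal.ofReal ‖h‖ ≤ c / 2 + K * (2 * ‖f‖₊) := by gcongr
      _ = _ := by
        rw [← mul_assoc]
        norm_cast

/-- Multiplication by `h` is bounded on `L¹` and preserves bounded variation, so it acts on the
closures too. -/
theorem mem_closure_bvSet_of_mul {h : X → ℝ} (hh : zVar h < ⊤) {c : ℝ≥0} {f q : Lp ℝ 1 μ}
    (hf : f ∈ closure (bvSet μ c)) (hq : q =ᵐ[μ] fun x => h x * f x) :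
    q ∈ closure (bvSet μ ((2 * zVar h).toNNReal * c)) := by
  rw [Metric.mem_closure_iff] at hf ⊢
  intro ε hε
  set M := (zVar h).toReal
  have hM : 0 ≤ M := ENNReal.toReal_nonneg
  obtain ⟨f', ⟨u, hu, hfu⟩, hdist⟩ := hf (ε / (M + 1)) (by positivity)
  have hu' : zVar u < ⊤ := hu.trans_lt ENNReal.coe_lt_top
  have hint := integrable_of_zVar_lt_top (zVar_mul_lt_top hh hu') μ
  refine ⟨hint.toL1 _, ⟨h * u, ?_, hint.coeFn_toL1⟩, ?_⟩
  · rw [ENNReal.coe_mul, ENNReal.coe_toNNReal (ENNReal.mul_lt_top (by simp) hh).ne]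
    refine (zVar_mul_le (fun x => ofReal_abs_le_zVar h x)
      fun x => ofReal_abs_le_zVar u x).trans ?_
    calc zVar h * zVar u + zVar u * zVar h = 2 * zVar h * zVar u := by ring
      _ ≤ _ := by gcongr
  · rw [dist_eq_norm] at hdist ⊢
    have hle : ENNReal.ofReal ‖q - hint.toL1 _‖ ≤ ENNReal.ofReal (M * ‖f - f'‖) := by
      rw [ofReal_norm_sub_eq_lintegral hq hint.coeFn_toL1, ENNReal.ofReal_mul hM,
        ofReal_norm_sub_eq_lintegral (EventuallyEq.refl _ _) hfu,
        ← lintegral_const_mul' _ _ ENNReal.ofReal_ne_top]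
      refine lintegral_mono fun x => ?_
      rw [Pi.mul_apply, ← mul_sub, abs_mul, ENNReal.ofReal_mul (abs_nonneg _)]
      gcongr
      exact abs_le_of_zVar_lt_top hh x
    rw [ENNReal.ofReal_le_ofReal_iff (by positivity)] at hle
    rw [lt_div_iff₀ (by positivity)] at hdist
    nlinarith [norm_nonneg (f - f')]

end

-- Contractions with a Lasota–Yorke inequality: recurrent and vanishing parts.

section Contraction

variable {B : Type*} [NormedAddCommGroup B] [NormedSpace ℝ B] {P : B →L[ℝ] B}

theorem norm_pow_apply_le (hP : ∀ f, ‖P f‖ ≤ ‖f‖) (n : ℕ) (f : B) : ‖(P ^ n) f‖ ≤ ‖f‖ := by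
  induction n with
  | zero => simp
  | succ n ih =>
    rw [pow_succ']
    exact (hP _).trans ih

theorem pow_add_apply (P : B →L[ℝ] B) (m n : ℕ) (f : B) : (P ^ (m + n)) f = (P ^ m) ((P ^ n) f) := by
  rw [pow_add]; rfl

theorem antitone_norm_pow_apply (hP : ∀ f, ‖P f‖ ≤ ‖f‖) (f : B) :
    Antitone fun n => ‖(P ^ n) f‖ := by
  intro m n h
  obtain ⟨k, rfl⟩ := Nat.exists_eq_add_of_le' h
  simp only [pow_add_apply]
  exact norm_pow_apply_le hP k _

variable {D : ℝ≥0 → Set B}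

/-- Iterating the contraction step sums a geometric series, whence `2 * K`, as norms do not grow
along orbits. The `n % N` leftover steps cost at most `(1 + K₁) ^ N`. -/
theorem IsLasotaYorke.exists_orbit_bound (hD : IsLasotaYorke P D) (hP : ∀ f, ‖P f‖ ≤ ‖f‖) :
    ∃ (N : ℕ) (L K : ℝ≥0), 0 < N ∧ ∀ c, ∀ f ∈ D c, ∀ n,
      (P ^ n) f ∈ D (L * c / 2 ^ (n / N) + K * ‖f‖₊) := by
  obtain ⟨K₁, hK₁⟩ := hD.step
  obtain ⟨N, K, hN, hNK⟩ := hD.contract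
  have h1 : ∀ c, ∀ f ∈ D c, ∀ k, (P ^ (N * k)) f ∈ D (c / 2 ^ k + 2 * K * ‖f‖₊) := by
    intro c f hf k
    induction k with
    | zero => exact hD.mono (c := c) (by simp) (by simpa using hf)
    | succ k ih =>
      rw [Nat.mul_succ, add_comm (N * k) N, pow_add_apply]
      refine hD.mono ?_ (hNK _ _ ih)
      have h2 : ‖(P ^ (N * k)) f‖₊ ≤ ‖f‖₊ := norm_pow_apply_le hP _ f
      calc (c / 2 ^ k + 2 * K * ‖f‖₊) / 2 + K * ‖(P ^ (N * k)) f‖₊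
          ≤ (c / 2 ^ k + 2 * K * ‖f‖₊) / 2 + K * ‖f‖₊ := by gcongr
        _ = c / 2 ^ (k + 1) + 2 * K * ‖f‖₊ := by
          rw [pow_succ]
          field_simp
          ring
  have h2 : ∀ c, ∀ f ∈ D c, ∀ j, (P ^ j) f ∈ D (K₁ ^ j * c) := by
    intro c f hf j
    induction j with
    | zero => simpa using hf
    | succ j ih =>
      rw [pow_succ', pow_succ', mul_assoc]
      exact hK₁ _ _ ih
  refine ⟨N, (1 + K₁) ^ N, 2 * K, hN, fun c f hf n => ?_⟩
  have h3 := h1 _ _ (h2 c f hf (n % N)) (n / N)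
  rw [← pow_add_apply, Nat.div_add_mod] at h3
  refine hD.mono ?_ h3
  have h4 : ‖(P ^ (n % N)) f‖₊ ≤ ‖f‖₊ := norm_pow_apply_le hP _ f
  have h5 : K₁ ^ (n % N) ≤ (1 + K₁) ^ N :=
    (pow_le_pow_left₀ (zero_le) le_add_self _).trans
      (pow_le_pow_right₀ le_self_add (Nat.mod_lt _ hN).le)
  gcongr

/-- An approximant in some `D c` has its entire orbit in one set of the scale, and the contraction
keeps the two orbits close for all time. -/
theorem IsLasotaYorke.totallyBounded_orbit (hD : IsLasotaYorke P D) (hP : ∀ f, ‖P f‖ ≤ ‖f‖)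
    (f : B) : TotallyBounded (Set.range fun n => (P ^ n) f) := by
  obtain ⟨N, L, K, -, hb⟩ := hD.exists_orbit_bound hP
  refine totallyBounded_of_approx fun ε hε => ?_
  obtain ⟨c, g, hg, hfg⟩ := hD.dense f ε hε
  refine ⟨D (L * c + K * ‖g‖₊), hD.totallyBounded _, ?_⟩
  rintro _ ⟨n, rfl⟩
  refine ⟨(P ^ n) g, hD.mono ?_ (hb c g hg n), ?_⟩
  · gcongr
    exact div_le_self zero_le (one_le_pow₀ one_le_two)
  · rw [dist_eq_norm, ← map_sub]
    exact (norm_pow_apply_le hP n _).trans hfg.le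

/-- The recurrent vectors of a contraction. -/
def recurrentSet (P : B →L[ℝ] B) : Set B :=
  {f | ∀ ε > 0, ∀ n₀, ∃ n ≥ n₀, ‖(P ^ n) f - f‖ < ε}

/-- Norms decrease along an orbit, yet the orbit comes back near its start arbitrarily late. -/
theorem norm_pow_apply_of_recurrent (hP : ∀ f, ‖P f‖ ≤ ‖f‖) {f : B} (hf : f ∈ recurrentSet P)
    (m : ℕ) : ‖(P ^ m) f‖ = ‖f‖ := by
  refine le_antisymm (norm_pow_apply_le hP m f) (le_of_forall_pos_le_add fun ε hε => ?_)
  obtain ⟨n, hn, h⟩ := hf ε hε m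
  have h1 := antitone_norm_pow_apply hP f hn
  have h2 := norm_sub_norm_le f ((P ^ n) f)
  rw [norm_sub_rev] at h2
  simp only at h1
  linarith

theorem pow_apply_comm (P : B →L[ℝ] B) (m n : ℕ) (f : B) :
    (P ^ m) ((P ^ n) f) = (P ^ n) ((P ^ m) f) := by
  rw [← pow_add_apply, ← pow_add_apply, add_comm]

theorem pow_apply_sub_mem_recurrentSet (hP : ∀ f, ‖P f‖ ≤ ‖f‖) {f : B} (hf : f ∈ recurrentSet P)
    (d : ℕ) : (P ^ d) f - f ∈ recurrentSet P := by
  intro ε hε n₀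
  obtain ⟨n, hn, h⟩ := hf (ε / 2) (half_pos hε) n₀
  refine ⟨n, hn, ?_⟩
  have e : (P ^ n) ((P ^ d) f - f) - ((P ^ d) f - f)
      = (P ^ d) ((P ^ n) f - f) - ((P ^ n) f - f) := by
    rw [map_sub, map_sub, pow_apply_comm]
    abel
  rw [e]
  have := norm_pow_apply_le hP d ((P ^ n) f - f)
  have := norm_sub_le ((P ^ d) ((P ^ n) f - f)) ((P ^ n) f - f)
  linarith

theorem exists_gap_of_tendsto {f a : B} {φ : ℕ → ℕ}
    (ha : Tendsto (fun i => (P ^ φ i) f) atTop (𝓝 a)) {ε : ℝ} (hε : 0 < ε) :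
    ∃ i₀, ∀ i ≥ i₀, ‖(P ^ φ i) f - a‖ < ε := by
  have := Metric.tendsto_atTop.1 ha ε hε
  simpa only [dist_eq_norm] using this

theorem isClosed_recurrentSet (hP : ∀ f, ‖P f‖ ≤ ‖f‖) : IsClosed (recurrentSet P) := by
  refine isClosed_of_closure_subset fun f hf ε hε n₀ => ?_
  obtain ⟨g, hg, hfg⟩ := Metric.mem_closure_iff.1 hf (ε / 3) (by positivity)
  obtain ⟨n, hn, h⟩ := hg (ε / 3) (by positivity) n₀
  refine ⟨n, hn, ?_⟩
  rw [dist_eq_norm] at hfg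
  have h1 := (norm_pow_apply_le hP n (f - g))
  have e : (P ^ n) f - f = (P ^ n) (f - g) + ((P ^ n) g - g) - (f - g) := by
    rw [map_sub]; abel
  rw [e]
  have h2 := norm_sub_le ((P ^ n) (f - g) + ((P ^ n) g - g)) (f - g)
  have h3 := norm_add_le ((P ^ n) (f - g)) ((P ^ n) g - g)
  linarith

theorem map_mem_recurrentSet (hP : ∀ f, ‖P f‖ ≤ ‖f‖) {f : B} (hf : f ∈ recurrentSet P) :
    P f ∈ recurrentSet P := by
  intro ε hε n₀
  obtain ⟨n, hn, h⟩ := hf ε hε n₀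
  refine ⟨n, hn, ?_⟩
  have e : (P ^ n) (P f) = P ((P ^ n) f) := by
    have := pow_apply_comm P n 1 f
    simpa using this
  rw [e, ← map_sub]
  exact (hP _).trans_lt h

/-- Approximate `f` by some `g` in the scale and wait for a late return of `f`. By then the
transient term of `g` is at most 1, so `P ^ n g` is close to `f` and lies in a set independent of
`f`. -/
theorem IsLasotaYorke.exists_recurrent_ball_subset (hD : IsLasotaYorke P D)
    (hP : ∀ f, ‖P f‖ ≤ ‖f‖) : ∃ c, ∀ f ∈ recurrentSet P, ‖f‖ ≤ 1 → f ∈ D c := by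
  obtain ⟨N, L, K, hN, hb⟩ := hD.exists_orbit_bound hP
  refine ⟨1 + K * 2, fun f hf hf1 => ?_⟩
  rw [← (hD.isClosed (1 + K * 2)).closure_eq, Metric.mem_closure_iff]
  intro ε hε
  set δ := min (ε / 2) 1
  have hδ : 0 < δ := lt_min (half_pos hε) one_pos
  obtain ⟨c, g, hg, hfg⟩ := hD.dense f δ hδ
  obtain ⟨k, hk⟩ := pow_unbounded_of_one_lt (L * c) (one_lt_two : (1 : ℝ≥0) < 2)
  obtain ⟨n, hn, hnf⟩ := hf (ε / 2) (half_pos hε) (N * k)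
  refine ⟨(P ^ n) g, hD.mono ?_ (hb c g hg n), ?_⟩
  · have h1 : k ≤ n / N := (Nat.le_div_iff_mul_le hN).2 (by rw [mul_comm]; exact hn)
    have h2 : L * c / 2 ^ (n / N) ≤ 1 := by
      refine div_le_one_of_le₀ ?_ (zero_le)
      exact hk.le.trans (pow_le_pow_right₀ one_le_two h1)
    have h3 : ‖g‖₊ ≤ 2 := by
      rw [← NNReal.coe_le_coe, coe_nnnorm]
      have := norm_sub_norm_le g f
      rw [norm_sub_rev] at this
      have := min_le_right (ε / 2) 1
      simp only [NNReal.coe_ofNat]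
      linarith
    gcongr
  · rw [dist_eq_norm]
    have h1 := norm_pow_apply_le hP n (f - g)
    have e : f - (P ^ n) g = (P ^ n) (f - g) - ((P ^ n) f - f) := by
      rw [map_sub]; abel
    rw [e]
    have h2 := norm_sub_le ((P ^ n) (f - g)) ((P ^ n) f - f)
    have h3 := min_le_left (ε / 2) 1
    linarith

theorem eq_zero_of_recurrent_of_tendsto (hP : ∀ f, ‖P f‖ ≤ ‖f‖) {f : B} (hf : f ∈ recurrentSet P)
    (h : Tendsto (fun n => (P ^ n) f) atTop (𝓝 0)) : f = 0 := by
  have h1 := h.norm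
  simp only [norm_pow_apply_of_recurrent hP hf, norm_zero] at h1
  exact norm_eq_zero.1 (tendsto_nhds_unique tendsto_const_nhds h1)

/-- Uniform exponential decay of the vectors with vanishing orbit. -/
theorem IsLasotaYorke.exists_half (hD : IsLasotaYorke P D) (hP : ∀ f, ‖P f‖ ≤ ‖f‖) :
    ∃ n₀, 0 < n₀ ∧ ∀ c, ∀ f ∈ D c, Tendsto (fun n => (P ^ n) f) atTop (𝓝 0) →
      (P ^ n₀) f ∈ D (c / 2) := by
  obtain ⟨N, L, K, hN, hb⟩ := hD.exists_orbit_bound hP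
  -- A finite net of the totally bounded set of vanishing vectors in `D 1` makes the time `m`
  -- uniform.
  obtain ⟨m, hm⟩ : ∃ m, ∀ f ∈ D 1, Tendsto (fun n => (P ^ n) f) atTop (𝓝 0) →
      ‖(P ^ m) f‖ ≤ 1 / (4 * (K + 1)) := by
    set δ : ℝ := 1 / (4 * (K + 1))
    have hδ : 0 < δ := by positivity
    have htb : TotallyBounded (D 1 ∩ {f | Tendsto (fun n => (P ^ n) f) atTop (𝓝 0)}) :=
      (hD.totallyBounded 1).subset Set.inter_subset_left
    obtain ⟨t, hts, htf, hcov⟩ := Metric.finite_approx_of_totallyBounded htb (δ / 2) (half_pos hδ)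
    have hev : ∀ᶠ n in atTop, ∀ g ∈ t, ‖(P ^ n) g‖ < δ / 2 := by
      rw [eventually_all_finite htf]
      intro g hg
      exact (tendsto_zero_iff_norm_tendsto_zero.1 (hts hg).2).eventually (gt_mem_nhds (half_pos hδ))
    obtain ⟨m, hm⟩ := hev.exists
    refine ⟨m, fun f hf hlim => ?_⟩
    obtain ⟨g, hg, hfg⟩ := Set.mem_iUnion₂.1 (hcov ⟨hf, hlim⟩)
    rw [Metric.mem_ball, dist_eq_norm] at hfg
    have h1 := hm g hg
    have h2 := norm_pow_apply_le hP m (f - g)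
    have e : (P ^ m) f = (P ^ m) (f - g) + (P ^ m) g := by rw [map_sub]; abel
    rw [e]
    linarith [norm_add_le ((P ^ m) (f - g)) ((P ^ m) g)]
  -- After `m` steps the vector is in `D (L + K)`. The choice of `k` makes the transient term at
  -- most 1/4, and the choice of `m` does the same for the norm term.
  obtain ⟨k, hk⟩ := pow_unbounded_of_one_lt (4 * (L * (L + K))) (one_lt_two : (1 : ℝ≥0) < 2)
  have hone : ∀ f ∈ D 1, Tendsto (fun n => (P ^ n) f) atTop (𝓝 0) →
      (P ^ (N * (k + 1) + m)) f ∈ D (1 / 2) := by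
    intro f hf hlim
    have hf1 : ‖f‖₊ ≤ 1 := hD.norm_le hf
    have h1 : (P ^ m) f ∈ D (L + K) := by
      refine hD.mono ?_ (hb 1 f hf m)
      calc L * 1 / 2 ^ (m / N) + K * ‖f‖₊ ≤ L * 1 + K * 1 := by
            gcongr
            exact div_le_self zero_le (one_le_pow₀ one_le_two)
        _ = L + K := by simp
    rw [pow_add_apply]
    refine hD.mono ?_ (hb _ _ h1 (N * (k + 1)))
    rw [Nat.mul_div_cancel_left _ hN]
    have h2 : L * (L + K) / 2 ^ (k + 1) ≤ 1 / 4 := by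
      rw [div_le_div_iff₀ (by positivity) (by norm_num), one_mul, mul_comm]
      exact hk.le.trans (pow_le_pow_right₀ one_le_two (Nat.le_succ k))
    have h3 : K * ‖(P ^ m) f‖₊ ≤ 1 / 4 := by
      rw [← NNReal.coe_le_coe]
      rw [NNReal.coe_mul, coe_nnnorm]
      have h4 := hm f hf hlim
      have hK : (0 : ℝ) ≤ K := K.2
      calc (K : ℝ) * ‖(P ^ m) f‖ ≤ K * (1 / (4 * (K + 1))) := by gcongr
        _ ≤ ((1 / 4 : ℝ≥0) : ℝ) := by
          push_cast
          rw [mul_one_div, div_le_div_iff₀ (by positivity) (by norm_num)]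
          linarith
    calc _ ≤ (1 / 4 + 1 / 4 : ℝ≥0) := add_le_add h2 h3
      _ = 1 / 2 := by
        rw [← NNReal.coe_inj]
        push_cast
        norm_num
  refine ⟨N * (k + 1) + m, by positivity, fun c f hf hlim => ?_⟩
  rcases eq_or_ne c 0 with rfl | hc
  · have hf0 : f = 0 := norm_le_zero_iff.1 (by simpa using hD.norm_le hf)
    simpa [hf0] using hf
  · have hcr : (c : ℝ) ≠ 0 := by exact_mod_cast hc
    have h1 : (c : ℝ)⁻¹ • f ∈ D 1 := by
      have := hD.smul_mem (c : ℝ)⁻¹ hf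
      rwa [nnnorm_inv, NNReal.nnnorm_eq, inv_mul_cancel₀ hc] at this
    have h2 := hone _ h1 (by simpa using hlim.const_smul (c : ℝ)⁻¹)
    have h3 := hD.smul_mem (c : ℝ) h2
    rwa [← map_smul, smul_inv_smul₀ hcr, NNReal.nnnorm_eq, mul_one_div] at h3

variable [CompleteSpace B]

theorem IsLasotaYorke.exists_subseq (hD : IsLasotaYorke P D) (hP : ∀ f, ‖P f‖ ≤ ‖f‖) (f : B)
    {φ : ℕ → ℕ} :
    ∃ a, ∃ ψ : ℕ → ℕ, StrictMono ψ ∧ Tendsto (fun i => (P ^ φ (ψ i)) f) atTop (𝓝 a) := by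
  have hc : IsCompact (closure (Set.range fun n => (P ^ n) f)) :=
    (hD.totallyBounded_orbit hP f).closure.isCompact_of_isClosed isClosed_closure
  obtain ⟨a, -, ψ, hψ, h⟩ := hc.tendsto_subseq (x := fun i => (P ^ φ i) f)
    fun i => subset_closure ⟨φ i, rfl⟩
  exact ⟨a, ψ, hψ, h⟩

/-- Two recurrent vectors return simultaneously. -/
theorem IsLasotaYorke.exists_common_return (hD : IsLasotaYorke P D) (hP : ∀ f, ‖P f‖ ≤ ‖f‖)
    {f g : B} (hf : f ∈ recurrentSet P) (hg : g ∈ recurrentSet P) {ε : ℝ} (hε : 0 < ε) (n₀ : ℕ) :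
    ∃ n ≥ n₀, ‖(P ^ n) f - f‖ < ε ∧ ‖(P ^ n) g - g‖ < ε := by
  obtain ⟨a, φ, hφ, ha⟩ := hD.exists_subseq hP f (φ := id)
  obtain ⟨b, ψ, hψ, hb⟩ := hD.exists_subseq hP g (φ := φ)
  have ha' : Tendsto (fun i => (P ^ φ (ψ i)) f) atTop (𝓝 a) := ha.comp hψ.tendsto_atTop
  obtain ⟨i₁, h₁⟩ := exists_gap_of_tendsto ha' (half_pos hε)
  obtain ⟨i₂, h₂⟩ := exists_gap_of_tendsto hb (half_pos hε)
  have hmono : StrictMono (φ ∘ ψ) := hφ.comp hψ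
  set i := max i₁ i₂
  set j := φ (ψ i) + n₀ + i
  have hj : φ (ψ i) + n₀ ≤ φ (ψ j) := le_trans (by simp only [id]; omega) (hmono.id_le j)
  obtain ⟨d, hd⟩ := Nat.exists_eq_add_of_le hj
  have hij : i ≤ j := by omega
  -- The difference of two late times of the common subsequence is a return time, because powers of
  -- `P` preserve the norm of `P ^ d h - h` when `h` is recurrent.
  have key : ∀ h c : B, h ∈ recurrentSet P → ‖(P ^ φ (ψ i)) h - c‖ < ε / 2 →
      ‖(P ^ φ (ψ j)) h - c‖ < ε / 2 → ‖(P ^ (n₀ + d)) h - h‖ < ε := by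
    intro h c hh h1 h2
    rw [← norm_pow_apply_of_recurrent hP (pow_apply_sub_mem_recurrentSet hP hh _) (φ (ψ i)),
      map_sub, ← pow_add_apply, ← add_assoc, ← hd]
    have := norm_sub_le ((P ^ φ (ψ j)) h - c) ((P ^ φ (ψ i)) h - c)
    rw [sub_sub_sub_cancel_right] at this
    linarith
  exact ⟨n₀ + d, Nat.le_add_right _ _,
    key f a hf (h₁ i (le_max_left _ _)) (h₁ j ((le_max_left _ _).trans hij)),
    key g b hg (h₂ i (le_max_right _ _)) (h₂ j ((le_max_right _ _).trans hij))⟩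

/-- The subspace of recurrent vectors. -/
def IsLasotaYorke.recurrent (hD : IsLasotaYorke P D) (hP : ∀ f, ‖P f‖ ≤ ‖f‖) : Submodule ℝ B where
  carrier := recurrentSet P
  zero_mem' := fun ε hε n₀ => ⟨n₀, le_rfl, by simpa using hε⟩
  add_mem' := fun {f g} hf hg ε hε n₀ => by
    obtain ⟨n, hn, h1, h2⟩ := hD.exists_common_return hP hf hg (half_pos hε) n₀
    refine ⟨n, hn, ?_⟩
    rw [map_add, add_sub_add_comm]
    linarith [norm_add_le ((P ^ n) f - f) ((P ^ n) g - g)]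
  smul_mem' := fun t f hf ε hε n₀ => by
    obtain ⟨n, hn, h⟩ := hf (ε / (‖t‖ + 1)) (by positivity) n₀
    refine ⟨n, hn, ?_⟩
    rw [map_smul, ← smul_sub, norm_smul]
    rw [lt_div_iff₀ (by positivity)] at h
    nlinarith [norm_nonneg ((P ^ n) f - f)]

theorem IsLasotaYorke.isCompact_recurrent_inter (hD : IsLasotaYorke P D) (hP : ∀ f, ‖P f‖ ≤ ‖f‖) :
    IsCompact (recurrentSet P ∩ Metric.closedBall 0 1) := by
  obtain ⟨c, hc⟩ := hD.exists_recurrent_ball_subset hP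
  refine ((hD.totallyBounded c).isCompact_of_isClosed (hD.isClosed c)).of_isClosed_subset
    ((isClosed_recurrentSet hP).inter Metric.isClosed_closedBall) ?_
  rintro f ⟨hf, hf1⟩
  exact hc f hf (by simpa using hf1)

/-- The closed unit ball lies in one set of the scale and is closed, hence compact; Riesz's theorem
applies. -/
theorem IsLasotaYorke.finiteDimensional_recurrent (hD : IsLasotaYorke P D)
    (hP : ∀ f, ‖P f‖ ≤ ‖f‖) : FiniteDimensional ℝ (hD.recurrent hP) := by
  refine FiniteDimensional.of_isCompact_closedBall₀ ℝ one_pos ?_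
  rw [Topology.IsEmbedding.subtypeVal.isCompact_iff]
  convert hD.isCompact_recurrent_inter hP using 1
  ext f
  constructor
  · rintro ⟨⟨g, hg⟩, h1, rfl⟩
    exact ⟨hg, by simpa using h1⟩
  · rintro ⟨hf, h1⟩
    exact ⟨⟨f, hf⟩, by simpa using h1, rfl⟩

theorem IsLasotaYorke.recurrent_eq_of_map_eq (hD : IsLasotaYorke P D) (hP : ∀ f, ‖P f‖ ≤ ‖f‖)
    {f g : B} (hf : f ∈ recurrentSet P) (hg : g ∈ recurrentSet P) (h : P f = P g) : f = g := by
  have h1 : f - g ∈ recurrentSet P := (hD.recurrent hP).sub_mem hf hg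
  have h2 := norm_pow_apply_of_recurrent hP h1 1
  rw [pow_one, map_sub, h, sub_self, norm_zero] at h2
  exact sub_eq_zero.1 (norm_eq_zero.1 h2.symm)

/-- An isometry of a finite-dimensional space is onto. -/
theorem IsLasotaYorke.exists_recurrent_preimage (hD : IsLasotaYorke P D) (hP : ∀ f, ‖P f‖ ≤ ‖f‖)
    {y : B} (hy : y ∈ recurrentSet P) : ∃ x ∈ recurrentSet P, P x = y := by
  have := hD.finiteDimensional_recurrent hP
  let Q : hD.recurrent hP →ₗ[ℝ] hD.recurrent hP :=
    (P : B →ₗ[ℝ] B).restrict fun f hf => map_mem_recurrentSet hP hf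
  have hQ : Function.Injective Q := fun f g h =>
    Subtype.ext (hD.recurrent_eq_of_map_eq hP f.2 g.2 (congrArg Subtype.val h))
  obtain ⟨x, hx⟩ := LinearMap.surjective_of_injective hQ ⟨y, hy⟩
  exact ⟨x, x.2, congrArg Subtype.val hx⟩

theorem IsLasotaYorke.exists_recurrent_pow_preimage (hD : IsLasotaYorke P D)
    (hP : ∀ f, ‖P f‖ ≤ ‖f‖) {y : B} (hy : y ∈ recurrentSet P) (n : ℕ) :
    ∃ x ∈ recurrentSet P, (P ^ n) x = y := by
  induction n with
  | zero => exact ⟨y, hy, rfl⟩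
  | succ n ih =>
    obtain ⟨x, hx, hxy⟩ := ih
    obtain ⟨z, hz, hzx⟩ := hD.exists_recurrent_preimage hP hx
    exact ⟨z, hz, by rw [pow_succ, ← hxy, ← hzx]; rfl⟩

/-- Every vector is asymptotic to a recurrent one. -/
theorem IsLasotaYorke.exists_recurrent_asymptotic (hD : IsLasotaYorke P D)
    (hP : ∀ f, ‖P f‖ ≤ ‖f‖) (f : B) :
    ∃ x ∈ recurrentSet P, Tendsto (fun n => (P ^ n) (f - x)) atTop (𝓝 0) := by
  have := hD.finiteDimensional_recurrent hP
  have := FiniteDimensional.proper ℝ (hD.recurrent hP)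
  obtain ⟨y, φ, hφ, hy⟩ := hD.exists_subseq hP f (φ := id)
  have hy : Tendsto (fun i => (P ^ φ i) f) atTop (𝓝 y) := hy
  have hyrec : y ∈ recurrentSet P := by
    intro ε hε n₀
    obtain ⟨i, hi⟩ := exists_gap_of_tendsto hy (half_pos hε)
    have hj : φ i + n₀ ≤ φ (φ i + n₀ + i) := le_trans (by simp only [id]; omega) (hφ.id_le _)
    obtain ⟨d, hd⟩ := Nat.exists_eq_add_of_le hj
    refine ⟨n₀ + d, Nat.le_add_right _ _, ?_⟩
    have h1 := hi _ le_rfl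
    have h2 := hi (φ i + n₀ + i) (by omega)
    have h3 := norm_pow_apply_le hP (n₀ + d) ((P ^ φ i) f - y)
    have e : (P ^ (n₀ + d)) y - y
        = ((P ^ φ (φ i + n₀ + i)) f - y) - (P ^ (n₀ + d)) ((P ^ φ i) f - y) := by
      rw [map_sub, ← pow_add_apply, hd]
      rw [show n₀ + d + φ i = φ i + n₀ + d by omega]
      abel
    rw [e]
    have := norm_sub_le ((P ^ φ (φ i + n₀ + i)) f - y) ((P ^ (n₀ + d)) ((P ^ φ i) f - y))
    linarith
  -- Pulling the limit `y` back by `P ^ φ i` inside the recurrent space gives vectors of norm `‖y‖`;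
  -- a limit point `z` of them shadows `f`.
  choose x hx hxy using fun i => hD.exists_recurrent_pow_preimage hP hyrec (φ i)
  obtain ⟨z, -, ψ, hψ, hz⟩ := (isCompact_closedBall (0 : hD.recurrent hP) ‖y‖).tendsto_subseq
    (x := fun i => (⟨x i, hx i⟩ : hD.recurrent hP)) fun i => by
      rw [mem_closedBall_zero_iff, ← hxy i, norm_pow_apply_of_recurrent hP (hx i)]
      exact le_rfl
  have hz' : Tendsto (fun i => x (ψ i)) atTop (𝓝 (z : B)) :=
    (continuous_subtype_val.tendsto z).comp hz
  refine ⟨z, z.2, ?_⟩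
  rw [tendsto_zero_iff_norm_tendsto_zero]
  -- The norms decrease, so convergence along one subsequence suffices.
  refine (tendsto_iff_tendsto_subseq_of_antitone (antitone_norm_pow_apply hP _)
    (hφ.tendsto_atTop.comp hψ.tendsto_atTop)).2 ?_
  have hlim : Tendsto (fun i => ‖(P ^ φ (ψ i)) f - y‖ + ‖x (ψ i) - z‖) atTop (𝓝 0) := by
    have h1 := tendsto_iff_norm_sub_tendsto_zero.1 (hy.comp hψ.tendsto_atTop)
    have h2 := tendsto_iff_norm_sub_tendsto_zero.1 hz'
    simpa using h1.add h2
  refine squeeze_zero (fun _ => norm_nonneg _) (fun i => ?_) hlim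
  have e : (P ^ φ (ψ i)) (f - z) = ((P ^ φ (ψ i)) f - y) + (P ^ φ (ψ i)) (x (ψ i) - z) := by
    rw [map_sub, map_sub, hxy]
    abel
  simp only [Function.comp_apply]
  rw [e]
  exact (norm_add_le _ _).trans (add_le_add le_rfl (norm_pow_apply_le hP _ _))

/-- The projection onto the recurrent vectors along the vectors with vanishing orbit. -/
theorem IsLasotaYorke.exists_projection (hD : IsLasotaYorke P D) (hP : ∀ f, ‖P f‖ ≤ ‖f‖) :
    ∃ π : B →L[ℝ] hD.recurrent hP, ∀ f, Tendsto (fun n => (P ^ n) (f - π f)) atTop (𝓝 0) := by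
  choose p hp hlim using hD.exists_recurrent_asymptotic hP
  -- Two recurrent vectors asymptotic to `f` differ by a recurrent vector with vanishing orbit,
  -- which is 0; linearity follows from this uniqueness.
  have huniq : ∀ f x, x ∈ recurrentSet P → Tendsto (fun n => (P ^ n) (f - x)) atTop (𝓝 0) →
      p f = x := by
    intro f x hx h
    refine sub_eq_zero.1 (eq_zero_of_recurrent_of_tendsto hP
      ((hD.recurrent hP).sub_mem (hp f) hx) ?_)
    have := h.sub (hlim f)
    simpa [← map_sub] using this
  let π₀ : B →ₗ[ℝ] hD.recurrent hP :=
    { toFun := fun f => ⟨p f, hp f⟩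
      map_add' := fun f g => Subtype.ext <| huniq _ _ ((hD.recurrent hP).add_mem (hp f) (hp g)) (by
        have := (hlim f).add (hlim g)
        simp only [← map_add, add_zero] at this
        convert this using 3
        exact (add_sub_add_comm f g (p f) (p g)))
      map_smul' := fun t f => Subtype.ext <| huniq _ _ ((hD.recurrent hP).smul_mem t (hp f)) (by
        have := (hlim f).const_smul t
        simp only [← map_smul, smul_zero, smul_sub] at this
        exact this) }
  refine ⟨π₀.mkContinuous 1 fun f => ?_, fun f => hlim f⟩
  rw [one_mul]
  refine le_of_forall_pos_le_add fun ε hε => ?_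
  have h0 := (tendsto_zero_iff_norm_tendsto_zero.1 (hlim f)).eventually (gt_mem_nhds hε)
  obtain ⟨n, hn⟩ := h0.exists
  have h1 : ‖p f‖ = ‖(P ^ n) (p f)‖ := (norm_pow_apply_of_recurrent hP (hp f) n).symm
  have e : (P ^ n) (p f) = (P ^ n) f - (P ^ n) (f - p f) := by
    rw [map_sub]; abel
  have h2 := norm_sub_le ((P ^ n) f) ((P ^ n) (f - p f))
  have h3 := norm_pow_apply_le hP n f
  change ‖p f‖ ≤ _
  rw [h1, e]
  linarith

end Contraction

-- Markov operators and the extreme recurrent densities.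

/-- A Markov operator on a Banach lattice whose norm is additive on the positive cone. -/
structure IsMarkov {B : Type*} [NormedAddCommGroup B] [NormedSpace ℝ B] [Lattice B]
    (P : B →L[ℝ] B) : Prop where
  norm_add : ∀ {f g : B}, 0 ≤ f → 0 ≤ g → ‖f + g‖ = ‖f‖ + ‖g‖
  smul_nonneg : ∀ {t : ℝ} {f : B}, 0 ≤ t → 0 ≤ f → 0 ≤ t • f
  map_nonneg : ∀ {f : B}, 0 ≤ f → 0 ≤ P f
  norm_map : ∀ {f : B}, 0 ≤ f → ‖P f‖ = ‖f‖

theorem IsMarkov.abs_map_le {B : Type*} [NormedAddCommGroup B] [NormedSpace ℝ B] [Lattice B]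
    [IsOrderedAddMonoid B] {P : B →L[ℝ] B} (hM : IsMarkov P) (f : B) : |P f| ≤ P |f| := by
  refine sup_le ?_ ?_
  · have := hM.map_nonneg (sub_nonneg.2 (le_abs_self f))
    rwa [map_sub, sub_nonneg] at this
  · have := hM.map_nonneg (sub_nonneg.2 (neg_le_abs f))
    rwa [map_sub, sub_nonneg, map_neg] at this

section Lattice

variable {B : Type*} [NormedAddCommGroup B] [NormedSpace ℝ B] [Lattice B] [HasSolidNorm B]
  [IsOrderedAddMonoid B] {P : B →L[ℝ] B}

theorem IsMarkov.norm_map_le (hM : IsMarkov P) (f : B) : ‖P f‖ ≤ ‖f‖ := by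
  rw [← norm_abs_eq_norm f, ← hM.norm_map (abs_nonneg f), ← norm_abs_eq_norm (P f)]
  exact norm_le_norm_of_abs_le_abs (by
    rw [abs_abs, abs_of_nonneg (hM.map_nonneg (abs_nonneg f))]
    exact hM.abs_map_le f)

/-- The positive vector `P |f| - |P f|` has norm `‖f‖ - ‖P f‖ = 0` by additivity of the norm on the
cone. Hence recurrent vectors are closed under absolute values. -/
theorem IsMarkov.map_abs_of_norm_eq (hM : IsMarkov P) {f : B} (hf : ‖P f‖ = ‖f‖) :
    P |f| = |P f| := by
  have h1 := hM.norm_add (sub_nonneg.2 (hM.abs_map_le f)) (abs_nonneg (P f))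
  rw [sub_add_cancel, hM.norm_map (abs_nonneg f), norm_abs_eq_norm, norm_abs_eq_norm, hf] at h1
  exact sub_eq_zero.1 (norm_eq_zero.1 (by linarith))

theorem IsMarkov.map_abs_recurrent (hM : IsMarkov P) {f : B} (hf : f ∈ recurrentSet P) :
    P |f| = |P f| :=
  hM.map_abs_of_norm_eq (by simpa using norm_pow_apply_of_recurrent hM.norm_map_le hf 1)

theorem IsMarkov.pow_abs_recurrent (hM : IsMarkov P) {f : B} (hf : f ∈ recurrentSet P) (n : ℕ) :
    (P ^ n) |f| = |(P ^ n) f| := by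
  induction n generalizing f with
  | zero => rfl
  | succ n ih =>
    have h1 := ih (map_mem_recurrentSet hM.norm_map_le hf)
    rw [pow_succ]
    change (P ^ n) (P |f|) = |(P ^ n) (P f)|
    rw [hM.map_abs_recurrent hf, h1]

theorem IsMarkov.abs_mem_recurrentSet (hM : IsMarkov P) {f : B} (hf : f ∈ recurrentSet P) :
    |f| ∈ recurrentSet P := by
  intro ε hε n₀
  obtain ⟨n, hn, h⟩ := hf ε hε n₀
  refine ⟨n, hn, ?_⟩
  rw [hM.pow_abs_recurrent hf]
  exact (norm_abs_sub_abs _ _).trans_lt h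

/-- The recurrent densities. -/
def recurrentDensities (P : B →L[ℝ] B) : Set B := {f | f ∈ recurrentSet P ∧ 0 ≤ f ∧ ‖f‖ = 1}

variable [CompleteSpace B] {D : ℝ≥0 → Set B}

theorem isCompact_recurrentDensities (hM : IsMarkov P) (hD : IsLasotaYorke P D) :
    IsCompact (recurrentDensities P) := by
  refine (hD.isCompact_recurrent_inter hM.norm_map_le).of_isClosed_subset ?_ ?_
  · exact (isClosed_recurrentSet hM.norm_map_le).inter
      ((isClosed_le continuous_const continuous_id).inter
        (isClosed_eq continuous_norm continuous_const))
  · rintro f ⟨h1, -, h2⟩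
    exact ⟨h1, by simp [h2]⟩

theorem convex_recurrentDensities (hM : IsMarkov P) (hD : IsLasotaYorke P D) :
    Convex ℝ (recurrentDensities P) := by
  rintro f ⟨hf, hf0, hf1⟩ g ⟨hg, hg0, hg1⟩ a b ha hb hab
  let R := hD.recurrent hM.norm_map_le
  refine ⟨R.add_mem (R.smul_mem a hf) (R.smul_mem b hg),
    add_nonneg (hM.smul_nonneg ha hf0) (hM.smul_nonneg hb hg0), ?_⟩
  rw [hM.norm_add (hM.smul_nonneg ha hf0) (hM.smul_nonneg hb hg0), norm_smul, norm_smul, hf1, hg1,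
    Real.norm_of_nonneg ha, Real.norm_of_nonneg hb, mul_one, mul_one, hab]

theorem normalize_mem_recurrentDensities (hM : IsMarkov P) (hD : IsLasotaYorke P D) {f : B}
    (hf : f ∈ recurrentSet P) (hf0 : 0 ≤ f) (hne : f ≠ 0) :
    ‖f‖⁻¹ • f ∈ recurrentDensities P := by
  refine ⟨(hD.recurrent hM.norm_map_le).smul_mem _ hf,
    hM.smul_nonneg (inv_nonneg.2 (norm_nonneg f)) hf0, ?_⟩
  rw [norm_smul, norm_inv, norm_norm, inv_mul_cancel₀ (norm_ne_zero_iff.2 hne)]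

/-- Extreme recurrent densities are atoms of the lattice of recurrent vectors. -/
theorem eq_norm_smul_of_le_extreme (hM : IsMarkov P) (hD : IsLasotaYorke P D) {e a : B}
    (he : e ∈ (recurrentDensities P).extremePoints ℝ) (ha : a ∈ recurrentSet P) (ha0 : 0 ≤ a)
    (hae : a ≤ e) : a = ‖a‖ • e := by
  have heC := he.1
  have hsum : ‖a‖ + ‖e - a‖ = 1 := by
    rw [← hM.norm_add ha0 (sub_nonneg.2 hae), add_sub_cancel, heC.2.2]
  rcases eq_or_ne a 0 with rfl | hane
  · simp
  rcases eq_or_ne (e - a) 0 with h | hne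
  · rw [← sub_eq_zero.1 h, heC.2.2, one_smul]
  have hea : e - a ∈ recurrentSet P := (hD.recurrent hM.norm_map_le).sub_mem heC.1 ha
  have h1 := normalize_mem_recurrentDensities hM hD ha ha0 hane
  have h2 := normalize_mem_recurrentDensities hM hD hea (sub_nonneg.2 hae) hne
  have h3 : e ∈ openSegment ℝ (‖a‖⁻¹ • a) (‖e - a‖⁻¹ • (e - a)) := by
    refine ⟨‖a‖, ‖e - a‖, norm_pos_iff.2 hane, norm_pos_iff.2 hne, hsum, ?_⟩
    rw [smul_inv_smul₀ (norm_ne_zero_iff.2 hane), smul_inv_smul₀ (norm_ne_zero_iff.2 hne),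
      add_sub_cancel]
  have h4 := he.2 h1 h2 h3
  conv_rhs => rw [← h4]
  rw [smul_inv_smul₀ (norm_ne_zero_iff.2 hane)]

theorem inf_mem_recurrentSet (hM : IsMarkov P) (hD : IsLasotaYorke P D) {f g : B}
    (hf : f ∈ recurrentSet P) (hg : g ∈ recurrentSet P) : f ⊓ g ∈ recurrentSet P := by
  let R := hD.recurrent hM.norm_map_le
  have h1 : (2 : ℝ) • (f ⊓ g) = f + g - |g - f| := by
    rw [← two_nsmul_inf_eq_add_sub_abs_sub, two_nsmul, two_smul]
  have h2 : f ⊓ g = (2 : ℝ)⁻¹ • (f + g - |g - f|) := by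
    rw [← h1, inv_smul_smul₀ two_ne_zero]
  rw [h2]
  exact R.smul_mem _ (R.sub_mem (R.add_mem hf hg) (hM.abs_mem_recurrentSet (R.sub_mem hg hf)))

/-- The infimum is a multiple of both densities; were it nonzero, they would coincide. -/
theorem inf_eq_zero_of_extreme (hM : IsMarkov P) (hD : IsLasotaYorke P D) {e e' : B}
    (he : e ∈ (recurrentDensities P).extremePoints ℝ)
    (he' : e' ∈ (recurrentDensities P).extremePoints ℝ) (hne : e ≠ e') : e ⊓ e' = 0 := by
  have hmem := inf_mem_recurrentSet hM hD he.1.1 he'.1.1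
  have h0 : 0 ≤ e ⊓ e' := le_inf he.1.2.1 he'.1.2.1
  have h1 := eq_norm_smul_of_le_extreme hM hD he hmem h0 inf_le_left
  have h2 := eq_norm_smul_of_le_extreme hM hD he' hmem h0 inf_le_right
  by_contra h
  have h3 : ‖e ⊓ e'‖ • e = ‖e ⊓ e'‖ • e' := h1.symm.trans h2
  exact hne (smul_right_injective B (norm_ne_zero_iff.2 h) h3)

/-- Distinct extreme densities are disjoint, hence at distance 2, which compactness allows only
finitely often. -/
theorem finite_extremePoints_recurrentDensities (hM : IsMarkov P) (hD : IsLasotaYorke P D) :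
    ((recurrentDensities P).extremePoints ℝ).Finite := by
  by_contra hinf
  let x := Set.Infinite.natEmbedding _ hinf
  obtain ⟨a, -, φ, hφ, ha⟩ := (isCompact_recurrentDensities hM hD).tendsto_subseq
    (x := fun n => (x n : B)) fun n => (x n).2.1
  have hc := ha.cauchySeq
  obtain ⟨N, hN⟩ := Metric.cauchySeq_iff'.1 hc 1 one_pos
  have h1 := hN (N + 1) (Nat.le_succ N)
  have hne : (x (φ (N + 1)) : B) ≠ x (φ N) := fun h =>
    (hφ (Nat.lt_succ_self N)).ne' (x.injective (Subtype.ext h))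
  set e := (x (φ (N + 1)) : B)
  set e' := (x (φ N) : B)
  have he : e ∈ (recurrentDensities P).extremePoints ℝ := (x (φ (N + 1))).2
  have he' : e' ∈ (recurrentDensities P).extremePoints ℝ := (x (φ N)).2
  have h2 : |e - e'| = e + e' := by
    have h3 := two_nsmul_inf_eq_add_sub_abs_sub e' e
    rw [inf_comm, inf_eq_zero_of_extreme hM hD he he' hne, smul_zero] at h3
    rw [add_comm]
    exact (sub_eq_zero.1 h3.symm).symm
  have h4 : ‖e - e'‖ = 2 := by
    rw [← norm_abs_eq_norm, h2, hM.norm_add he.1.2.1 he'.1.2.1, he.1.2.2, he'.1.2.2]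
    norm_num
  change dist e e' < 1 at h1
  rw [dist_eq_norm, h4] at h1
  norm_num at h1

/-- `P` maps the recurrent densities bijectively and affinely onto themselves. The preimage of a
density is positive because it has the same image as its absolute value. -/
theorem map_mem_extremePoints (hM : IsMarkov P) (hD : IsLasotaYorke P D) {e : B}
    (he : e ∈ (recurrentDensities P).extremePoints ℝ) :
    P e ∈ (recurrentDensities P).extremePoints ℝ := by
  have hP := hM.norm_map_le
  refine ⟨⟨map_mem_recurrentSet hP he.1.1, hM.map_nonneg he.1.2.1, ?_⟩, ?_⟩
  · rw [hM.norm_map he.1.2.1, he.1.2.2]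
  have hpre : ∀ x ∈ recurrentDensities P, ∃ y ∈ recurrentDensities P, P y = x := by
    rintro x ⟨hx, hx0, hx1⟩
    obtain ⟨y, hy, rfl⟩ := hD.exists_recurrent_preimage hP hx
    have h1 : |y| = y := by
      refine hD.recurrent_eq_of_map_eq hP (hM.abs_mem_recurrentSet hy) hy ?_
      rw [hM.map_abs_recurrent hy, abs_of_nonneg hx0]
    have hy0 : 0 ≤ y := h1 ▸ abs_nonneg y
    exact ⟨y, ⟨hy, hy0, by rw [← hM.norm_map hy0, hx1]⟩, rfl⟩
  intro x hx z hz hseg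
  obtain ⟨x', hx', rfl⟩ := hpre x hx
  obtain ⟨z', hz', rfl⟩ := hpre z hz
  obtain ⟨a, b, ha, hb, hab, h⟩ := hseg
  let R := hD.recurrent hP
  rw [← map_smul, ← map_smul, ← map_add] at h
  have h1 := hD.recurrent_eq_of_map_eq hP
    (R.add_mem (R.smul_mem a hx'.1) (R.smul_mem b hz'.1)) he.1.1 h
  rw [he.2 hx' hz' ⟨a, b, ha, hb, hab, h1⟩]

/-- Krein–Milman puts the densities in the span, which is closed since it is finite-dimensional. A
general `f` is the difference of the positive recurrent vectors `|f| + f` and `|f|`. -/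
theorem recurrent_le_span_extremePoints (hM : IsMarkov P) (hD : IsLasotaYorke P D) {f : B}
    (hf : f ∈ recurrentSet P) :
    f ∈ Submodule.span ℝ ((recurrentDensities P).extremePoints ℝ) := by
  set S := Submodule.span ℝ ((recurrentDensities P).extremePoints ℝ)
  have hfd : FiniteDimensional ℝ S :=
    FiniteDimensional.span_of_finite ℝ (finite_extremePoints_recurrentDensities hM hD)
  have hC : recurrentDensities P ⊆ S := by
    rw [← closure_convexHull_extremePoints (isCompact_recurrentDensities hM hD)
      (convex_recurrentDensities hM hD)]
    exact closure_minimal (convexHull_min Submodule.subset_span S.convex) S.closed_of_finiteDimensional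
  have hpos : ∀ f ∈ recurrentSet P, 0 ≤ f → f ∈ S := by
    intro f hf hf0
    rcases eq_or_ne f 0 with rfl | hne
    · exact S.zero_mem
    · have := S.smul_mem ‖f‖ (hC (normalize_mem_recurrentDensities hM hD hf hf0 hne))
      rwa [smul_inv_smul₀ (norm_ne_zero_iff.2 hne)] at this
  have habs := hM.abs_mem_recurrentSet hf
  have h1 := hpos _ ((hD.recurrent hM.norm_map_le).add_mem habs hf)
    (by simpa using add_le_add_left (neg_le_abs f) f)
  have h2 := S.sub_mem h1 (hpos _ habs (abs_nonneg f))
  simpa using h2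

/-- Spectral decomposition of a Markov operator with a Lasota–Yorke inequality. -/
theorem IsMarkov.exists_decomposition (hM : IsMarkov P) (hD : IsLasotaYorke P D) :
    ∃ (s : Finset B) (lam : s → (B →L[ℝ] ℝ)), (∀ e ∈ s, 0 ≤ e ∧ ‖e‖ = 1 ∧ P e ∈ s) ∧
      (∀ e ∈ s, ∀ e' ∈ s, P e = P e' → e = e') ∧ (∀ e ∈ s, ∀ e' ∈ s, e ≠ e' → e ⊓ e' = 0) ∧
      ∀ f, Tendsto (fun n => (P ^ n) (f - ∑ e : s, lam e f • (e : B))) atTop (𝓝 0) := by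
  have hP := hM.norm_map_le
  have hfin := finite_extremePoints_recurrentDensities hM hD
  set s := hfin.toFinset
  have hs : ∀ {e}, e ∈ s ↔ e ∈ (recurrentDensities P).extremePoints ℝ := hfin.mem_toFinset
  obtain ⟨π, hπ⟩ := hD.exists_projection hP
  let R := hD.recurrent hP
  have : FiniteDimensional ℝ R := hD.finiteDimensional_recurrent hP
  let Φ : (s → ℝ) →ₗ[ℝ] R := Fintype.linearCombination ℝ fun e : s => (⟨e, (hs.1 e.2).1.1⟩ : R)
  have hΦ : ∀ a, (Φ a : B) = ∑ e : s, a e • (e : B) := by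
    intro a
    simp [Φ, Fintype.linearCombination_apply]
  have hsurj : LinearMap.range Φ = ⊤ := by
    rw [LinearMap.range_eq_top]
    rintro ⟨f, hf⟩
    have h1 := recurrent_le_span_extremePoints hM hD hf
    rw [← hfin.coe_toFinset] at h1
    obtain ⟨a, ha⟩ := (Submodule.mem_span_finset'.1 h1)
    exact ⟨a, Subtype.ext ((hΦ a).trans ha)⟩
  -- A linear section supplies coordinates; composed with the projection they are bounded, as the
  -- recurrent space is finite-dimensional.
  obtain ⟨G, hG⟩ := Φ.exists_rightInverse_of_surjective hsurj
  refine ⟨s, fun e => (ContinuousLinearMap.proj (R := ℝ) (φ := fun _ : s => ℝ) e).comp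
    ((LinearMap.toContinuousLinearMap G).comp π), fun e he => ?_, ?_, ?_, fun f => ?_⟩
  · exact ⟨(hs.1 he).1.2.1, (hs.1 he).1.2.2, hs.2 (map_mem_extremePoints hM hD (hs.1 he))⟩
  · exact fun e he e' he' h => hD.recurrent_eq_of_map_eq hP (hs.1 he).1.1 (hs.1 he').1.1 h
  · exact fun e he e' he' hne => inf_eq_zero_of_extreme hM hD (hs.1 he) (hs.1 he') hne
  · have h1 : (∑ e : s, (G (π f)) e • (e : B)) = π f := by
      rw [← hΦ]
      exact congrArg Subtype.val (LinearMap.congr_fun hG (π f))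
    have h2 := hπ f
    rw [← h1] at h2
    exact h2

end Lattice

-- Cycles and existence of the decomposition.

/-- The cycles of an injective self-map of a finite type. -/
theorem exists_cycle_enumeration {s : Type*} [Finite s] {σ : s → s} (hσ : Function.Injective σ) :
    ∃ (l : ℕ) (r : Fin l → ℕ) (e : (Σ i, Fin (r i)) ≃ s), (∀ i, 0 < r i) ∧
      ∀ i j, e ⟨i, finRotate (r i) j⟩ = σ (e ⟨i, j⟩) := by
  classical
  let p : Equiv.Perm s := Equiv.ofBijective σ (Finite.injective_iff_bijective.1 hσ)
  have hp : ∀ x, p x = σ x := fun _ => rfl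
  let Q := Quotient (Equiv.Perm.SameCycle.setoid p)
  obtain ⟨l, ⟨q⟩⟩ := Finite.exists_equiv_fin Q
  let x : Fin l → s := fun i => (q.symm i).out
  let r : Fin l → ℕ := fun i => Function.minimalPeriod p (x i)
  have hr : ∀ i, 0 < r i := fun i => Function.minimalPeriod_pos_of_mem_periodicPts
    (p.injective.mem_periodicPts (x i))
  let F : (Σ i, Fin (r i)) → s := fun a => p^[(a.2 : ℕ)] (x a.1)
  have hq : ∀ (i : Fin l) (j : ℕ), q (Quotient.mk _ (p^[j] (x i))) = i := by
    intro i j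
    have : (Quotient.mk (Equiv.Perm.SameCycle.setoid p) (p^[j] (x i))) = q.symm i := by
      rw [← Quotient.out_eq (q.symm i)]
      refine Quotient.sound (s := Equiv.Perm.SameCycle.setoid p) ?_
      change p.SameCycle _ _
      rw [Equiv.Perm.iterate_eq_pow]
      exact (Equiv.Perm.sameCycle_pow_left).2 (Equiv.Perm.SameCycle.refl _ _)
    rw [this, Equiv.apply_symm_apply]
  have hFi : Function.Injective F := by
    rintro ⟨i, j⟩ ⟨i', j'⟩ h
    have h1 : i = i' := by
      have := congrArg (fun y => q (Quotient.mk (Equiv.Perm.SameCycle.setoid p) y)) h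
      simpa only [F, hq] using this
    subst h1
    have h2 : (j : ℕ) = j' := Function.iterate_injOn_Iio_minimalPeriod j.2 j'.2 h
    rw [Fin.ext h2]
  have hFs : Function.Surjective F := by
    intro y
    let i := q (Quotient.mk _ y)
    have h1 : p.SameCycle (x i) y := by
      have : Quotient.mk (Equiv.Perm.SameCycle.setoid p) (x i)
          = Quotient.mk (Equiv.Perm.SameCycle.setoid p) y := by
        simp only [x, i]
        rw [Quotient.out_eq, Equiv.symm_apply_apply]
      exact Quotient.exact this
    obtain ⟨n, -, hn⟩ := h1.exists_pow_eq'
    refine ⟨⟨i, ⟨n % r i, Nat.mod_lt _ (hr i)⟩⟩, ?_⟩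
    simp only [F, r]
    rw [Function.iterate_mod_minimalPeriod_eq, Equiv.Perm.iterate_eq_pow, hn]
  refine ⟨l, r, Equiv.ofBijective F ⟨hFi, hFs⟩, hr, fun i j => ?_⟩
  change p^[_] (x i) = σ (p^[(j : ℕ)] (x i))
  rw [← hp, ← Function.iterate_succ_apply' p]
  -- Rotation is addition of 1 modulo `r i`, which is the minimal period of the chosen
  -- representative.
  have hval : ((finRotate (r i) j : Fin (r i)) : ℕ) = ((j : ℕ) + 1) % r i := by
    have := j.neZero
    rw [finRotate_apply, Fin.val_add, Fin.val_one', Nat.add_mod_mod]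
  change p^[((finRotate (r i) j : Fin (r i)) : ℕ)] (x i) = _
  rw [hval]
  exact Function.iterate_mod_minimalPeriod_eq

section Existence

variable {X : Type*} [MeasurableSpace X] {T : X → X} {μ : Measure X} [IsFiniteMeasure μ]

theorem isMarkov_transferL (hT : Measure.QuasiMeasurePreserving T μ μ) :
    IsMarkov (transferL hT) where
  norm_add := L1_norm_add_of_nonneg
  smul_nonneg {t f} ht hf := by
    rw [← Lp.coeFn_nonneg] at hf ⊢
    filter_upwards [hf, Lp.coeFn_smul t f] with x h1 h2
    rw [h2]
    exact mul_nonneg ht h1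
  map_nonneg := transferL_nonneg hT
  norm_map := norm_transferL_of_nonneg hT

theorem eLpNorm_transferOp_iterate (hT : Measure.QuasiMeasurePreserving T μ μ) {f : Lp ℝ 1 μ}
    {u : X → ℝ} (h : f =ᵐ[μ] u) (n : ℕ) :
    eLpNorm ((transferOp T μ)^[n] u) 1 μ = ENNReal.ofReal ‖(transferL hT ^ n) f‖ := by
  rw [← eLpNorm_congr_ae (coeFn_transferL_pow_of_ae_eq hT n h), Lp.norm_def,
    ENNReal.ofReal_toReal (Lp.eLpNorm_ne_top _)]

theorem IsLasotaYorke.exists_asymptoticallyPeriodic (hT : Measure.QuasiMeasurePreserving T μ μ)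
    {D : ℝ≥0 → Set (Lp ℝ 1 μ)} (hD : IsLasotaYorke (transferL hT) D) :
    ∃ (l : ℕ) (r : Fin l → ℕ) (g : (i : Fin l) → Fin (r i) → X → ℝ)
      (lam : (i : Fin l) → Fin (r i) → (Lp ℝ 1 μ →L[ℝ] ℝ)),
      IsAsymptoticallyPeriodicWith T μ r g lam := by
  obtain ⟨s, lam, hs, hinj, hdis, hlim⟩ := (isMarkov_transferL hT).exists_decomposition hD
  let σ : s → s := fun e => ⟨transferL hT e, (hs e e.2).2.2⟩
  have hσ : Function.Injective σ := fun a b h =>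
    Subtype.ext (hinj a a.2 b b.2 (congrArg Subtype.val h))
  obtain ⟨l, r, e, hr, he⟩ := exists_cycle_enumeration hσ
  refine ⟨l, r, fun i j => ((e ⟨i, j⟩ : Lp ℝ 1 μ) : X → ℝ), fun i j => lam (e ⟨i, j⟩), hr,
    fun i j => L1.integrable_coeFn _, fun i j => (Lp.coeFn_nonneg _).2 (hs _ (e ⟨i, j⟩).2).1,
    fun i j => ?_, fun p q hpq => ?_, fun i j => ?_, fun f => ?_⟩
  · rw [← L1_norm_eq_integral_of_nonneg (hs _ (e ⟨i, j⟩).2).1, (hs _ (e ⟨i, j⟩).2).2.1]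
  · have h0 := hdis _ (e p).2 _ (e q).2 fun h => hpq (e.injective (Subtype.ext h))
    have h1 := Lp.coeFn_inf (e p : Lp ℝ 1 μ) (e q : Lp ℝ 1 μ)
    rw [h0] at h1
    filter_upwards [h1, Lp.coeFn_zero ℝ 1 μ] with x h1 h2
    rw [h2] at h1
    simp only [Pi.zero_apply, Pi.inf_apply] at h1
    simp only [Pi.zero_apply]
    rcases min_choice ((e p : Lp ℝ 1 μ) x) ((e q : Lp ℝ 1 μ) x) with h | h
    · rw [← h, show min ((e p : Lp ℝ 1 μ) x) ((e q : Lp ℝ 1 μ) x) = 0 from h1.symm, zero_mul]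
    · rw [← h, show min ((e p : Lp ℝ 1 μ) x) ((e q : Lp ℝ 1 μ) x) = 0 from h1.symm, mul_zero]
  · rw [he]
    exact (coeFn_transferL hT _).symm
  · have hsum : (f - ∑ a : s, lam a f • (a : Lp ℝ 1 μ) : Lp ℝ 1 μ) =ᵐ[μ]
        fun x => f x - ∑ i, ∑ j, lam (e ⟨i, j⟩) f * (e ⟨i, j⟩ : Lp ℝ 1 μ) x := by
      have h1 := Lp.coeFn_sub f (∑ a : s, lam a f • (a : Lp ℝ 1 μ))
      have h2 := Lp.coeFn_finsetSum Finset.univ fun a : s => lam a f • (a : Lp ℝ 1 μ)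
      have h3 : ∀ᵐ x ∂μ, ∀ a : s, (lam a f • (a : Lp ℝ 1 μ) : Lp ℝ 1 μ) x
          = lam a f * (a : Lp ℝ 1 μ) x := by
        rw [ae_all_iff]
        exact fun a => Lp.coeFn_smul (lam a f) (a : Lp ℝ 1 μ)
      filter_upwards [h1, h2, h3] with x h1 h2 h3
      rw [h1, Pi.sub_apply, h2, Finset.sum_apply, Finset.sum_congr rfl fun a _ => h3 a,
        ← Equiv.sum_comp e, Fintype.sum_sigma]
    simp only [eLpNorm_transferOp_iterate hT hsum]
    have := ENNReal.tendsto_ofReal (tendsto_zero_iff_norm_tendsto_zero.1 (hlim f))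
    rwa [ENNReal.ofReal_zero] at this

end Existence

-- Exponential decay of the vanishing part.

section Decay

variable {B : Type*} [NormedAddCommGroup B] [NormedSpace ℝ B] {P : B →L[ℝ] B} {D : ℝ≥0 → Set B}

/-- The scale parameter halves every `n₀` steps, so the rate is `θ = 2^(-1/n₀)`; the factor 2 in `C`
absorbs an incomplete block. -/
theorem IsLasotaYorke.exists_geometric_bound (hD : IsLasotaYorke P D) (hP : ∀ f, ‖P f‖ ≤ ‖f‖)
    {c : ℝ≥0} {f : B} (hf : f ∈ D c) (h0 : Tendsto (fun n => (P ^ n) f) atTop (𝓝 0)) :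
    ∃ C θ : ℝ, 0 ≤ C ∧ 0 ≤ θ ∧ θ < 1 ∧ ∀ n, ‖(P ^ n) f‖ ≤ C * θ ^ n := by
  obtain ⟨n₀, hn₀, hhalf⟩ := hD.exists_half hP
  have h1 : ∀ k, (P ^ (n₀ * k)) f ∈ D (c / 2 ^ k) := by
    intro k
    induction k with
    | zero => simpa using hf
    | succ k ih =>
      have h2 := hhalf _ _ ih (by
        have := h0.comp (tendsto_add_atTop_nat (n₀ * k))
        simpa only [Function.comp_def, pow_add_apply] using this)
      rw [← pow_add_apply] at h2
      rwa [show n₀ * (k + 1) = n₀ + n₀ * k by ring, pow_succ, ← div_div]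
  have hn₀' : (n₀ : ℝ) ≠ 0 := by positivity
  have hθ : ((1 / 2 : ℝ) ^ (1 / n₀ : ℝ)) ^ n₀ = 1 / 2 := by
    rw [← Real.rpow_natCast, ← Real.rpow_mul (by norm_num), one_div_mul_cancel hn₀', Real.rpow_one]
  have hθ0 : 0 ≤ (1 / 2 : ℝ) ^ (1 / n₀ : ℝ) := by positivity
  have hθ1 : (1 / 2 : ℝ) ^ (1 / n₀ : ℝ) < 1 :=
    Real.rpow_lt_one (by norm_num) (by norm_num) (by positivity)
  refine ⟨2 * c, (1 / 2 : ℝ) ^ (1 / n₀ : ℝ), by positivity, hθ0, hθ1, fun n => ?_⟩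
  set θ := (1 / 2 : ℝ) ^ (1 / n₀ : ℝ)
  have h3 : ‖(P ^ n) f‖ ≤ c / 2 ^ (n / n₀) := by
    refine (antitone_norm_pow_apply hP f (Nat.mul_div_le n n₀)).trans ?_
    have := hD.norm_le (h1 (n / n₀))
    exact_mod_cast this
  have h4 : (1 / 2 : ℝ) ≤ θ ^ (n % n₀) := by
    rw [← hθ]
    exact pow_le_pow_of_le_one hθ0 hθ1.le (Nat.mod_lt _ hn₀).le
  have h5 : θ ^ n = (1 / 2) ^ (n / n₀) * θ ^ (n % n₀) := by
    rw [← hθ, ← pow_mul, ← pow_add, Nat.div_add_mod]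
  have h6 : (0 : ℝ) ≤ (1 / 2) ^ (n / n₀) := by positivity
  refine h3.trans ?_
  rw [h5, div_eq_mul_one_div, ← one_div_pow]
  calc (c : ℝ) * (1 / 2) ^ (n / n₀) = 2 * c * ((1 / 2) ^ (n / n₀) * (1 / 2)) := by ring
    _ ≤ _ := by gcongr

/-- A vector that is asymptotically fixed by a power of `P` has its asymptotic part in some `D c`. -/
theorem IsLasotaYorke.exists_mem_of_tendsto (hD : IsLasotaYorke P D) (hP : ∀ f, ‖P f‖ ≤ ‖f‖)
    {c : ℝ≥0} {f φ : B} (hf : f ∈ D c)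
    (h0 : Tendsto (fun n => (P ^ n) (f - φ)) atTop (𝓝 0)) {R : ℕ} (hR : 0 < R)
    (hφ : (P ^ R) φ = φ) : (∃ c', f - φ ∈ D c') ∧
      Tendsto (fun k => (P ^ (R * k)) f) atTop (𝓝 φ) := by
  have h1 : ∀ k, (P ^ (R * k)) φ = φ := by
    intro k
    induction k with
    | zero => simp
    | succ k ih => rw [mul_add, mul_one, pow_add_apply, hφ, ih]
  have h2 : Tendsto (fun k => (P ^ (R * k)) f) atTop (𝓝 φ) := by
    have h3 := (h0.comp (tendsto_id.const_mul_atTop' hR)).add_const φ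
    simpa only [Function.comp_def, id, map_sub, h1, sub_add_cancel, zero_add] using h3
  refine ⟨?_, h2⟩
  obtain ⟨N, L, K, hN, hb⟩ := hD.exists_orbit_bound hP
  have h3 : φ ∈ D (L * c + K * ‖f‖₊) := by
    refine (hD.isClosed _).mem_of_tendsto h2 (Eventually.of_forall fun k => ?_)
    refine hD.mono ?_ (hb c f hf (R * k))
    gcongr
    exact div_le_self (zero_le) (one_le_pow₀ one_le_two)
  have h4 := hD.add_mem hf (hD.smul_mem (-1) h3)
  rw [neg_one_smul, ← sub_eq_add_neg] at h4
  exact ⟨_, h4⟩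

end Decay

-- The periodic part and the passage from `μ` to `ν`.

theorem finRotate_iterate_self (n : ℕ) (j : Fin n) : (finRotate n)^[n] j = j := by
  have h : ∀ k : ℕ, (((finRotate n)^[k] j : Fin n) : ℕ) = (j + k) % n := by
    intro k
    induction k with
    | zero => simp [Nat.mod_eq_of_lt j.2]
    | succ k ih =>
      have := j.neZero
      rw [Function.iterate_succ_apply', finRotate_apply, Fin.val_add, Fin.val_one',
        Nat.add_mod_mod, ih, Nat.mod_add_mod, add_assoc]
  ext
  rw [h, Nat.add_mod_right, Nat.mod_eq_of_lt j.2]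

section Measure

variable {X : Type*} [MeasurableSpace X] {T : X → X} {μ : Measure X} [IsFiniteMeasure μ]

/-- Each cycle length divides the product of all of them. This uses only the axioms of a
decomposition, so it holds for every one, not just the one constructed above. -/
theorem IsAsymptoticallyPeriodicWith.exists_periodic {l : ℕ} {r : Fin l → ℕ}
    {g : (i : Fin l) → Fin (r i) → X → ℝ} {lam : (i : Fin l) → Fin (r i) → (Lp ℝ 1 μ →L[ℝ] ℝ)}
    (hA : IsAsymptoticallyPeriodicWith T μ r g lam) (hT : Measure.QuasiMeasurePreserving T μ μ)
    (f : Lp ℝ 1 μ) : ∃ φ, (transferL hT ^ (∏ i, r i)) φ = φ ∧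
      Tendsto (fun n => (transferL hT ^ n) (f - φ)) atTop (𝓝 0) := by
  let G : (i : Fin l) → Fin (r i) → Lp ℝ 1 μ := fun i j => (hA.integrable i j).toL1 _
  have hG : ∀ i j, G i j =ᵐ[μ] g i j := fun i j => (hA.integrable i j).coeFn_toL1
  have hstep : ∀ i j, transferL hT (G i j) = G i (finRotate (r i) j) := by
    intro i j
    refine Lp.ext ((coeFn_transferL hT _).trans ?_)
    rw [transferOp_congr T (hG i j)]
    exact (hA.cyclic i j).trans (hG i _).symm
  have hpow : ∀ i j k, (transferL hT ^ k) (G i j) = G i ((finRotate (r i))^[k] j) := by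
    intro i j k
    induction k with
    | zero => rfl
    | succ k ih =>
      rw [add_comm, pow_add_apply, ih, pow_one, hstep, add_comm, Function.iterate_succ_apply']
  have hper : ∀ i j, (transferL hT ^ (∏ i, r i)) (G i j) = G i j := by
    intro i j
    obtain ⟨m, hm⟩ := Finset.dvd_prod_of_mem r (Finset.mem_univ i)
    rw [hpow, hm, Function.iterate_mul,
      Function.iterate_fixed (finRotate_iterate_self (r i) j)]
  refine ⟨∑ i, ∑ j, lam i j f • G i j, ?_, ?_⟩
  · simp only [map_sum, map_smul, hper]
  · have hsum : (f - ∑ i, ∑ j, lam i j f • G i j : Lp ℝ 1 μ) =ᵐ[μ]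
        fun x => f x - ∑ i, ∑ j, lam i j f * g i j x := by
      have h1 := Lp.coeFn_sub f (∑ i, ∑ j, lam i j f • G i j)
      have h2 := Lp.coeFn_finsetSum Finset.univ fun i => ∑ j, lam i j f • G i j
      have h3 : ∀ᵐ x ∂μ, ∀ i, (∑ j, lam i j f • G i j : Lp ℝ 1 μ) x
          = (∑ j, ((lam i j f • G i j : Lp ℝ 1 μ) : X → ℝ)) x := by
        rw [ae_all_iff]
        exact fun i => Lp.coeFn_finsetSum Finset.univ fun j => lam i j f • G i j
      have h4 : ∀ᵐ x ∂μ, ∀ i j, (lam i j f • G i j : Lp ℝ 1 μ) x = lam i j f * g i j x := by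
        simp only [ae_all_iff]
        intro i j
        filter_upwards [Lp.coeFn_smul (lam i j f) (G i j), hG i j] with x a b
        rw [a, Pi.smul_apply, b, smul_eq_mul]
      filter_upwards [h1, h2, h3, h4] with x h1 h2 h3 h4
      rw [h1, Pi.sub_apply, h2, Finset.sum_apply]
      simp only [h3, Finset.sum_apply, h4]
    have h := hA.tendsto f
    simp only [eLpNorm_transferOp_iterate hT hsum] at h
    rw [tendsto_zero_iff_norm_tendsto_zero]
    have h5 := (ENNReal.tendsto_toReal ENNReal.zero_ne_top).comp h
    simpa only [Function.comp_def, ENNReal.toReal_ofReal (norm_nonneg _), ENNReal.toReal_zero]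
      using h5

/-- `L¹(ν)` embeds isometrically into `L¹(μ)` by multiplication with the density of `ν`. -/
theorem exists_density_embedding {ν : Measure X} [IsFiniteMeasure ν] (hνμ : ν ≪ μ) :
    ∃ (J : Lp ℝ 1 ν →ₗᵢ[ℝ] Lp ℝ 1 μ) (ρ : X → ℝ),
      (∀ (f : Lp ℝ 1 ν) (u : X → ℝ), f =ᵐ[ν] u → J f =ᵐ[μ] fun x => ρ x * u x) ∧
      ∀ (f : Lp ℝ 1 ν) (A : Set X), MeasurableSet A →
        ∫ x in A, J f x ∂μ = ∫ x in A, f x ∂ν := by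
  let ρ : X → ℝ≥0 := fun x => (ν.rnDeriv μ x).toNNReal
  have hρ : Measurable ρ := (Measure.measurable_rnDeriv ν μ).ennreal_toNNReal
  have hν : ν = μ.withDensity (fun x => (ρ x : ℝ≥0∞)) := by
    conv_lhs => rw [← Measure.withDensity_rnDeriv_eq ν μ hνμ]
    refine withDensity_congr_ae ?_
    filter_upwards [Measure.rnDeriv_ne_top ν μ] with x hx
    exact (ENNReal.coe_toNNReal hx).symm
  clear_value ρ
  subst hν
  have hJ : ∀ f : Lp ℝ 1 (μ.withDensity (fun x => (ρ x : ℝ≥0∞))),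
      withDensitySMulLI (E := ℝ) μ hρ f =ᵐ[μ] fun x => ρ x * f x := fun f =>
    (memL1_smul_of_L1_withDensity hρ f).coeFn_toLp
  refine ⟨withDensitySMulLI μ hρ, fun x => ρ x, fun f u h => ?_, fun f A hA => ?_⟩
  · filter_upwards [hJ f, (ae_withDensity_iff hρ.coe_nnreal_ennreal).1 h] with x h1 h2
    rw [h1]
    by_cases h0 : ρ x = 0
    · simp [h0]
    · rw [h2 (by simpa using h0)]
  · rw [setIntegral_withDensity_eq_setIntegral_smul hρ _ hA]
    exact integral_congr_ae (ae_restrict_of_ae (hJ f))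

/-- For one step, both sides integrate over `A` to the `ν`-integral of `f` over the preimage of `A`.
-/
theorem map_transferL_of_setIntegral {ν : Measure X} [IsFiniteMeasure ν]
    (hT : Measure.QuasiMeasurePreserving T μ μ) (hTν : Measure.QuasiMeasurePreserving T ν ν)
    {J : Lp ℝ 1 ν →ₗᵢ[ℝ] Lp ℝ 1 μ}
    (hJ : ∀ (f : Lp ℝ 1 ν) (A : Set X), MeasurableSet A →
        ∫ x in A, J f x ∂μ = ∫ x in A, f x ∂ν) (n : ℕ) (f : Lp ℝ 1 ν) :
    J ((transferL hTν ^ n) f) = (transferL hT ^ n) (J f) := by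
  have h1 : ∀ f, J (transferL hTν f) = transferL hT (J f) := by
    intro f
    refine Lp.ext (Integrable.ae_eq_of_forall_setIntegral_eq _ _ (L1.integrable_coeFn _)
      (L1.integrable_coeFn _) fun A hA _ => ?_)
    rw [hJ _ A hA, setIntegral_transferL hTν f hA, setIntegral_transferL hT _ hA,
      hJ _ _ (hT.measurable hA)]
  induction n with
  | zero => rfl
  | succ n ih => rw [add_comm, pow_add_apply, pow_add_apply, ← ih, pow_one, pow_one, h1]

end Measure

-- Invariant sets, fixed points and `L²` bounds.

section Invariant

variable {X : Type*} [MeasurableSpace X] {T : X → X} {ν : Measure X}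

theorem abs_setIntegral_le_norm (A : Set X) (f : Lp ℝ 1 ν) : |∫ x in A, f x ∂ν| ≤ ‖f‖ := by
  rw [L1.norm_eq_integral_norm]
  exact (norm_integral_le_integral_norm _).trans
    (setIntegral_le_integral (L1.integrable_coeFn f).norm
      (Eventually.of_forall fun _ => norm_nonneg _))

theorem setIntegral_Lp_sub (A : Set X) (f g : Lp ℝ 1 ν) :
    ∫ x in A, (f - g : Lp ℝ 1 ν) x ∂ν = ∫ x in A, f x ∂ν - ∫ x in A, g x ∂ν := by
  rw [← integral_sub (L1.integrable_coeFn f).integrableOn (L1.integrable_coeFn g).integrableOn]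
  exact integral_congr_ae (ae_restrict_of_ae (Lp.coeFn_sub f g))

theorem aestronglyMeasurable_transferOp_iterate {u : X → ℝ} (hu : AEStronglyMeasurable u ν)
    (n : ℕ) : AEStronglyMeasurable ((transferOp T ν)^[n] u) ν := by
  cases n with
  | zero => exact hu
  | succ n =>
    rw [Function.iterate_succ_apply']
    exact (transferOp_integrable T ν _).1

/-- The interpolation `u² ≤ b |u|` transfers exponential decay from `L¹` to `L²`. -/
theorem eLpNorm_two_le_of_abs_le {u : X → ℝ} {b : ℝ} (hb : ∀ᵐ x ∂ν, |u x| ≤ b) :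
    eLpNorm u 2 ν ≤ (ENNReal.ofReal b * eLpNorm u 1 ν) ^ (1 / 2 : ℝ) := by
  rw [eLpNorm_eq_lintegral_rpow_enorm_toReal two_ne_zero ENNReal.ofNat_ne_top,
    eLpNorm_one_eq_lintegral_enorm, ← lintegral_const_mul' _ _ ENNReal.ofReal_ne_top]
  simp only [ENNReal.toReal_ofNat]
  refine ENNReal.rpow_le_rpow (lintegral_mono_ae ?_) (by norm_num)
  filter_upwards [hb] with x hx
  rw [ENNReal.rpow_two, sq]
  gcongr
  rw [Real.enorm_eq_ofReal_abs]
  exact ENNReal.ofReal_le_ofReal hx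

theorem tsum_mul_eLpNorm_sum_lt_top {a : ℕ → X → ℝ} (ha : ∀ k, AEStronglyMeasurable (a k) ν)
    (hsum : ∑' k, eLpNorm (a k) 2 ν ≠ ⊤) :
    ∑' n : ℕ, ENNReal.ofReal (((n : ℝ) + 1) ^ (-(3 / 2) : ℝ)) *
      eLpNorm (∑ k ∈ Finset.range (n + 1), a k) 2 ν < ⊤ := by
  have h1 : Summable fun n : ℕ => ((n : ℝ) + 1) ^ (-(3 / 2) : ℝ) := by
    have := (summable_nat_add_iff 1).2
      (Real.summable_nat_rpow (p := (-(3 / 2) : ℝ)).2 (by norm_num))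
    simpa only [Nat.cast_add, Nat.cast_one] using this
  calc _ ≤ ∑' n : ℕ, ENNReal.ofReal (((n : ℝ) + 1) ^ (-(3 / 2) : ℝ)) *
        ∑' k, eLpNorm (a k) 2 ν := by
        refine ENNReal.tsum_le_tsum fun n => ?_
        gcongr
        exact (eLpNorm_sum_le (fun k _ => ha k) one_le_two).trans (ENNReal.sum_le_tsum _)
    _ < ⊤ := by
        rw [ENNReal.tsum_mul_right]
        exact ENNReal.mul_lt_top h1.tsum_ofReal_lt_top hsum.lt_top

variable [IsFiniteMeasure ν]

theorem setIntegral_transferL_pow_of_invariant (hT : Measure.QuasiMeasurePreserving T ν ν)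
    {A : Set X} (hA : MeasurableSet A) (hTA : T ⁻¹' A =ᵐ[ν] A) (n : ℕ) (f : Lp ℝ 1 ν) :
    ∫ x in A, (transferL hT ^ n) f x ∂ν = ∫ x in A, f x ∂ν := by
  induction n with
  | zero => rfl
  | succ n ih =>
    rw [add_comm, pow_add_apply, pow_one, setIntegral_transferL hT _ hA,
      setIntegral_congr_set hTA, ih]

/-- The set where a nonnegative fixed point of the transfer operator is positive is invariant. -/
theorem preimage_pos_ae_eq_of_fixed (hν : MeasurePreserving T ν ν) {v : Lp ℝ 1 ν} (h0 : 0 ≤ v)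
    (hv : transferL hν.quasiMeasurePreserving v = v) :
    T ⁻¹' {x | 0 < v x} =ᵐ[ν] {x | 0 < v x} := by
  rw [← Lp.coeFn_nonneg] at h0
  set A : Set X := {x | 0 < v x}
  have hA : MeasurableSet A := measurableSet_lt measurable_const (Lp.stronglyMeasurable v).measurable
  have h1 : ∫ x in T ⁻¹' Aᶜ, v x ∂ν = 0 := by
    rw [← setIntegral_transferL hν.quasiMeasurePreserving v hA.compl, hv]
    refine setIntegral_eq_zero_of_ae_eq_zero ?_
    filter_upwards [h0] with x h0 hx
    exact le_antisymm (not_lt.1 hx) h0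
  rw [setIntegral_eq_zero_iff_of_nonneg_ae (ae_restrict_of_ae h0)
    (L1.integrable_coeFn v).integrableOn, Filter.EventuallyEq,
    ae_restrict_iff' (hν.measurable hA.compl)] at h1
  have h2 : A ≤ᵐ[ν] T ⁻¹' A := by
    filter_upwards [h1] with x hx hxA
    by_contra hc
    exact (ne_of_gt hxA) (hx hc)
  exact (ae_eq_of_ae_subset_of_measure_ge h2 (hν.measure_preimage hA.nullMeasurableSet).le
    hA.nullMeasurableSet (measure_ne_top _ _)).symm

/-- Equality of norms makes `|u|` fixed as well, so the positivity set of `|u| + u` is invariant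
modulo null sets. There `u` is positive with integral 0, so the set is null. -/
theorem nonpos_of_fixed_of_setIntegral_eq_zero (hν : MeasurePreserving T ν ν) {u : Lp ℝ 1 ν}
    (hu : transferL hν.quasiMeasurePreserving u = u)
    (hA : ∀ A, MeasurableSet A → T ⁻¹' A =ᵐ[ν] A → ∫ x in A, u x ∂ν = 0) : u ≤ 0 := by
  have habs : transferL hν.quasiMeasurePreserving |u| = |u| := by
    have := (isMarkov_transferL hν.quasiMeasurePreserving).map_abs_of_norm_eq
      (congrArg norm hu)
    rwa [hu] at this
  have hv0 : 0 ≤ |u| + u := neg_le_iff_add_nonneg.1 (neg_le_abs u)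
  have hinv := preimage_pos_ae_eq_of_fixed hν hv0 (by rw [map_add, habs, hu])
  set v : Lp ℝ 1 ν := |u| + u
  set A : Set X := {x | 0 < v x}
  have hAm : MeasurableSet A :=
    measurableSet_lt measurable_const (Lp.stronglyMeasurable v).measurable
  have hval : ∀ᵐ x ∂ν, v x = |u x| + u x := by
    filter_upwards [Lp.coeFn_add |u| u, Lp.coeFn_abs u] with x h1 h2
    rw [h1, Pi.add_apply, h2]
  have h1 := hA A hAm hinv
  have hpos : ∀ᵐ x ∂ν, x ∈ A → 0 < u x := by
    filter_upwards [hval] with x hx hxA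
    by_contra hc
    have h3 : 0 < v x := hxA
    rw [hx, abs_of_nonpos (not_lt.1 hc)] at h3
    simp at h3
  rw [setIntegral_eq_zero_iff_of_nonneg_ae ((ae_restrict_iff' hAm).2
      (hpos.mono fun x hx hxA => (hx hxA).le)) (L1.integrable_coeFn u).integrableOn,
    Filter.EventuallyEq, ae_restrict_iff' hAm] at h1
  rw [← Lp.coeFn_le]
  filter_upwards [h1, hpos, hval, Lp.coeFn_zero ℝ 1 ν] with x h1 h2 h3 h4
  rw [h4]
  by_contra hc
  have hc' : 0 < u x := not_le.1 hc
  have hxA : x ∈ A := by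
    change 0 < v x
    rw [h3]
    exact add_pos_of_nonneg_of_pos (abs_nonneg _) hc'
  exact hc'.ne' (h1 hxA)

theorem eq_zero_of_fixed_of_setIntegral_eq_zero (hν : MeasurePreserving T ν ν) {u : Lp ℝ 1 ν}
    (hu : transferL hν.quasiMeasurePreserving u = u)
    (hA : ∀ A, MeasurableSet A → T ⁻¹' A =ᵐ[ν] A → ∫ x in A, u x ∂ν = 0) : u = 0 := by
  refine le_antisymm (nonpos_of_fixed_of_setIntegral_eq_zero hν hu hA) (neg_nonpos.1 ?_)
  refine nonpos_of_fixed_of_setIntegral_eq_zero hν (by rw [map_neg, hu]) fun A hAm hTA => ?_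
  have := setIntegral_Lp_sub A 0 u
  rw [zero_sub, hA A hAm hTA, sub_zero] at this
  rw [this]
  refine (integral_congr_ae (ae_restrict_of_ae (Lp.coeFn_zero ℝ 1 ν))).trans ?_
  simp

/-- A set invariant modulo null sets is replaced by a strictly invariant one, which the conditional
expectation sees. -/
theorem setIntegral_eq_zero_of_condExp_invariants (hν : MeasurePreserving T ν ν) {h : X → ℝ}
    (hh : Integrable h ν) (hcond : ν[h | MeasurableSpace.invariants T] =ᵐ[ν] 0) {A : Set X}
    (hA : MeasurableSet A) (hTA : T ⁻¹' A =ᵐ[ν] A) : ∫ x in A, h x ∂ν = 0 := by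
  obtain ⟨t, ht, htA, hinv⟩ :=
    hν.quasiMeasurePreserving.exists_preimage_eq_of_preimage_ae hA.nullMeasurableSet hTA
  rw [← setIntegral_congr_set htA,
    ← setIntegral_condExp (MeasurableSpace.invariants_le T) hh
      (MeasurableSpace.measurableSet_invariants.2 ⟨ht, hinv⟩),
    integral_congr_ae (ae_restrict_of_ae hcond)]
  simp

/-- The orbit sum of the periodic part vanishes when the conditional expectation does. -/
theorem sum_pow_apply_eq_zero (hν : MeasurePreserving T ν ν) {H w : Lp ℝ 1 ν}
    (hH : ∀ A, MeasurableSet A → T ⁻¹' A =ᵐ[ν] A → ∫ x in A, H x ∂ν = 0) {R : ℕ}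
    (hw : (transferL hν.quasiMeasurePreserving ^ R) w = w)
    (hlim : Tendsto (fun n => (transferL hν.quasiMeasurePreserving ^ n) (H - w)) atTop (𝓝 0)) :
    ∑ i ∈ Finset.range R, (transferL hν.quasiMeasurePreserving ^ i) w = 0 := by
  set Q := transferL hν.quasiMeasurePreserving
  -- Integrals over invariant sets do not change under `Q`, so `|∫_A w| = |∫_A Qⁿ(H - w)|`, which
  -- tends to 0.
  have hwA : ∀ A, MeasurableSet A → T ⁻¹' A =ᵐ[ν] A → ∫ x in A, w x ∂ν = 0 := by
    intro A hA hTA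
    have h1 : ∀ n, |∫ x in A, w x ∂ν| ≤ ‖(Q ^ n) (H - w)‖ := by
      intro n
      have := abs_setIntegral_le_norm A ((Q ^ n) (H - w))
      rwa [setIntegral_transferL_pow_of_invariant hν.quasiMeasurePreserving hA hTA,
        setIntegral_Lp_sub, hH A hA hTA, zero_sub, abs_neg] at this
    have h2 := ge_of_tendsto' (tendsto_zero_iff_norm_tendsto_zero.1 hlim) h1
    exact abs_eq_zero.1 (le_antisymm h2 (abs_nonneg _))
  have hstep : ∀ i, Q ((Q ^ i) w) = (Q ^ (i + 1)) w := fun i => by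
    rw [add_comm, pow_add_apply, pow_one]
  -- `Q` shifts the orbit sum by one, and `Q ^ R w = w` closes the cycle, so the sum is fixed.
  refine eq_zero_of_fixed_of_setIntegral_eq_zero hν ?_ fun A hA hTA => ?_
  · change Q _ = _
    rw [map_sum]
    simp only [hstep]
    have h1 := Finset.sum_range_succ' (fun i => (Q ^ i) w) R
    rw [Finset.sum_range_succ, hw] at h1
    simpa using h1.symm
  · have h1 := Lp.coeFn_finsetSum (Finset.range R) fun i => (Q ^ i) w
    rw [integral_congr_ae (ae_restrict_of_ae h1)]
    simp only [Finset.sum_apply]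
    rw [integral_finsetSum _ fun i _ => (L1.integrable_coeFn _).integrableOn]
    refine Finset.sum_eq_zero fun i _ => ?_
    rw [setIntegral_transferL_pow_of_invariant hν.quasiMeasurePreserving hA hTA, hwA A hA hTA]

theorem transferOp_comp (hν : MeasurePreserving T ν ν) {φ : X → ℝ} (hφ : Integrable φ ν) :
    transferOp T ν (φ ∘ T) =ᵐ[ν] φ := by
  refine transferOp_ae_eq_of_setIntegral hν.quasiMeasurePreserving
    (hν.integrable_comp_of_integrable hφ) hφ fun A hA => ?_
  conv_lhs => rw [← hν.map_eq]
  exact setIntegral_map hA (by rw [hν.map_eq]; exact hφ.1) hν.aemeasurable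

theorem transferOp_iterate_comp_iterate (hν : MeasurePreserving T ν ν) {φ : X → ℝ}
    (hφ : Integrable φ ν) (k : ℕ) : (transferOp T ν)^[k] (φ ∘ T^[k]) =ᵐ[ν] φ := by
  induction k with
  | zero => rfl
  | succ k ih =>
    rw [Function.iterate_succ_apply, Function.iterate_succ, ← Function.comp_assoc]
    refine (transferOp_iterate_congr T (transferOp_comp hν ?_) k).trans ih
    exact (hν.iterate k).integrable_comp_of_integrable hφ

/-- Positivity together with the fact that an invariant measure makes constants fixed. -/
theorem abs_transferOp_iterate_le (hν : MeasurePreserving T ν ν) {u : X → ℝ} {b : ℝ}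
    (hu : Integrable u ν) (hb : ∀ᵐ x ∂ν, |u x| ≤ b) (n : ℕ) :
    ∀ᵐ x ∂ν, |(transferOp T ν)^[n] u x| ≤ b := by
  have hstep : ∀ u : X → ℝ, Integrable u ν → (∀ᵐ x ∂ν, |u x| ≤ b) →
      ∀ᵐ x ∂ν, |transferOp T ν u x| ≤ b := by
    intro u hu hb
    have hc : Integrable (fun _ : X => b) ν := integrable_const b
    have h1 := transferOp_add hν.quasiMeasurePreserving (hc.sub hu.abs) hu.abs
    rw [sub_add_cancel] at h1
    have h2 := transferOp_nonneg hν.quasiMeasurePreserving (hc.sub hu.abs) (by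
      filter_upwards [hb] with x hx
      exact sub_nonneg.2 hx)
    have h3 : transferOp T ν (fun _ => b) =ᵐ[ν] fun _ => b :=
      transferOp_comp (φ := fun _ => b) hν hc
    filter_upwards [h1, h2, h3, abs_transferOp_le hν.quasiMeasurePreserving hu] with x h1 h2 h3 h4
    rw [h3, Pi.add_apply] at h1
    simp only [Pi.zero_apply] at h2
    linarith
  induction n generalizing u with
  | zero => exact hb
  | succ n ih =>
    rw [Function.iterate_succ_apply]
    exact ih (transferOp_integrable T ν u) (hstep u hu hb)

end Invariant

-- Block sums.

theorem abs_blockSum_le {X : Type*} (T : X → X) {h : X → ℝ} {b : ℝ} (hb : ∀ x, |h x| ≤ b) (R : ℕ) (x : X) :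
    |blockSum T h R x| ≤ (1 / Real.sqrt R) * (R * b) := by
  rw [blockSum, abs_mul, abs_of_nonneg (by positivity : (0 : ℝ) ≤ 1 / Real.sqrt R)]
  gcongr
  refine (Finset.abs_sum_le_sum_abs _ _).trans ?_
  refine (Finset.sum_le_card_nsmul _ _ b fun k _ => hb _).trans ?_
  simp

section BlockSum

variable {X : Type*} [MeasurableSpace X] {T : X → X} {ν : Measure X}

theorem integrable_blockSum (hν : MeasurePreserving T ν ν) {h : X → ℝ} (hh : Integrable h ν)
    (R : ℕ) : Integrable (blockSum T h R) ν :=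
  (integrable_finsetSum _ fun k _ =>
    (hν.iterate k).integrable_comp_of_integrable hh).const_mul _

variable [IsFiniteMeasure ν]

/-- The first `k` of the `R` steps undo the composition with `T^[k]`, leaving `R - k`; reversing the
order of summation writes this number as `i + 1`. -/
theorem transferL_pow_blockSum (hν : MeasurePreserving T ν ν) {h : X → ℝ} (hh : Integrable h ν)
    (R : ℕ) :
    (transferL hν.quasiMeasurePreserving ^ R) ((integrable_blockSum hν hh R).toL1 _)
      = (1 / Real.sqrt R) • ∑ i ∈ Finset.range R,
        (transferL hν.quasiMeasurePreserving ^ (i + 1)) (hh.toL1 h) := by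
  set Q := transferL hν.quasiMeasurePreserving
  have hint : ∀ k, Integrable (h ∘ T^[k]) ν := fun k =>
    (hν.iterate k).integrable_comp_of_integrable hh
  have hcomp : ∀ k, (Q ^ k) ((hint k).toL1 _) = hh.toL1 h := by
    intro k
    refine Lp.ext ((coeFn_transferL_pow_of_ae_eq hν.quasiMeasurePreserving k
      (hint k).coeFn_toL1).trans ?_)
    exact (transferOp_iterate_comp_iterate hν hh k).trans hh.coeFn_toL1.symm
  have hblock : (integrable_blockSum hν hh R).toL1 _
      = (1 / Real.sqrt R) • ∑ k ∈ Finset.range R, (hint k).toL1 _ := by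
    refine Lp.ext ((integrable_blockSum hν hh R).coeFn_toL1.trans ?_)
    have h1 : ∀ᵐ x ∂ν, ∀ k, (hint k).toL1 _ x = h (T^[k] x) :=
      ae_all_iff.2 fun k => (hint k).coeFn_toL1
    filter_upwards [Lp.coeFn_smul (1 / Real.sqrt R) (∑ k ∈ Finset.range R, (hint k).toL1 _),
      Lp.coeFn_finsetSum (Finset.range R) fun k => (hint k).toL1 _, h1] with x h2 h3 h4
    rw [h2, Pi.smul_apply, h3, Finset.sum_apply, smul_eq_mul, blockSum]
    simp only [h4]
  rw [hblock, map_smul, map_sum, ← Finset.sum_range_reflect]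
  congr 1
  refine Finset.sum_congr rfl fun i hi => ?_
  have hi' := Finset.mem_range.1 hi
  have e : R = (i + 1) + (R - 1 - i) := by omega
  conv_lhs => rw [e]
  rw [pow_add_apply]
  conv_lhs => rw [← e]
  rw [hcomp]

/-- The contribution of `w` is `Q` applied to its vanishing orbit sum, so only `h - w` remains. -/
theorem norm_transferL_pow_blockSum_le (hν : MeasurePreserving T ν ν) {h : X → ℝ}
    (hh : Integrable h ν) {R : ℕ} {w : Lp ℝ 1 ν}
    (hw : ∑ i ∈ Finset.range R, (transferL hν.quasiMeasurePreserving ^ i) w = 0) (n : ℕ) :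
    ‖(transferL hν.quasiMeasurePreserving ^ (n + R)) ((integrable_blockSum hν hh R).toL1 _)‖
      ≤ (1 / Real.sqrt R) * (R * ‖(transferL hν.quasiMeasurePreserving ^ n) (hh.toL1 h - w)‖) := by
  set Q := transferL hν.quasiMeasurePreserving
  have hQ := (isMarkov_transferL hν.quasiMeasurePreserving).norm_map_le
  have h1 : (Q ^ (n + R)) ((integrable_blockSum hν hh R).toL1 _)
      = (1 / Real.sqrt R) • ∑ i ∈ Finset.range R, (Q ^ (i + 1)) ((Q ^ n) (hh.toL1 h - w)) := by
    have h2 : ∑ i ∈ Finset.range R, (Q ^ (i + 1)) w = 0 := by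
      have := congrArg Q hw
      rw [map_sum, map_zero] at this
      simpa only [pow_succ', mul_apply_eq_comp, Function.comp_apply] using this
    have h3 : ∑ i ∈ Finset.range R, (Q ^ (i + 1)) (hh.toL1 h)
        = ∑ i ∈ Finset.range R, (Q ^ (i + 1)) (hh.toL1 h - w) := by
      simp only [map_sub, Finset.sum_sub_distrib, h2, sub_zero]
    rw [pow_add_apply, transferL_pow_blockSum hν hh, h3, map_smul, map_sum]
    simp only [pow_apply_comm Q n, Q]
  rw [h1, norm_smul, Real.norm_of_nonneg (by positivity)]
  gcongr
  refine (norm_sum_le _ _).trans ((Finset.sum_le_card_nsmul _ _ _ fun i _ =>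
    norm_pow_apply_le hQ (i + 1) _).trans ?_)
  simp

theorem tsum_eLpNorm_two_ne_top (hν : MeasurePreserving T ν ν) {u : X → ℝ} (hu : Integrable u ν)
    {b : ℝ} (hb : ∀ x, |u x| ≤ b) {R : ℕ} {C θ : ℝ} (hC : 0 ≤ C) (hθ0 : 0 ≤ θ) (hθ1 : θ < 1)
    (hbound : ∀ k, ‖(transferL hν.quasiMeasurePreserving ^ (R * (k + 1))) (hu.toL1 u)‖
      ≤ C * θ ^ k) :
    ∑' k, eLpNorm ((transferOp T ν)^[R * k] u) 2 ν ≠ ⊤ := by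
  have h1 : ∀ n, eLpNorm ((transferOp T ν)^[n] u) 2 ν ≤ (ENNReal.ofReal b *
      ENNReal.ofReal ‖(transferL hν.quasiMeasurePreserving ^ n) (hu.toL1 u)‖) ^ (1 / 2 : ℝ) := by
    intro n
    rw [← eLpNorm_transferOp_iterate hν.quasiMeasurePreserving hu.coeFn_toL1]
    exact eLpNorm_two_le_of_abs_le
      (abs_transferOp_iterate_le hν hu (Eventually.of_forall hb) n)
  have h2 : ∀ n, eLpNorm ((transferOp T ν)^[n] u) 2 ν ≠ ⊤ := fun n =>
    ne_top_of_le_ne_top (ENNReal.rpow_ne_top_of_nonneg (by norm_num)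
      (ENNReal.mul_ne_top ENNReal.ofReal_ne_top ENNReal.ofReal_ne_top)) (h1 n)
  -- The decay is available only after one full block; the term `k = 0` is merely finite.
  rw [tsum_eq_zero_add' ENNReal.summable]
  refine ENNReal.add_ne_top.2 ⟨h2 _, ?_⟩
  set d : ℝ≥0∞ := (ENNReal.ofReal b * ENNReal.ofReal C) ^ (1 / 2 : ℝ)
  have hd : d ≠ ⊤ := ENNReal.rpow_ne_top_of_nonneg (by norm_num)
    (ENNReal.mul_ne_top ENNReal.ofReal_ne_top ENNReal.ofReal_ne_top)
  set q : ℝ≥0∞ := ENNReal.ofReal θ ^ (1 / 2 : ℝ)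
  have hq : q < 1 := ENNReal.rpow_lt_one (by simpa using hθ1) (by norm_num)
  have h3 : ∀ k, eLpNorm ((transferOp T ν)^[R * (k + 1)] u) 2 ν ≤ d * q ^ k := by
    intro k
    refine (h1 _).trans ?_
    have e : d * q ^ k
        = (ENNReal.ofReal b * (ENNReal.ofReal C * ENNReal.ofReal θ ^ k)) ^ (1 / 2 : ℝ) := by
      rw [← mul_assoc, ENNReal.mul_rpow_of_nonneg _ _ (by norm_num), ← ENNReal.rpow_natCast,
        ← ENNReal.rpow_natCast, ← ENNReal.rpow_mul, ← ENNReal.rpow_mul, mul_comm (k : ℝ)]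
    rw [e]
    refine ENNReal.rpow_le_rpow ?_ (by norm_num)
    gcongr
    rw [← ENNReal.ofReal_pow hθ0, ← ENNReal.ofReal_mul hC]
    exact ENNReal.ofReal_le_ofReal (hbound k)
  refine ne_top_of_le_ne_top ?_ (ENNReal.tsum_le_tsum h3)
  rw [ENNReal.tsum_mul_left, ENNReal.tsum_geometric]
  exact ENNReal.mul_ne_top hd (ENNReal.inv_ne_top.2 (tsub_pos_of_lt hq).ne')

end BlockSum

-- Assembling the summability estimate.

section Main

variable {X : Type*} [LinearOrder X] [TopologicalSpace X] [OrderTopology X]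
  [MeasurableSpace X] [BorelSpace X] {μ : Measure X} [IsProbabilityMeasure μ] {T : X → X}

/-- The part of `h` in `L¹(ν)` that is asymptotically periodic; the rest decays exponentially. -/
theorem exists_periodic_part {ν : Measure X} [IsProbabilityMeasure ν]
    (hT : Measure.QuasiMeasurePreserving T μ μ) (hν : MeasurePreserving T ν ν) (hνμ : ν ≪ μ)
    (hD : IsLasotaYorke (transferL hT) fun c => closure (bvSet μ c)) {R : ℕ} (hR : 0 < R)
    (hper : ∀ f : Lp ℝ 1 μ, ∃ φ, (transferL hT ^ R) φ = φ ∧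
      Tendsto (fun n => (transferL hT ^ n) (f - φ)) atTop (𝓝 0))
    {h : X → ℝ} (hvar : zVar h < ⊤) (hh : Integrable h ν) :
    ∃ w : Lp ℝ 1 ν, (transferL hν.quasiMeasurePreserving ^ R) w = w ∧
      ∃ C θ : ℝ, 0 ≤ C ∧ 0 ≤ θ ∧ θ < 1 ∧
        ∀ n, ‖(transferL hν.quasiMeasurePreserving ^ n) (hh.toL1 h - w)‖ ≤ C * θ ^ n := by
  have hP := (isMarkov_transferL hT).norm_map_le
  obtain ⟨J, ρ, hJ, hJint⟩ := exists_density_embedding hνμ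
  have hcomm := map_transferL_of_setIntegral hT hν.quasiMeasurePreserving hJint
  have hone : Integrable (fun _ : X => (1 : ℝ)) ν := integrable_const 1
  -- The image of 1 is the density of `ν`. It is fixed, hence recurrent, and has norm at most 1.
  obtain ⟨c, hc⟩ : ∃ c, J (hone.toL1 _) ∈ closure (bvSet μ c) := by
    obtain ⟨c, hc⟩ := hD.exists_recurrent_ball_subset hP
    refine ⟨c, hc _ (fun ε hε n₀ => ⟨n₀, le_rfl, ?_⟩) ?_⟩
    · have h1 : (transferL hν.quasiMeasurePreserving ^ n₀) (hone.toL1 _) = hone.toL1 _ := by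
        refine Lp.ext ((coeFn_transferL_pow_of_ae_eq hν.quasiMeasurePreserving n₀
          hone.coeFn_toL1).trans ?_)
        exact (transferOp_iterate_comp_iterate (φ := fun _ => 1) hν hone n₀).trans
          hone.coeFn_toL1.symm
      rw [← hcomm, h1, sub_self, norm_zero]
      exact hε
    · rw [J.norm_map, L1.norm_eq_integral_norm]
      refine (integral_congr_ae (hone.coeFn_toL1.fun_comp norm)).trans_le ?_
      simp
  have hF : J (hh.toL1 h) ∈ closure (bvSet μ ((2 * zVar h).toNNReal * c)) := by
    refine mem_closure_bvSet_of_mul hvar hc ?_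
    filter_upwards [hJ _ _ hh.coeFn_toL1, hJ _ _ hone.coeFn_toL1] with x h1 h2
    rw [h1, h2, mul_one, mul_comm]
  obtain ⟨φ, hφ, hlim⟩ := hper (J (hh.toL1 h))
  obtain ⟨⟨c', hc'⟩, hφlim⟩ := hD.exists_mem_of_tendsto hP hF hlim hR hφ
  -- `φ` is a limit of images `J (Q^(Rk) h)`, and an isometric embedding of a complete space has
  -- closed range.
  obtain ⟨w, rfl⟩ : φ ∈ Set.range J := by
    refine J.isometry.isClosedEmbedding.isClosed_range.mem_of_tendsto hφlim
      (Eventually.of_forall fun k => ⟨_, hcomm (R * k) (hh.toL1 h)⟩)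
  refine ⟨w, J.injective (by rw [hcomm, hφ]), ?_⟩
  obtain ⟨C, θ, hC, hθ0, hθ1, hbound⟩ := hD.exists_geometric_bound hP hc' hlim
  refine ⟨C, θ, hC, hθ0, hθ1, fun n => ?_⟩
  rw [← J.norm_map, hcomm, map_sub]
  exact hbound n

theorem blockSummability_of_isLasotaYorke {ν : Measure X} [IsProbabilityMeasure ν]
    (hT : Measure.QuasiMeasurePreserving T μ μ) (hν : MeasurePreserving T ν ν) (hνμ : ν ≪ μ)
    (hD : IsLasotaYorke (transferL hT) fun c => closure (bvSet μ c)) {R : ℕ} (hR : 0 < R)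
    (hper : ∀ f : Lp ℝ 1 μ, ∃ φ, (transferL hT ^ R) φ = φ ∧
      Tendsto (fun n => (transferL hT ^ n) (f - φ)) atTop (𝓝 0))
    {h : X → ℝ} (hvar : zVar h < ⊤) (hcond : ν[h | MeasurableSpace.invariants T] =ᵐ[ν] 0) :
    BlockSummability T ν h R := by
  have hh : Integrable h ν := integrable_of_zVar_lt_top hvar ν
  obtain ⟨w, hw, C, θ, hC, hθ0, hθ1, hbound⟩ :=
    exists_periodic_part hT hν hνμ hD hR hper hvar hh
  have hlim : Tendsto (fun n => (transferL hν.quasiMeasurePreserving ^ n) (hh.toL1 h - w))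
      atTop (𝓝 0) := by
    refine squeeze_zero_norm hbound ?_
    simpa using (tendsto_pow_atTop_nhds_zero_of_lt_one hθ0 hθ1).const_mul C
  have hsum := sum_pow_apply_eq_zero hν (fun A hA hTA => by
    rw [integral_congr_ae (ae_restrict_of_ae hh.coeFn_toL1)]
    exact setIntegral_eq_zero_of_condExp_invariants hν hh hcond hA hTA) hw hlim
  have hint := integrable_blockSum hν hh R
  refine tsum_mul_eLpNorm_sum_lt_top
    (fun k => aestronglyMeasurable_transferOp_iterate hint.1 (R * k)) ?_
  -- One block is `R` iterates, so the rate per block is `θ ^ R`; the factor in `C` comes from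
  -- `norm_transferL_pow_blockSum_le`.
  refine tsum_eLpNorm_two_ne_top hν hint (abs_blockSum_le T (abs_le_of_zVar_lt_top hvar) R)
    (C := 1 / Real.sqrt R * (R * C)) (by positivity) (pow_nonneg hθ0 R)
    (pow_lt_one₀ hθ0 hθ1 hR.ne') fun k => ?_
  rw [mul_add, mul_one]
  refine (norm_transferL_pow_blockSum_le hν hh hsum (R * k)).trans ?_
  rw [mul_assoc, mul_assoc, ← pow_mul]
  gcongr
  exact hbound _

end Main

end

theorem mainTheorem8 {X : Type*} [ConditionallyCompleteLinearOrder X] [TopologicalSpace X]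
    [OrderTopology X] [MeasurableSpace X] [BorelSpace X]
    (μ : Measure X) [IsProbabilityMeasure μ] [μ.Regular] (T : X → X) (V : Set X)
    (hT : IsPiecewiseUniformlyExpanding T μ V)
    (ν : Measure X) [IsProbabilityMeasure ν] (hν : MeasurePreserving T ν ν) (hνμ : ν ≪ μ)
    (h : X → ℝ) (hBV : BoundedVariationOn h Set.univ)
    (hcond : ν[h | MeasurableSpace.invariants T] =ᵐ[ν] 0) :
    (∃ (l : ℕ) (r : Fin l → ℕ) (g : (i : Fin l) → Fin (r i) → X → ℝ)
      (lam : (i : Fin l) → Fin (r i) → (Lp ℝ 1 μ →L[ℝ] ℝ)),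
      IsAsymptoticallyPeriodicWith T μ r g lam) ∧
    ∀ (l : ℕ) (r : Fin l → ℕ) (g : (i : Fin l) → Fin (r i) → X → ℝ)
      (lam : (i : Fin l) → Fin (r i) → (Lp ℝ 1 μ →L[ℝ] ℝ)),
      IsAsymptoticallyPeriodicWith T μ r g lam →
        BlockSummability T ν h (∏ i, r i) := by
  obtain ⟨𝒵, w, c, hI⟩ := hT.exists_weightedBranchSystem
  have hD := hI.isLasotaYorke hT.nonsingular
  refine ⟨hD.exists_asymptoticallyPeriodic hT.nonsingular, fun l r g lam hA => ?_⟩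
  exact blockSummability_of_isLasotaYorke hT.nonsingular hν hνμ hD
    (Finset.prod_pos fun i _ => hA.length_pos i) (hA.exists_periodic hT.nonsingular)
    (zVar_lt_top_of_boundedVariationOn hBV) hcond
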